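/- Fix a finite set $\Lambda$ of edge labels with arities $\mathrm{ar}\colon\Lambda\to\mathbb N$. A graph is a finite $\Lambda$-hypergraph: each edge carries a label $\ell$ and a sequence of $\mathrm{ar}(\ell)$ nodes. A partial morphism $G\rightharpoonup H$ is a pair of partial maps on nodes and edges that preserves labels and connections and that is defined on all nodes incident to an edge on which it is defined. Pushouts are taken in the category of graphs and partial morphisms. A rule is a partial morphism $r\colon L\rightharpoonup R$. A match is a total morphism $m\colon L\to G$ that is conflict-free with respect to $r$ (whenever $m(x)=m(y)$, $r(x)$ and $r(y)$ are both defined or both undefined), and it rewrites $G$ to $H$ if $H$ is the pushout object of $r$ and $m$. A graph transformation system (GTS) is a finite set of rules; $\Rightarrow$ denotes the rewriting relation it generates on the set of all graphs. We write $G\subseteq H$ if, up to isomorphism, $G$ arises from $H$ by a sequence of deletions of edges and isolated nodes; a subgraph morphism is a partial morphism that is surjective and is injective where it is defined. For $k\in\mathbb N$ let $\mathcal G_k$ be the set of graphs all of whose undirected paths (without repeated nodes or edges) have length at most $k$. For a set $I$ of graphs let $\uparrow I$ be its upward closure with respect to $\subseteq$, $\mathrm{Pred}(I)=\{G\mid \exists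 H\in I\colon G\Rightarrow H\}$, $\mathrm{Pred}_k(I)=\mathrm{Pred}(I)\cap\mathcal G_k$, and let $\Rightarrow_k$ be the restriction of $\Rightarrow$ to $\mathcal G_k\times\mathcal G_k$. Algorithms work on codes of finite graphs, computability is Turing computability, and sets of graphs are finite or computable up to isomorphism. \textbf{Proposition.} (a) Subgraph morphisms satisfy the following conditions. \begin{itemize} \item Representation: $\subseteq$ is a quasi-order, $G\subseteq H$ and $H\subseteq G$ hold together if and only if $G$ and $H$ are isomorphic, $H\subseteq G$ if and only if there is a subgraph morphism $G\rightharpoonup H$, and subgraph morphisms are closed under composition. \item Preservation by total pushouts: if $\mu\colon G_0\rightharpoonup G_1$ is a subgraph morphism, $g\colon G_0\to G_2$ is total and $g'\colon G_1\rightharpoonup G_3$, $\mu'\colon G_2\rightharpoonup G_3$ is the pushout of $\mu$ and $g$, then $\mu'$ is a subgraph morphism. \item Pushout closure: if $m\colon L\to G$ is total and conflict-free with respect to $r\colon L\rightharpoonup R$, if $m'\colon R\rightharpoonup H$, $r'\colon G\rightharpoonup H$ is the pushout of $r$ and $m$, and if $\mu\colon H\rightharpoonup S$ is a subgraph morphism,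 then there are subgraph morphisms $\mu_R\colon R\rightharpoonup R'$, $\mu_G\colon G\rightharpoonup G'$ and morphisms $n\colon R'\to S$, $s\colon G'\rightharpoonup S$ with $n\circ\mu_R=\mu\circ m'$ and $s\circ\mu_G=\mu\circ r'$ such that $n,s$ is the pushout of $\mu_R\circ r$ and $\mu_G\circ m$, the morphisms $n$ and $\mu_G\circ m$ are total, and $\mu_G\circ m$ is conflict-free with respect to $r$. \end{itemize} (b) For every rule $r\colon L\rightharpoonup R$ and every total co-match $m'\colon R\to S$ the set of $\subseteq$-minimal pushout complement objects (the minimal graphs among the graphs $G$ that admit a total, conflict-free $m\colon L\to G$ and some $r'\colon G\rightharpoonup S$ such that $m',r'$ is the pushout of $r,m$) is finite, and it is computable from $(r,m')$. (c) For every $k$, every GTS is a $\mathcal G_k$-restricted well-structured transition system with respect to $\subseteq$: $\mathcal G_k$ is decidable and downward closed, $\subseteq$ is a quasi-order and a well-quasi-order on $\mathcal G_k$, and $G\subseteq G'$, $G\Rightarrow H$ imply $G'\Rightarrow^*H'$ for some $H'\supseteq H$. The order $\subseteq$ is decidable. The system has an effective pred-basis: an algorithm computes from a graph $G$ a finite basis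 of $\uparrow\mathrm{Pred}(\uparrow\{G\})$. It also has an effective $\mathcal G_k$-pred-basis: an algorithm computes from $G\in\mathcal G_k$ a finite basis, contained in $\mathcal G_k$, of $\uparrow\mathrm{Pred}_k(\uparrow\{G\})$. Consequently the following hold. \begin{enumerate} \item[(i)] If $\mathcal G_k$ is the set of all graphs, then the general coverability problem (given $G,H$, does $G\Rightarrow^*H'$ hold for some $H'\supseteq H$?) and the restricted coverability problem (given $G,H\in\mathcal G_k$, does $G\Rightarrow_k^*H'$ hold for some $H'\supseteq H$?) coincide and are decidable. \item[(ii)] If $\mathcal G_k$ is closed under $\Rightarrow$, then the restricted coverability problem is decidable. \item[(iii)] Let $B\subseteq\mathcal G_k$ be finite, let $\mathrm{pb}_k$ assign to each $G\in\mathcal G_k$ a finite basis, contained in $\mathcal G_k$, of $\uparrow\mathrm{Pred}_k(\uparrow\{G\})$, and let $I_0=B$, $I_{n+1}=I_n\cup\mathrm{pb}_k(I_n)$. Then $\uparrow I_m=\uparrow I_{m+1}$ for some $m$. For every such $m$: if $G\in\uparrow I_m$, then $G\Rightarrow^*H$ for some $H\in\uparrow B$; if $G\notin\uparrow I_m$,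 then there is no $H\in\uparrow B$ with $G\Rightarrow_k^*H$. A finite basis of the limit $\uparrow I_m$ can be computed from $B$. \item[(iv)] Let $B$ be any finite set of graphs, let $\mathrm{pb}$ assign to each graph $G$ a finite basis of $\uparrow\mathrm{Pred}(\uparrow\{G\})$, and let $I_0=B$, $I_{n+1}=I_n\cup\mathrm{pb}(I_n)$. If $\uparrow I_m=\uparrow I_{m+1}$, then for every graph $G$: $G\Rightarrow^*H$ for some $H\in\uparrow B$ if and only if $G\in\uparrow I_m$. A finite basis of the limit $\uparrow I_m$ can be computed from $B$ by an algorithm that halts whenever such an $m$ exists. \end{enumerate} -/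

import Mathlib

namespace GTS

/-! ## Restricted well-structured transition systems -/

section WSTS

universe u

/-- The upward closure of a set of states with respect to `le`. -/
def upClosure {S : Type u} (le : S → S → Prop) (Y : Set S) : Set S :=
  {x | ∃ y ∈ Y, le y x}

/-- The direct predecessors of a set of states. -/
def pred {S : Type u} (step : S → S → Prop) (I : Set S) : Set S :=
  {s | ∃ s' ∈ I, step s s'}

/-- The direct predecessors that lie in `Q`. -/
def predIn {S : Type u} (step : S → S → Prop) (Q : Set S) (I : Set S) : Set S :=
  pred step I ∩ Q

/-- The transition relation restricted to `Q × Q`. -/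
def stepIn {S : Type u} (step : S → S → Prop) (Q : Set S) (s t : S) : Prop :=
  s ∈ Q ∧ t ∈ Q ∧ step s t

/-- `s` covers a state of `I`: finitely many (possibly zero) transitions lead from `s` into `I`. -/
def CoversSet {S : Type u} (step : S → S → Prop) (s : S) (I : Set S) : Prop :=
  ∃ s' ∈ I, Relation.ReflTransGen step s s'

/-- `s` covers `t`: some state above `t` is reachable from `s`. -/
def Covers {S : Type u} (step le : S → S → Prop) (s t : S) : Prop :=
  ∃ s', Relation.ReflTransGen step s s' ∧ le t s'

/-- The `Q`-restricted well-structured transition systems.  States are presented to algorithms by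
codes `c : C`, the code `c` denoting the state `ρ c`. -/
structure IsRestrictedWSTS {S : Type u} {C : Type} [Primcodable C] (ρ : C → S)
    (step le : S → S → Prop) (Q : Set S) : Prop where
  downward_closed : ∀ s t, le s t → t ∈ Q → s ∈ Q
  mem_decidable : ComputablePred fun c : C => ρ c ∈ Q
  le_refl : ∀ s, le s s
  le_trans : ∀ s t r, le s t → le t r → le s r
  wqo : ∀ x : ℕ → S, (∀ n, x n ∈ Q) → ∃ i j, i < j ∧ le (x i) (x j)
  compatible : ∀ s₁ s₂ t₁, le s₁ t₁ → step s₁ s₂ →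
    ∃ t₂, Relation.ReflTransGen step t₁ t₂ ∧ le s₂ t₂

/-- The order is decidable. -/
def DecidableOrder {S : Type u} {C : Type} [Primcodable C] (ρ : C → S)
    (le : S → S → Prop) : Prop :=
  ComputablePred fun p : C × C => le (ρ p.1) (ρ p.2)

/-- The set of states denoted by a finite list of codes. -/
def statesOf {S : Type u} {C : Type} (ρ : C → S) (l : List C) : Set S :=
  {s | ∃ c ∈ l, ρ c = s}

/-- Effective pred-basis: an algorithm which computes from a state `s` a finite basis
of `↑ Pred (↑ {s})`. -/
def HasEffectivePredBasis {S : Type u} {C : Type} [Primcodable C] (ρ : C → S)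
    (step le : S → S → Prop) : Prop :=
  ∃ pb : C → List C, Computable pb ∧
    ∀ c, upClosure le (statesOf ρ (pb c)) = upClosure le (pred step (upClosure le {ρ c}))

/-- Effective `Q`-pred-basis: an algorithm which computes from a state `q ∈ Q` a finite basis
of `↑ Pred_Q (↑ {q})`, consisting of elements of `Q` (so that it can be iterated). -/
def HasEffectiveQPredBasis {S : Type u} {C : Type} [Primcodable C] (ρ : C → S)
    (step le : S → S → Prop) (Q : Set S) : Prop :=
  ∃ pb : C → List C, Computable pb ∧ ∀ c, ρ c ∈ Q →
    statesOf ρ (pb c) ⊆ Q ∧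
    upClosure le (statesOf ρ (pb c)) = upClosure le (predIn step Q (upClosure le {ρ c}))

/-- `pb` assigns to every state `s` a finite basis of `↑ Pred (↑ {s})`. -/
def IsPredBasis {S : Type u} (step le : S → S → Prop) (pb : S → Set S) : Prop :=
  ∀ s, (pb s).Finite ∧
    upClosure le (pb s) = upClosure le (pred step (upClosure le {s}))

/-- `pb` assigns to every `q ∈ Q` a finite basis, contained in `Q`, of `↑ Pred_Q (↑ {q})`. -/
def IsQPredBasis {S : Type u} (step le : S → S → Prop) (Q : Set S) (pb : S → Set S) : Prop :=
  ∀ q ∈ Q, (pb q).Finite ∧ pb q ⊆ Q ∧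
    upClosure le (pb q) = upClosure le (predIn step Q (upClosure le {q}))

/-- The backward search: `I₀ = B` and `Iₙ₊₁ = Iₙ ∪ pb Iₙ`. -/
def backSeq {S : Type u} (pb : S → Set S) (B : Set S) : ℕ → Set S
  | 0 => B
  | n + 1 => backSeq pb B n ∪ ⋃ s ∈ backSeq pb B n, pb s

/-- The upward closures of the backward search do not change from step `m` to step `m + 1`. -/
def StationaryAt {S : Type u} (le : S → S → Prop) (pb : S → Set S) (B : Set S) (m : ℕ) : Prop :=
  upClosure le (backSeq pb B m) = upClosure le (backSeq pb B (m + 1))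

/-- The general coverability problem is decidable. -/
def GeneralCoverabilityDecidable {S : Type u} {C : Type} [Primcodable C] (ρ : C → S)
    (step le : S → S → Prop) : Prop :=
  ComputablePred fun p : C × C => Covers step le (ρ p.1) (ρ p.2)

/-- The restricted coverability problem, whose instances are pairs of states of `Q`,
is decidable. -/
def RestrictedCoverabilityDecidable {S : Type u} {C : Type} [Primcodable C] (ρ : C → S)
    (step le : S → S → Prop) (Q : Set S) : Prop :=
  ∃ d : C × C → Bool, Computable d ∧ ∀ s t : C, ρ s ∈ Q → ρ t ∈ Q →
    (d (s, t) = true ↔ Covers (stepIn step Q) le (ρ s) (ρ t))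

end WSTS

/-! ## Hypergraphs and partial morphisms -/

/-- Finite hypergraphs with edge labels in `Λ`, where `ar` gives the arity of a label. -/
structure Hypergraph (Λ : Type) (ar : Λ → ℕ) : Type 1 where
  V : Type
  E : Type
  finite_V : Finite V
  finite_E : Finite E
  /-- the sequence of nodes an edge is connected to -/
  conn : E → List V
  label : E → Λ
  length_conn : ∀ e, (conn e).length = ar (label e)

variable {Λ : Type} {ar : Λ → ℕ}

/-- Partial hypergraph morphisms.  The last condition says that the morphism is defined on all
nodes incident to `e` and maps their sequence to the one of `e'`. -/
structure PMor (G H : Hypergraph Λ ar) where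
  onV : G.V → Option H.V
  onE : G.E → Option H.E
  label_eq : ∀ e e', onE e = some e' → G.label e = H.label e'
  conn_eq : ∀ e e', onE e = some e' → (G.conn e).map onV = (H.conn e').map some

namespace PMor

/-- Composition `ψ ∘ φ` of partial morphisms. -/
def comp {G H K : Hypergraph Λ ar} (ψ : PMor H K) (φ : PMor G H) : PMor G K where
  onV v := (φ.onV v).bind ψ.onV
  onE e := (φ.onE e).bind ψ.onE
  label_eq e e' h := by
    obtain ⟨d, hd, hd'⟩ := Option.bind_eq_some_iff.1 h
    exact (φ.label_eq e d hd).trans (ψ.label_eq d e' hd')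
  conn_eq e e' h := by
    obtain ⟨d, hd, hd'⟩ := Option.bind_eq_some_iff.1 h
    have h1 : (G.conn e).map (fun v => (φ.onV v).bind ψ.onV)
        = ((G.conn e).map φ.onV).map (fun o => o.bind ψ.onV) := by
      rw [List.map_map]; rfl
    rw [h1, φ.conn_eq e d hd, List.map_map, ← ψ.conn_eq d e' hd']
    rfl

/-- The morphism is defined everywhere. -/
def Total {G H : Hypergraph Λ ar} (φ : PMor G H) : Prop :=
  (∀ v, ∃ w, φ.onV v = some w) ∧ (∀ e, ∃ d, φ.onE e = some d)

/-- The morphism is injective on the elements on which it is defined. -/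
def Injective {G H : Hypergraph Λ ar} (φ : PMor G H) : Prop :=
  (∀ v v' w, φ.onV v = some w → φ.onV v' = some w → v = v') ∧
  (∀ e e' d, φ.onE e = some d → φ.onE e' = some d → e = e')

/-- The morphism is surjective. -/
def Surjective {G H : Hypergraph Λ ar} (φ : PMor G H) : Prop :=
  (∀ w, ∃ v, φ.onV v = some w) ∧ (∀ d, ∃ e, φ.onE e = some d)

/-- Subgraph morphisms: injective where defined, and surjective. -/
def IsSubgraphMor {G H : Hypergraph Λ ar} (φ : PMor G H) : Prop :=
  φ.Injective ∧ φ.Surjective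

/-- `m : L → G` is conflict-free with respect to `r : L ⇀ R`: two elements identified by `m`
are both in the domain of `r` or both outside. -/
def ConflictFree {L R G : Hypergraph Λ ar} (m : PMor L G) (r : PMor L R) : Prop :=
  (∀ x y z, m.onV x = some z → m.onV y = some z → ((r.onV x).isSome ↔ (r.onV y).isSome)) ∧
  (∀ x y z, m.onE x = some z → m.onE y = some z → ((r.onE x).isSome ↔ (r.onE y).isSome))

end PMor

/-- Two graphs are isomorphic if there is a total bijective morphism between them. -/
def Isomorphic (G H : Hypergraph Λ ar) : Prop :=
  ∃ φ : PMor G H, φ.Total ∧ φ.Injective ∧ φ.Surjective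

/-- The square with `φ : G₀ ⇀ G₁`, `ψ : G₀ ⇀ G₂`, `ψ' : G₁ ⇀ G₃`, `φ' : G₂ ⇀ G₃` is a pushout. -/
def IsPushout {G₀ G₁ G₂ G₃ : Hypergraph Λ ar} (φ : PMor G₀ G₁) (ψ : PMor G₀ G₂)
    (ψ' : PMor G₁ G₃) (φ' : PMor G₂ G₃) : Prop :=
  ψ'.comp φ = φ'.comp ψ ∧
  ∀ (K : Hypergraph Λ ar) (ψ'' : PMor G₁ K) (φ'' : PMor G₂ K), ψ''.comp φ = φ''.comp ψ →
    ∃! η : PMor G₃ K, η.comp ψ' = ψ'' ∧ η.comp φ' = φ''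

/-! ## Graph transformation systems -/

/-- A rewriting rule is a partial morphism from a left-hand side to a right-hand side. -/
structure Rule (Λ : Type) (ar : Λ → ℕ) : Type 1 where
  L : Hypergraph Λ ar
  R : Hypergraph Λ ar
  map : PMor L R

/-- `G` is rewritten to `H` by the rule `ρ` (single-pushout rewriting with total,
conflict-free matches). -/
def Rule.Rewrites (ρ : Rule Λ ar) (G H : Hypergraph Λ ar) : Prop :=
  ∃ (m : PMor ρ.L G) (m' : PMor ρ.R H) (r' : PMor G H),
    m.Total ∧ m.ConflictFree ρ.map ∧ IsPushout ρ.map m m' r'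

/-- The transition relation, on all graphs, generated by a set of rules. -/
def Step (𝓡 : Set (Rule Λ ar)) (G H : Hypergraph Λ ar) : Prop :=
  ∃ ρ ∈ 𝓡, ρ.Rewrites G H

/-! ## The subgraph order -/

namespace Hypergraph

/-- Deletion of an edge. -/
def delEdge (G : Hypergraph Λ ar) (e : G.E) : Hypergraph Λ ar where
  V := G.V
  E := {d : G.E // d ≠ e}
  finite_V := G.finite_V
  finite_E := by
    have := G.finite_E
    infer_instance
  conn d := G.conn d.1
  label d := G.label d.1
  length_conn d := G.length_conn d.1

/-- A node is isolated if no edge is incident to it. -/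
def Isolated (G : Hypergraph Λ ar) (v : G.V) : Prop :=
  ∀ e, v ∉ G.conn e

/-- Deletion of an isolated node. -/
def delNode (G : Hypergraph Λ ar) (v : G.V) (hv : G.Isolated v) : Hypergraph Λ ar where
  V := {w : G.V // w ≠ v}
  E := G.E
  finite_V := by
    have := G.finite_V
    infer_instance
  finite_E := G.finite_E
  conn e := (G.conn e).attach.map fun w => ⟨w.1, fun h => hv e (h ▸ w.2)⟩
  label e := G.label e
  length_conn e := by simpa using G.length_conn e

/-- An undirected path of length `n`: nodes `v₀, …, vₙ` and edges `e₁, …, eₙ`, no node and no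
edge occurring twice, such that the `i`-th edge is incident to the `i`-th node and to its
successor. -/
def IsPath (G : Hypergraph Λ ar) (n : ℕ) (v : Fin (n + 1) → G.V) (e : Fin n → G.E) : Prop :=
  Function.Injective v ∧ Function.Injective e ∧
    ∀ i : Fin n, v i.castSucc ∈ G.conn (e i) ∧ v i.succ ∈ G.conn (e i)

end Hypergraph

/-- `SubgraphOf H G`: up to isomorphism, `H` is obtained from `G` by a sequence of deletions of
edges and isolated nodes. -/
inductive SubgraphOf : Hypergraph Λ ar → Hypergraph Λ ar → Prop
  | iso {H G : Hypergraph Λ ar} : Isomorphic H G → SubgraphOf H G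
  | delEdge {H G : Hypergraph Λ ar} (e : G.E) : SubgraphOf H (G.delEdge e) → SubgraphOf H G
  | delNode {H G : Hypergraph Λ ar} (v : G.V) (hv : G.Isolated v) :
      SubgraphOf H (G.delNode v hv) → SubgraphOf H G

/-- The set of graphs in which every undirected path has length at most `k`. -/
def boundedPath (Λ : Type) (ar : Λ → ℕ) (k : ℕ) : Set (Hypergraph Λ ar) :=
  {G | ∀ (n : ℕ) (v : Fin (n + 1) → G.V) (e : Fin n → G.E), G.IsPath n v e → n ≤ k}

/-! ## Conditions on a class of order morphisms -/

/-- The order `le` is a quasi-order, anti-symmetric up to isomorphism, and representable by the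
class `M` of morphisms. -/
def RepresentableBy (le : Hypergraph Λ ar → Hypergraph Λ ar → Prop)
    (M : ∀ {G H : Hypergraph Λ ar}, PMor G H → Prop) : Prop :=
  (∀ G, le G G) ∧
  (∀ G H K, le G H → le H K → le G K) ∧
  (∀ G H, (le G H ∧ le H G) ↔ Isomorphic G H) ∧
  (∀ G H, le H G ↔ ∃ μ : PMor G H, M μ) ∧
  (∀ (G H K : Hypergraph Λ ar) (μ₁ : PMor G H) (μ₂ : PMor H K), M μ₁ → M μ₂ → M (μ₂.comp μ₁))

/-- The class `M` is preserved by total pushouts. -/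
def PreservedByTotalPushouts (M : ∀ {G H : Hypergraph Λ ar}, PMor G H → Prop) : Prop :=
  ∀ (G₀ G₁ G₂ G₃ : Hypergraph Λ ar) (μ : PMor G₀ G₁) (g : PMor G₀ G₂)
    (g' : PMor G₁ G₃) (μ' : PMor G₂ G₃),
    M μ → g.Total → IsPushout μ g g' μ' → M μ'

/-- The class `M` is pushout closed. -/
def PushoutClosed (M : ∀ {G H : Hypergraph Λ ar}, PMor G H → Prop) : Prop :=
  ∀ (L R G H S : Hypergraph Λ ar) (r : PMor L R) (m : PMor L G) (m' : PMor R H) (r' : PMor G H)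
    (μ : PMor H S),
    m.Total → m.ConflictFree r → IsPushout r m m' r' → M μ →
    ∃ (R' G' : Hypergraph Λ ar) (μR : PMor R R') (μG : PMor G G') (n : PMor R' S) (s : PMor G' S),
      M μR ∧ M μG ∧
      n.comp μR = μ.comp m' ∧ s.comp μG = μ.comp r' ∧
      IsPushout (μR.comp r) (μG.comp m) n s ∧
      (μG.comp m).Total ∧ n.Total ∧ (μG.comp m).ConflictFree r

/-! ## Codes for graphs and morphisms -/

/-- Well-formedness of a pair `(n, l)` consisting of a number of nodes and a list of edges, each
given by its label and the list of its nodes. -/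
def CodeWF (ar : Λ → ℕ) (x : ℕ × List (Λ × List ℕ)) : Prop :=
  ∀ e ∈ x.2, e.2.length = ar e.1 ∧ ∀ v ∈ e.2, v < x.1

instance (ar : Λ → ℕ) : DecidablePred (CodeWF ar) := fun x => by
  unfold CodeWF
  infer_instance

theorem codeWF_primrec [Finite Λ] [Primcodable Λ] (ar : Λ → ℕ) : PrimrecPred (CodeWF ar) := by
  have h1 : PrimrecRel fun (e : Λ × List ℕ) (n : ℕ) =>
      e.2.length = ar e.1 ∧ ∀ v ∈ e.2, v < n := by
    refine PrimrecPred.primrecRel (p := fun x : (Λ × List ℕ) × ℕ =>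
      x.1.2.length = ar x.1.1 ∧ ∀ v ∈ x.1.2, v < x.2) ?_
    apply PrimrecPred.and
    · exact Primrec.eq.comp
        (Primrec.list_length.comp (Primrec.snd.comp Primrec.fst))
        ((Primrec.dom_finite ar).comp (Primrec.fst.comp Primrec.fst))
    · exact (Primrec.nat_lt.forall_mem_list).comp (Primrec.snd.comp Primrec.fst) Primrec.snd
  exact (h1.forall_mem_list).comp Primrec.snd Primrec.fst

/-- Codes of graphs with node set `{0, …, n - 1}` and edge set `{0, …, m - 1}`. -/
def GraphCode (Λ : Type) (ar : Λ → ℕ) : Type :=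
  {x : ℕ × List (Λ × List ℕ) // CodeWF ar x}

instance [Finite Λ] [Primcodable Λ] (ar : Λ → ℕ) : Primcodable (GraphCode Λ ar) :=
  Primcodable.subtype (codeWF_primrec ar)

/-- The graph denoted by a code. -/
def GraphCode.graph (c : GraphCode Λ ar) : Hypergraph Λ ar where
  V := Fin c.1.1
  E := Fin c.1.2.length
  finite_V := inferInstance
  finite_E := inferInstance
  conn e := (c.1.2.get e).2.attach.map fun v =>
    ⟨v.1, (c.2 _ (List.get_mem c.1.2 e)).2 v.1 v.2⟩
  label e := (c.1.2.get e).1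
  length_conn e := by simpa using (c.2 _ (List.get_mem c.1.2 e)).1

/-- Every graph is, up to isomorphism, denoted by a code. -/
theorem GraphCode.exists_code (G : Hypergraph Λ ar) :
    ∃ c : GraphCode Λ ar, Isomorphic c.graph G := by
  have := G.finite_V
  have := G.finite_E
  obtain ⟨n, ⟨f⟩⟩ := Finite.exists_equiv_fin G.V
  obtain ⟨m, ⟨g⟩⟩ := Finite.exists_equiv_fin G.E
  let l : List (Λ × List ℕ) := List.ofFn fun i : Fin m =>
    (G.label (g.symm i), (G.conn (g.symm i)).map fun v => (f v).val)
  have hl : l.length = m := List.length_ofFn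
  have hwf : CodeWF ar (n, l) := by
    intro e he
    obtain ⟨i, rfl⟩ := (List.mem_ofFn' _ _).1 he
    refine ⟨by simpa using G.length_conn _, fun v hv => ?_⟩
    obtain ⟨w, -, rfl⟩ := List.mem_map.1 hv
    exact (f w).isLt
  let c : GraphCode Λ ar := ⟨(n, l), hwf⟩
  have hget : ∀ e : Fin l.length, l.get e =
      (G.label (g.symm (Fin.cast hl e)),
        (G.conn (g.symm (Fin.cast hl e))).map fun v => (f v).val) := by
    intro e
    simp [l]
    exact ⟨rfl, rfl⟩
  have hconn : ∀ e : Fin l.length,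
      (c.graph.conn e).map (fun v : Fin n => f.symm v) = G.conn (g.symm (Fin.cast hl e)) := by
    intro e
    have h1 : (c.graph.conn e).map (fun v : Fin n => v.val) = (l.get e).2 := by
      simp [GraphCode.graph, c]
    have h2 : ((c.graph.conn e).map (fun v : Fin n => f.symm v)).map (fun v => (f v).val) =
        (G.conn (g.symm (Fin.cast hl e))).map (fun v => (f v).val) := by
      have h3 : ((fun v => (f v).val) ∘ fun v : Fin n => f.symm v) = fun v : Fin n => v.val := by
        funext v; simp
      refine List.map_map.trans ?_
      refine (congrArg (fun q : Fin n → ℕ => List.map q (c.graph.conn e)) h3).trans ?_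
      exact h1.trans (congrArg Prod.snd (hget e))
    exact List.map_injective_iff.2 (Fin.val_injective.comp f.injective) h2
  refine ⟨c, ⟨fun v : Fin n => some (f.symm v),
    fun e : Fin l.length => some (g.symm (Fin.cast hl e)), ?_, ?_⟩, ⟨?_, ?_⟩, ⟨?_, ?_⟩, ⟨?_, ?_⟩⟩
  · intro e e' h
    obtain rfl := Option.some.inj h
    exact congrArg Prod.fst (hget e)
  · intro e e' h
    obtain rfl := Option.some.inj h
    refine Eq.trans ?_ (congrArg (List.map some) (hconn e))
    exact List.map_map.symm
  · exact fun v => ⟨_, rfl⟩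
  · exact fun e => ⟨_, rfl⟩
  · intro v v' w h h'
    exact f.symm.injective (Option.some.inj (h.trans h'.symm))
  · intro e e' d h h'
    exact Fin.cast_injective hl (g.symm.injective (Option.some.inj (h.trans h'.symm)))
  · exact fun w => ⟨f w, congrArg some (f.symm_apply_apply w)⟩
  · exact fun d => ⟨Fin.cast hl.symm (g d), congrArg some (g.symm_apply_apply d)⟩

/-- Data describing a partial morphism: the values on the nodes and on the edges. -/
abbrev MorCode : Type := List (Option ℕ) × List (Option ℕ)

/-- The code of a partial morphism between coded graphs. -/
def PMor.code {a b : GraphCode Λ ar} (φ : PMor a.graph b.graph) : MorCode :=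
  (List.ofFn fun v : Fin a.1.1 => (φ.onV v).map fun w : Fin b.1.1 => w.val,
   List.ofFn fun e : Fin a.1.2.length => (φ.onE e).map fun d : Fin b.1.2.length => d.val)

/-! ## Minimal pushout complements -/

/-- `G` is a pushout complement object of the rule `r : L ⇀ R` and the co-match `m' : R → S`, with
a total and conflict-free match `L → G`. -/
def IsPOC {L R S : Hypergraph Λ ar} (r : PMor L R) (m' : PMor R S) (G : Hypergraph Λ ar) : Prop :=
  ∃ (m : PMor L G) (r' : PMor G S), m.Total ∧ m.ConflictFree r ∧ IsPushout r m m' r'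

/-- `G` is a minimal pushout complement object with respect to the order `le`. -/
def IsMinimalPOC (le : Hypergraph Λ ar → Hypergraph Λ ar → Prop) {L R S : Hypergraph Λ ar}
    (r : PMor L R) (m' : PMor R S) (G : Hypergraph Λ ar) : Prop :=
  IsPOC r m' G ∧ ∀ G', IsPOC r m' G' → le G' G → le G G'

/-- The set of minimal pushout complements is finite (up to isomorphism) and computable: one
algorithm returns, for every rule `r` and every total co-match `m'`, a finite list of
representatives of all minimal pushout complement objects. -/
def MinimalPOCsComputable [Finite Λ] [Primcodable Λ] (ar : Λ → ℕ)
    (le : Hypergraph Λ ar → Hypergraph Λ ar → Prop) : Prop :=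
  ∃ poc : (GraphCode Λ ar × GraphCode Λ ar × GraphCode Λ ar) × MorCode × MorCode →
      List (GraphCode Λ ar),
    Computable poc ∧
    ∀ (L R S : GraphCode Λ ar) (r : PMor L.graph R.graph) (m' : PMor R.graph S.graph), m'.Total →
      (∀ c ∈ poc ((L, R, S), r.code, m'.code), IsMinimalPOC le r m' c.graph) ∧
      (∀ G, IsMinimalPOC le r m' G →
        ∃ c ∈ poc ((L, R, S), r.code, m'.code), Isomorphic c.graph G)

end GTS

/-!
Coverability in graph transformation systems whose graphs have bounded paths.

**Pushouts.** The universal property of a pushout of partial morphisms quantifies over all graphs.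
It is replaced by an elementary condition (`IsElementaryPushout`): the square commutes, its two
morphisms into the apex are jointly surjective, and each pair of predicates that is compatible with
the span is induced by a predicate on the apex (for edges, only predicates are considered under
which all incident nodes survive).  The two notions agree (`IsElementaryPushout.isPushout`,
`IsPushout.elementary`), and every span has a pushout (`exists_isPushout`).  Preservation under
total pushouts and pushout closure are then statements about predicates on finite sets.

**Bounded predecessors.** The subgraph order is the existence of a total injective morphism, or
equivalently of a retract (`subgraphOf_iff_embeds`, `embeds_iff_exists_retract`).  If `G` is
rewritten to `H` by a match `m` and a subgraph `S` of `H` is given, then only the part of `G` formed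
by the image of `m` and the preimage of `S` is needed in order to cover `S` (`kept`).  Hence the
minimal predecessors of the graphs above `S`, and the minimal pushout complements, have at most as
many nodes and edges as the left-hand side and `S` together, and can be found by a search through
the finitely many graphs of that size (`Rule.Rewrites.exists_bounded`, `IsPOC.exists_bounded`).

**Well-quasi-order.** A graph is viewed as its coloured incidence structure.  If paths are bounded,
then deleting one vertex from each component shortens the paths that remain to be considered, and
the colours of the other vertices record how they were attached.  Induction on the bound, with
Higman's lemma for the families of components, gives the well-quasi-order
(`ColoredSet.partiallyWellOrderedOn_shallow`, `exists_subgraphOf_of_boundedPath`).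

**Computability.** Coded morphisms between coded graphs form an explicit finite list (`homs`), and
so do the graphs of bounded size (`graphsUpTo`).  The subgraph order, pushouts, bounded paths and
rewriting are bounded searches through these lists, hence primitive recursive.  To recognise a
pushout it suffices to test the universal property for the apex itself and for the graphs whose
size is at most that of a pushout (`IsPushout.of_hasMediator`).

**Backward search.** The upward closures of the sets of the search do not depend on the chosen
bases (`predIter`, `upClosure_backSeq`).  Compatibility of the order with transitions makes the
search sound (`coversSet_of_mem_predIter`), a stationary set is complete
(`mem_predIter_of_coversSet`), and the well-quasi-order makes the restricted search terminate
(`exists_stationary`).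
-/

namespace GTS

variable {Λ : Type} {ar : Λ → ℕ}

/-! ### The category of partial morphisms -/

namespace PMor

@[ext]
theorem ext {G H : Hypergraph Λ ar} {φ ψ : PMor G H} (hV : ∀ v, φ.onV v = ψ.onV v)
    (hE : ∀ e, φ.onE e = ψ.onE e) : φ = ψ := by
  cases φ
  cases ψ
  obtain rfl := funext hV
  obtain rfl := funext hE
  rfl

/-- The identity morphism. -/
def id (G : Hypergraph Λ ar) : PMor G G where
  onV := some
  onE := some
  label_eq e e' h := by rw [Option.some.inj h]
  conn_eq e e' h := by rw [Option.some.inj h]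

variable {G H K M : Hypergraph Λ ar}

@[simp] theorem id_onV (v : G.V) : (id G).onV v = some v := rfl
@[simp] theorem id_onE (e : G.E) : (id G).onE e = some e := rfl
@[simp] theorem comp_onV (ψ : PMor H K) (φ : PMor G H) (v : G.V) :
    (ψ.comp φ).onV v = (φ.onV v).bind ψ.onV := rfl
@[simp] theorem comp_onE (ψ : PMor H K) (φ : PMor G H) (e : G.E) :
    (ψ.comp φ).onE e = (φ.onE e).bind ψ.onE := rfl

@[simp] theorem id_comp (φ : PMor G H) : (id H).comp φ = φ := by
  ext1 x
  · exact Option.bind_fun_some (φ.onV x)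
  · exact Option.bind_fun_some (φ.onE x)

@[simp] theorem comp_id (φ : PMor G H) : φ.comp (id G) = φ := by
  ext1 <;> simp

theorem comp_assoc (χ : PMor K M) (ψ : PMor H K) (φ : PMor G H) :
    (χ.comp ψ).comp φ = χ.comp (ψ.comp φ) := by
  ext1 x
  · exact (Option.bind_assoc (φ.onV x) ψ.onV χ.onV).symm
  · exact (Option.bind_assoc (φ.onE x) ψ.onE χ.onE).symm

theorem onV_eq_of_comp_eq {ψ : PMor H K} {φ : PMor G H} {χ : PMor G K} (h : ψ.comp φ = χ)
    {v : G.V} {w : H.V} (hv : φ.onV v = some w) : χ.onV v = ψ.onV w := by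
  rw [← h, comp_onV, hv, Option.bind_some]

theorem onE_eq_of_comp_eq {ψ : PMor H K} {φ : PMor G H} {χ : PMor G K} (h : ψ.comp φ = χ)
    {v : G.E} {w : H.E} (hv : φ.onE v = some w) : χ.onE v = ψ.onE w := by
  rw [← h, comp_onE, hv, Option.bind_some]

theorem exists_onV_of_onE (φ : PMor G H) {e : G.E} {d : H.E} (h : φ.onE e = some d) {v : G.V}
    (hv : v ∈ G.conn e) : ∃ w ∈ H.conn d, φ.onV v = some w := by
  have h1 := List.mem_map_of_mem (f := φ.onV) hv
  rw [φ.conn_eq e d h] at h1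
  obtain ⟨w, hw, h2⟩ := List.mem_map.1 h1
  exact ⟨w, hw, h2.symm⟩

theorem exists_onV_of_onE' (φ : PMor G H) {e : G.E} {d : H.E} (h : φ.onE e = some d) {w : H.V}
    (hw : w ∈ H.conn d) : ∃ v ∈ G.conn e, φ.onV v = some w := by
  have h1 := List.mem_map_of_mem (f := some) hw
  rw [← φ.conn_eq e d h] at h1
  obtain ⟨v, hv, h2⟩ := List.mem_map.1 h1
  exact ⟨v, hv, h2⟩

theorem total_id : (id G).Total := ⟨fun v => ⟨v, rfl⟩, fun e => ⟨e, rfl⟩⟩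

theorem Total.comp {ψ : PMor H K} {φ : PMor G H} (hψ : ψ.Total) (hφ : φ.Total) :
    (ψ.comp φ).Total := by
  constructor
  · intro v
    obtain ⟨w, hw⟩ := hφ.1 v
    simpa [hw] using hψ.1 w
  · intro v
    obtain ⟨w, hw⟩ := hφ.2 v
    simpa [hw] using hψ.2 w

theorem Injective.comp {ψ : PMor H K} {φ : PMor G H} (hψ : ψ.Injective) (hφ : φ.Injective) :
    (ψ.comp φ).Injective := by
  constructor
  · intro v v' w h h'
    obtain ⟨a, ha, ha'⟩ := Option.bind_eq_some_iff.1 h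
    obtain ⟨b, hb, hb'⟩ := Option.bind_eq_some_iff.1 h'
    obtain rfl := hψ.1 _ _ _ ha' hb'
    exact hφ.1 _ _ _ ha hb
  · intro v v' w h h'
    obtain ⟨a, ha, ha'⟩ := Option.bind_eq_some_iff.1 h
    obtain ⟨b, hb, hb'⟩ := Option.bind_eq_some_iff.1 h'
    obtain rfl := hψ.2 _ _ _ ha' hb'
    exact hφ.2 _ _ _ ha hb

theorem Surjective.comp {ψ : PMor H K} {φ : PMor G H} (hψ : ψ.Surjective) (hφ : φ.Surjective) :
    (ψ.comp φ).Surjective := by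
  constructor
  · intro w
    obtain ⟨v, hv⟩ := hψ.1 w
    obtain ⟨u, hu⟩ := hφ.1 v
    exact ⟨u, by simp [hu, hv]⟩
  · intro w
    obtain ⟨v, hv⟩ := hψ.2 w
    obtain ⟨u, hu⟩ := hφ.2 v
    exact ⟨u, by simp [hu, hv]⟩

theorem IsSubgraphMor.comp {ψ : PMor H K} {φ : PMor G H} (hψ : ψ.IsSubgraphMor)
    (hφ : φ.IsSubgraphMor) : (ψ.comp φ).IsSubgraphMor :=
  ⟨hψ.1.comp hφ.1, hψ.2.comp hφ.2⟩

theorem isSubgraphMor_id : (id G).IsSubgraphMor :=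
  ⟨⟨fun _ _ _ h h' => Option.some.inj (h.trans h'.symm),
    fun _ _ _ h h' => Option.some.inj (h.trans h'.symm)⟩,
   ⟨fun w => ⟨w, rfl⟩, fun w => ⟨w, rfl⟩⟩⟩

/-- The inverse relation of an injective partial morphism is again a partial morphism. -/
theorem Injective.exists_inverse {φ : PMor G H} (h : φ.Injective) :
    ∃ ψ : PMor H G, (∀ v w, ψ.onV w = some v ↔ φ.onV v = some w) ∧
      (∀ e d, ψ.onE d = some e ↔ φ.onE e = some d) := by
  classical
  have key : ∀ {X Y : Type} (f : X → Option Y),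
      (∀ v v' w, f v = some w → f v' = some w → v = v') →
      ∃ g : Y → Option X, ∀ x y, g y = some x ↔ f x = some y := by
    intro X Y f hf
    refine ⟨fun y => if hy : ∃ x, f x = some y then some hy.choose else none, fun x y => ?_⟩
    constructor
    · intro hx
      by_cases hy : ∃ x, f x = some y
      · simp only [hy, dite_true] at hx
        rw [← Option.some.inj hx]
        exact hy.choose_spec
      · simp [hy] at hx
    · intro hx
      have hy : ∃ x, f x = some y := ⟨x, hx⟩
      simp only [hy, dite_true]
      exact congrArg some (hf _ _ _ hy.choose_spec hx)
  obtain ⟨g, hg⟩ := key φ.onV h.1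
  obtain ⟨k, hk⟩ := key φ.onE h.2
  refine ⟨⟨g, k, fun e e' he => (φ.label_eq _ _ ((hk _ _).1 he)).symm, fun e e' he => ?_⟩, hg, hk⟩
  have h1 := φ.conn_eq _ _ ((hk _ _).1 he)
  apply List.ext_getElem?
  intro i
  have h2 := congrArg (fun l => l[i]?) h1
  simp only [List.getElem?_map] at h2 ⊢
  cases ha : (H.conn e)[i]? with
  | none => cases hb : (G.conn e')[i]? <;> simp_all
  | some a =>
    cases hb : (G.conn e')[i]? with
    | none => simp_all
    | some b =>
      simp only [ha, hb, Option.map_some, Option.some.injEq] at h2 ⊢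
      exact (hg _ _).2 h2

end PMor

/-! ### Embeddings -/

/-- `Embeds H G`: there is a total injective morphism from `H` to `G`.  This is the working form
of the subgraph order. -/
def Embeds (H G : Hypergraph Λ ar) : Prop := ∃ j : PMor H G, j.Total ∧ j.Injective

theorem Embeds.refl (G : Hypergraph Λ ar) : Embeds G G :=
  ⟨PMor.id G, PMor.total_id, PMor.isSubgraphMor_id.1⟩

theorem Embeds.trans {G H K : Hypergraph Λ ar} (h : Embeds G H) (h' : Embeds H K) :
    Embeds G K := by
  obtain ⟨j, hj⟩ := h
  obtain ⟨j', hj'⟩ := h'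
  exact ⟨j'.comp j, hj'.1.comp hj.1, hj'.2.comp hj.2⟩

/-- A total injective morphism has a subgraph morphism as retraction. -/
theorem PMor.Total.exists_retraction {H G : Hypergraph Λ ar} {j : PMor H G} (ht : j.Total)
    (hi : j.Injective) : ∃ μ : PMor G H, μ.IsSubgraphMor ∧ μ.comp j = PMor.id H ∧
      (∀ v w, μ.onV w = some v ↔ j.onV v = some w) ∧
      (∀ e d, μ.onE d = some e ↔ j.onE e = some d) := by
  obtain ⟨μ, hV, hE⟩ := hi.exists_inverse
  refine ⟨μ, ⟨⟨?_, ?_⟩, ?_, ?_⟩, ?_, hV, hE⟩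
  · intro v v' w h h'
    exact Option.some.inj (((hV _ _).1 h).symm.trans ((hV _ _).1 h'))
  · intro v v' w h h'
    exact Option.some.inj (((hE _ _).1 h).symm.trans ((hE _ _).1 h'))
  · intro w
    obtain ⟨v, hv⟩ := ht.1 w
    exact ⟨v, (hV _ _).2 hv⟩
  · intro w
    obtain ⟨v, hv⟩ := ht.2 w
    exact ⟨v, (hE _ _).2 hv⟩
  · ext1 v
    · obtain ⟨w, hw⟩ := ht.1 v
      simpa [hw] using (hV _ _).2 hw
    · obtain ⟨w, hw⟩ := ht.2 v
      simpa [hw] using (hE _ _).2 hw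

/-- A subgraph morphism has a total injective section. -/
theorem PMor.IsSubgraphMor.exists_section {H G : Hypergraph Λ ar} {μ : PMor G H}
    (h : μ.IsSubgraphMor) : ∃ j : PMor H G, j.Total ∧ j.Injective ∧ μ.comp j = PMor.id H ∧
      (∀ v w, j.onV v = some w ↔ μ.onV w = some v) ∧
      (∀ e d, j.onE e = some d ↔ μ.onE d = some e) := by
  obtain ⟨j, hV, hE⟩ := h.1.exists_inverse
  have ht : j.Total := by
    constructor
    · intro w
      obtain ⟨v, hv⟩ := h.2.1 w
      exact ⟨v, (hV _ _).2 hv⟩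
    · intro w
      obtain ⟨v, hv⟩ := h.2.2 w
      exact ⟨v, (hE _ _).2 hv⟩
  refine ⟨j, ht, ⟨?_, ?_⟩, ?_, fun v w => hV _ _, fun v w => hE _ _⟩
  · intro v v' w h h'
    exact Option.some.inj (((hV _ _).1 h).symm.trans ((hV _ _).1 h'))
  · intro v v' w h h'
    exact Option.some.inj (((hE _ _).1 h).symm.trans ((hE _ _).1 h'))
  · ext1 v
    · obtain ⟨w, hw⟩ := ht.1 v
      simpa [hw] using (hV _ _).1 hw
    · obtain ⟨w, hw⟩ := ht.2 v
      simpa [hw] using (hE _ _).1 hw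

theorem embeds_iff_exists_isSubgraphMor {H G : Hypergraph Λ ar} :
    Embeds H G ↔ ∃ μ : PMor G H, μ.IsSubgraphMor := by
  constructor
  · rintro ⟨j, ht, hi⟩
    obtain ⟨μ, hμ, -⟩ := ht.exists_retraction hi
    exact ⟨μ, hμ⟩
  · rintro ⟨μ, hμ⟩
    obtain ⟨j, ht, hi, -⟩ := hμ.exists_section
    exact ⟨j, ht, hi⟩

/-- The order expressed by composition and equality of morphisms only. -/
theorem embeds_iff_exists_retract {H G : Hypergraph Λ ar} :
    Embeds H G ↔ ∃ (j : PMor H G) (μ : PMor G H), μ.comp j = PMor.id H := by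
  constructor
  · rintro ⟨j, ht, hi⟩
    obtain ⟨μ, -, h, -⟩ := ht.exists_retraction hi
    exact ⟨j, μ, h⟩
  · rintro ⟨j, μ, h⟩
    have hV : ∀ v, ∃ w, j.onV v = some w ∧ μ.onV w = some v := fun v => by
      have := congrArg (fun φ => φ.onV v) h
      exact Option.bind_eq_some_iff.1 this
    have hE : ∀ v, ∃ w, j.onE v = some w ∧ μ.onE w = some v := fun v => by
      have := congrArg (fun φ => φ.onE v) h
      exact Option.bind_eq_some_iff.1 this
    refine ⟨j, ⟨fun v => ⟨_, (hV v).choose_spec.1⟩, fun v => ⟨_, (hE v).choose_spec.1⟩⟩, ?_, ?_⟩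
    · intro v v' w h1 h2
      obtain ⟨a, ha, ha'⟩ := hV v
      obtain ⟨b, hb, hb'⟩ := hV v'
      obtain rfl := Option.some.inj (h1.symm.trans ha)
      obtain rfl := Option.some.inj (h2.symm.trans hb)
      exact Option.some.inj (ha'.symm.trans hb')
    · intro v v' w h1 h2
      obtain ⟨a, ha, ha'⟩ := hE v
      obtain ⟨b, hb, hb'⟩ := hE v'
      obtain rfl := Option.some.inj (h1.symm.trans ha)
      obtain rfl := Option.some.inj (h2.symm.trans hb)
      exact Option.some.inj (ha'.symm.trans hb')

/-- A total bijective morphism has a two-sided inverse. -/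
theorem isomorphic_iff_exists_inverse {G H : Hypergraph Λ ar} :
    Isomorphic G H ↔ ∃ (i : PMor G H) (j : PMor H G), j.comp i = PMor.id G ∧
      i.comp j = PMor.id H ∧ i.Total ∧ i.IsSubgraphMor ∧ j.Total ∧ j.IsSubgraphMor := by
  constructor
  · rintro ⟨i, ht, hi, hs⟩
    obtain ⟨j, hj, h1, hV, hE⟩ := ht.exists_retraction hi
    have htj : j.Total := by
      constructor
      · intro w
        obtain ⟨v, hv⟩ := hs.1 w
        exact ⟨v, (hV _ _).2 hv⟩
      · intro w
        obtain ⟨v, hv⟩ := hs.2 w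
        exact ⟨v, (hE _ _).2 hv⟩
    refine ⟨i, j, h1, ?_, ht, ⟨hi, hs⟩, htj, hj⟩
    ext1 w
    · obtain ⟨v, hv⟩ := htj.1 w
      simpa [hv] using (hV _ _).1 hv
    · obtain ⟨v, hv⟩ := htj.2 w
      simpa [hv] using (hE _ _).1 hv
  · rintro ⟨i, j, -, -, ht, hs, -⟩
    exact ⟨i, ht, hs⟩

theorem Isomorphic.symm {G H : Hypergraph Λ ar} (h : Isomorphic G H) : Isomorphic H G := by
  obtain ⟨i, j, -, -, -, -, hj, hj'⟩ := isomorphic_iff_exists_inverse.1 h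
  exact ⟨j, hj, hj'.1, hj'.2⟩

theorem Isomorphic.embeds {G H : Hypergraph Λ ar} (h : Isomorphic G H) : Embeds G H := by
  obtain ⟨i, h1, h2, -⟩ := h
  exact ⟨i, h1, h2⟩

namespace PMor

/-- The map on nodes of a total morphism. -/
theorem Total.exists_mapV {G H : Hypergraph Λ ar} {φ : PMor G H} (h : φ.Total) :
    ∃ f : G.V → H.V, ∀ v, φ.onV v = some (f v) :=
  ⟨fun v => (h.1 v).choose, fun v => (h.1 v).choose_spec⟩

/-- The map on edges of a total morphism. -/
theorem Total.exists_mapE {G H : Hypergraph Λ ar} {φ : PMor G H} (h : φ.Total) :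
    ∃ f : G.E → H.E, ∀ v, φ.onE v = some (f v) :=
  ⟨fun v => (h.2 v).choose, fun v => (h.2 v).choose_spec⟩

end PMor

theorem Embeds.card_le {H G : Hypergraph Λ ar} (h : Embeds H G) :
    Nat.card H.V ≤ Nat.card G.V ∧ Nat.card H.E ≤ Nat.card G.E := by
  obtain ⟨j, ht, hi⟩ := h
  obtain ⟨f, hf⟩ := ht.exists_mapV
  obtain ⟨g, hg⟩ := ht.exists_mapE
  have := G.finite_V
  have := G.finite_E
  exact ⟨Nat.card_le_card_of_injective f fun a b hab => hi.1 _ _ _ (hf a) (by rw [hf, hab]),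
    Nat.card_le_card_of_injective g fun a b hab => hi.2 _ _ _ (hg a) (by rw [hg, hab])⟩

theorem Embeds.antisymm {H G : Hypergraph Λ ar} (h : Embeds H G) (h' : Embeds G H) :
    Isomorphic H G := by
  have c := h.card_le
  have c' := h'.card_le
  obtain ⟨j, ht, hi⟩ := h
  obtain ⟨f, hf⟩ := ht.exists_mapV
  obtain ⟨g, hg⟩ := ht.exists_mapE
  have := G.finite_V
  have := G.finite_E
  have := H.finite_V
  have := H.finite_E
  have hfi : Function.Injective f := fun a b hab => hi.1 _ _ _ (hf a) (by rw [hf, hab])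
  have hgi : Function.Injective g := fun a b hab => hi.2 _ _ _ (hg a) (by rw [hg, hab])
  have hfb := (Nat.bijective_iff_injective_and_card f).2 ⟨hfi, le_antisymm c.1 c'.1⟩
  have hgb := (Nat.bijective_iff_injective_and_card g).2 ⟨hgi, le_antisymm c.2 c'.2⟩
  refine ⟨j, ht, hi, fun w => ?_, fun w => ?_⟩
  · obtain ⟨v, rfl⟩ := hfb.2 w
    exact ⟨v, hf v⟩
  · obtain ⟨v, rfl⟩ := hgb.2 w
    exact ⟨v, hg v⟩

namespace Hypergraph

/-- The subgraph formed by the nodes in `A` and the edges in `B`. -/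
def restrict (G : Hypergraph Λ ar) (A : G.V → Prop) (B : G.E → Prop)
    (h : ∀ e, B e → ∀ v ∈ G.conn e, A v) : Hypergraph Λ ar where
  V := {v // A v}
  E := {e // B e}
  finite_V := by
    have := G.finite_V
    infer_instance
  finite_E := by
    have := G.finite_E
    infer_instance
  conn e := (G.conn e.1).attach.map fun v => ⟨v.1, h e.1 e.2 v.1 v.2⟩
  label e := G.label e.1
  length_conn e := by simpa using G.length_conn e.1

variable (G : Hypergraph Λ ar) (A : G.V → Prop) (B : G.E → Prop)
  (h : ∀ e, B e → ∀ v ∈ G.conn e, A v)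

/-- The inclusion of a subgraph. -/
def incl : PMor (G.restrict A B h) G where
  onV v := some v.1
  onE e := some e.1
  label_eq e e' he := by
    obtain rfl := Option.some.inj he
    rfl
  conn_eq e e' he := by
    obtain rfl := Option.some.inj he
    simp [restrict, Function.comp_def]

theorem incl_total : (G.incl A B h).Total := ⟨fun v => ⟨v.1, rfl⟩, fun e => ⟨e.1, rfl⟩⟩

theorem incl_injective : (G.incl A B h).Injective :=
  ⟨fun _ _ _ h h' => Subtype.ext (Option.some.inj (h.trans h'.symm)),
    fun _ _ _ h h' => Subtype.ext (Option.some.inj (h.trans h'.symm))⟩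

/-- A morphism whose image lies in a subgraph factors through the inclusion. -/
theorem exists_lift {L : Hypergraph Λ ar} (m : PMor L G)
    (hV : ∀ x v, m.onV x = some v → A v) (hE : ∀ x e, m.onE x = some e → B e) :
    ∃ m₀ : PMor L (G.restrict A B h), (G.incl A B h).comp m₀ = m := by
  have key : ∀ {X Y : Type} (f : X → Option Y) (A : Y → Prop), (∀ x v, f x = some v → A v) →
      ∃ g : X → Option {y // A y}, ∀ x, (g x).map Subtype.val = f x := by
    intro X Y f A hA
    refine ⟨fun x => (f x).pmap (fun y hy => ⟨y, hy⟩) fun v hv => hA x v hv, fun x => ?_⟩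
    simp [Option.map_pmap]
  obtain ⟨f, hf⟩ : ∃ f : L.V → Option (G.restrict A B h).V,
    ∀ x, (f x).map (fun v : (G.restrict A B h).V => (v.1 : G.V)) = m.onV x := key m.onV A hV
  obtain ⟨g, hg⟩ : ∃ g : L.E → Option (G.restrict A B h).E,
    ∀ x, (g x).map (fun e : (G.restrict A B h).E => (e.1 : G.E)) = m.onE x := key m.onE B hE
  have hf' : ∀ x, (f x).bind (G.incl A B h).onV = m.onV x := fun x => by
    rw [← hf x]
    cases f x <;> rfl
  have hg' : ∀ x, (g x).bind (G.incl A B h).onE = m.onE x := fun x => by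
    rw [← hg x]
    cases g x <;> rfl
  have hinj : Function.Injective
      fun o : Option (G.restrict A B h).V => o.map fun v => (v.1 : G.V) :=
    Option.map_injective Subtype.val_injective
  refine ⟨⟨f, g, fun e e' he => ?_, fun e e' he => ?_⟩, PMor.ext hf' hg'⟩
  · have h1 : m.onE e = some e'.1 := by rw [← hg' e, he]; rfl
    exact m.label_eq _ _ h1
  · have h1 : m.onE e = some e'.1 := by rw [← hg' e, he]; rfl
    apply List.map_injective_iff.2 hinj
    rw [List.map_map]
    have h2 : ((fun o : Option (G.restrict A B h).V => o.map fun v => (v.1 : G.V)) ∘ f) =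
      m.onV := funext hf
    rw [h2, m.conn_eq _ _ h1]
    simp [restrict, Function.comp_def]

end Hypergraph

theorem embeds_delEdge (G : Hypergraph Λ ar) (e : G.E) : Embeds (G.delEdge e) G :=
  ⟨⟨some, fun d => some d.1, fun d d' h => by obtain rfl := Option.some.inj h; rfl,
    fun d d' h => by obtain rfl := Option.some.inj h; rfl⟩,
    ⟨fun v => ⟨v, rfl⟩, fun e => ⟨e.1, rfl⟩⟩,
    fun _ _ _ h h' => Option.some.inj (h.trans h'.symm),
    fun _ _ _ h h' => Subtype.ext (Option.some.inj (h.trans h'.symm))⟩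

theorem embeds_delNode (G : Hypergraph Λ ar) (v : G.V) (hv : G.Isolated v) :
    Embeds (G.delNode v hv) G :=
  ⟨⟨fun w => some w.1, some, fun d d' h => by obtain rfl := Option.some.inj h; rfl,
    fun d d' h => by
      obtain rfl := Option.some.inj h
      simp [Hypergraph.delNode, Function.comp_def]⟩,
    ⟨fun v => ⟨v.1, rfl⟩, fun e => ⟨e, rfl⟩⟩,
    fun _ _ _ h h' => Subtype.ext (Option.some.inj (h.trans h'.symm)),
    fun _ _ _ h h' => Option.some.inj (h.trans h'.symm)⟩

/-- If an embedding misses an edge, this edge can be deleted first; if it hits all edges but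
misses a node, this node is isolated. -/
theorem subgraphOf_iff_embeds {H G : Hypergraph Λ ar} : SubgraphOf H G ↔ Embeds H G := by
  constructor
  · intro h
    induction h with
    | iso h => exact h.embeds
    | delEdge e _ ih => exact ih.trans (embeds_delEdge _ e)
    | delNode v hv _ ih => exact ih.trans (embeds_delNode _ v hv)
  · obtain ⟨n, hn⟩ : ∃ n, Nat.card G.V + Nat.card G.E = n := ⟨_, rfl⟩
    intro hHG
    induction n using Nat.strong_induction_on generalizing G with
    | _ n ih =>
      obtain ⟨j, ht, hi⟩ := hHG
      have := G.finite_V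
      have := G.finite_E
      by_cases hE : ∀ e, ∃ d, j.onE d = some e
      · by_cases hV : ∀ v, ∃ w, j.onV w = some v
        · exact .iso ⟨j, ht, hi, hV, hE⟩
        · push Not at hV
          obtain ⟨v, hv⟩ := hV
          have hiso : G.Isolated v := by
            intro e hve
            obtain ⟨d, hd⟩ := hE e
            obtain ⟨w, -, hw⟩ := j.exists_onV_of_onE' hd hve
            exact hv w hw
          refine .delNode v hiso (ih _ ?_ rfl ?_)
          · have : Nat.card {w : G.V // w ≠ v} < Nat.card G.V :=
              Finite.card_subtype_lt (x := v) (by simp)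
            change Nat.card {w : G.V // w ≠ v} + Nat.card G.E < n
            omega
          · obtain ⟨f, hf⟩ := ht.exists_mapV
            have hfv : ∀ w, f w ≠ v := fun w hw => hv w (by rw [hf, hw])
            refine ⟨⟨fun w => some ⟨f w, hfv w⟩, j.onE, j.label_eq, fun e e' he => ?_⟩,
              ⟨fun w => ⟨_, rfl⟩, ht.2⟩, fun a b c h h' => ?_, hi.2⟩
            · apply List.map_injective_iff.2 (Option.map_injective Subtype.val_injective)
              have h1 := j.conn_eq _ _ he
              simp only [List.map_map, Function.comp_def, Option.map_some, Hypergraph.delNode]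
              rw [List.attach_map_val (f := some)]
              rw [← h1]
              exact List.map_congr_left fun a _ => (hf a).symm
            · have : f a = f b :=
                congrArg Subtype.val (Option.some.inj (h.trans h'.symm))
              exact hi.1 _ _ _ (hf a) (by rw [hf, this])
      · push Not at hE
        obtain ⟨e, he⟩ := hE
        refine .delEdge e (ih _ ?_ rfl ?_)
        · have : Nat.card {w : G.E // w ≠ e} < Nat.card G.E :=
            Finite.card_subtype_lt (x := e) (by simp)
          change Nat.card G.V + Nat.card {w : G.E // w ≠ e} < n
          omega
        · obtain ⟨f, hf⟩ := ht.exists_mapE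
          have hfv : ∀ w, f w ≠ e := fun w hw => he w (by rw [hf, hw])
          refine ⟨⟨j.onV, fun w => some ⟨f w, hfv w⟩, fun d d' h => ?_, fun d d' h => ?_⟩,
            ⟨ht.1, fun w => ⟨_, rfl⟩⟩, hi.1, fun a b c h h' => ?_⟩
          · obtain rfl := Option.some.inj h
            exact j.label_eq _ _ (hf d)
          · obtain rfl := Option.some.inj h
            exact j.conn_eq _ _ (hf d)
          · have : f a = f b :=
              congrArg Subtype.val (Option.some.inj (h.trans h'.symm))
            exact hi.2 _ _ _ (hf a) (by rw [hf, this])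

theorem representableBy_isSubgraphMor :
    RepresentableBy (Λ := Λ) (ar := ar) SubgraphOf PMor.IsSubgraphMor := by
  refine ⟨fun G => ?_, fun G H K => ?_, fun G H => ?_, fun G H => ?_,
    fun G H K _ _ h h' => h'.comp h⟩
  · exact subgraphOf_iff_embeds.2 (Embeds.refl G)
  · simp only [subgraphOf_iff_embeds]
    exact Embeds.trans
  · simp only [subgraphOf_iff_embeds]
    exact ⟨fun h => h.1.antisymm h.2, fun h => ⟨h.embeds, h.symm.embeds⟩⟩
  · rw [subgraphOf_iff_embeds]
    exact embeds_iff_exists_isSubgraphMor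

/-! ### Pushouts of partial morphisms -/

section Sets

variable {X₀ X₁ X₂ X₃ : Type}

/-- A pair of predicates on the targets of a span of partial functions that is a cocone with
values in the one-element set. -/
def IsCocone (f : X₀ → Option X₁) (g : X₀ → Option X₂) (P : X₁ → Prop) (Q : X₂ → Prop) : Prop :=
  ∀ x, (∃ a, f x = some a ∧ P a) ↔ ∃ b, g x = some b ∧ Q b

/-- The pair of predicates is induced by a predicate on `X₃`. -/
def Descends (p : X₁ → Option X₃) (q : X₂ → Option X₃) (P : X₁ → Prop) (Q : X₂ → Prop) : Prop :=
  ∃ T : X₃ → Prop, (∀ a, P a ↔ ∃ t, p a = some t ∧ T t) ∧ ∀ b, Q b ↔ ∃ t, q b = some t ∧ T t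

/-- Every element of `X₃` is in the image of one of the two partial functions. -/
def JointlySurjective (p : X₁ → Option X₃) (q : X₂ → Option X₃) : Prop :=
  ∀ t, (∃ a, p a = some t) ∨ ∃ b, q b = some t

theorem isCocone_of_bind_eq {Y : Type} {f : X₀ → Option X₁} {g : X₀ → Option X₂}
    {p : X₁ → Option Y} {q : X₂ → Option Y} (h : ∀ x, (f x).bind p = (g x).bind q)
    (P : Y → Prop) : IsCocone f g (fun a => ∃ y, p a = some y ∧ P y)
      (fun b => ∃ y, q b = some y ∧ P y) := by
  intro x
  have h1 : ∀ y, (∃ a, f x = some a ∧ p a = some y) ↔ ∃ b, g x = some b ∧ q b = some y := by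
    intro y
    rw [← Option.bind_eq_some_iff, ← Option.bind_eq_some_iff, h x]
  constructor
  · rintro ⟨a, ha, y, hy, hP⟩
    obtain ⟨b, hb, hb'⟩ := (h1 y).1 ⟨a, ha, hy⟩
    exact ⟨b, hb, y, hb', hP⟩
  · rintro ⟨a, ha, y, hy, hP⟩
    obtain ⟨b, hb, hb'⟩ := (h1 y).2 ⟨a, ha, hy⟩
    exact ⟨b, hb, y, hb', hP⟩

theorem isCocone_eq_some {Y : Type} {f : X₀ → Option X₁} {g : X₀ → Option X₂}
    {p : X₁ → Option Y} {q : X₂ → Option Y} (h : ∀ x, (f x).bind p = (g x).bind q)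
    (y : Y) : IsCocone f g (fun a => p a = some y) (fun b => q b = some y) := by
  simpa using isCocone_of_bind_eq h (· = y)

/-- A cocone factors through `X₃` if the preimages of all its values descend to `X₃`. -/
theorem exists_factorization {Y : Type} {p : X₁ → Option X₃} {q : X₂ → Option X₃}
    (hs : JointlySurjective p q) (f : X₁ → Option Y) (g : X₂ → Option Y)
    (h : ∀ y, Descends p q (fun a => f a = some y) (fun b => g b = some y)) :
    ∃ η : X₃ → Option Y, (∀ a, (p a).bind η = f a) ∧ ∀ b, (q b).bind η = g b := by
  classical
  choose T hT hT' using h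
  have huniq : ∀ t y y', T y t → T y' t → y = y' := by
    intro t y y' h h'
    rcases hs t with ⟨a, ha⟩ | ⟨b, hb⟩
    · exact Option.some.inj (((hT y a).2 ⟨t, ha, h⟩).symm.trans ((hT y' a).2 ⟨t, ha, h'⟩))
    · exact Option.some.inj (((hT' y b).2 ⟨t, hb, h⟩).symm.trans ((hT' y' b).2 ⟨t, hb, h'⟩))
  let η : X₃ → Option Y := fun t => if h : ∃ y, T y t then some h.choose else none
  have hη : ∀ t y, η t = some y ↔ T y t := by
    intro t y
    constructor
    · intro h
      by_cases ht : ∃ y, T y t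
      · simp only [η, ht, dite_true] at h
        rw [← Option.some.inj h]
        exact ht.choose_spec
      · simp [η, ht] at h
    · intro h
      have ht : ∃ y, T y t := ⟨y, h⟩
      simp only [η, ht, dite_true]
      rw [huniq t _ _ ht.choose_spec h]
  refine ⟨η, fun a => ?_, fun b => ?_⟩
  · ext y
    simp only [Option.bind_eq_some_iff, hη]
    exact (hT y a).symm
  · ext y
    simp only [Option.bind_eq_some_iff, hη]
    exact (hT' y b).symm

/-- Joint surjectivity makes factorizations unique. -/
theorem factorization_unique {Y : Type} {p : X₁ → Option X₃} {q : X₂ → Option X₃}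
    (hs : JointlySurjective p q) {η η' : X₃ → Option Y}
    (h1 : ∀ a, (p a).bind η = (p a).bind η') (h2 : ∀ b, (q b).bind η = (q b).bind η') (t : X₃) :
    η t = η' t := by
  rcases hs t with ⟨a, ha⟩ | ⟨b, hb⟩
  · simpa [ha] using h1 a
  · simpa [hb] using h2 b

/-- The quotient of a set `X` by a family `F` of predicates: elements that no predicate holds of
are deleted, elements that no predicate separates are identified. -/
theorem exists_quotient {X : Type} [Finite X] (F : Set (X → Prop)) :
    ∃ (Y : Type) (q : X → Option Y), Finite Y ∧ (∀ y, ∃ x, q x = some y) ∧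
      (∀ S ∈ F, ∃ T : Y → Prop, ∀ x, S x ↔ ∃ y, q x = some y ∧ T y) ∧
      (∀ x x', (∀ S ∈ F, S x ↔ S x') → q x = q x') ∧
      (∀ x, q x ≠ none → ∃ S ∈ F, S x) := by
  classical
  let cls : X → Set X := fun x => {y | ∀ S ∈ F, S x ↔ S y}
  let q : X → Option {C : Set X // ∃ x, (∃ S ∈ F, S x) ∧ C = cls x} := fun x =>
    if h : ∃ S ∈ F, S x then some ⟨cls x, x, h, rfl⟩ else none
  have hq : ∀ x y, q x = some y ↔ (∃ S ∈ F, S x) ∧ y.1 = cls x := by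
    intro x y
    by_cases h : ∃ S ∈ F, S x
    · simp only [q, h, dite_true, Option.some.injEq, true_and]
      exact ⟨fun h' => h' ▸ rfl, fun h' => Subtype.ext h'.symm⟩
    · simp only [q, h, dite_false, false_and, reduceCtorEq]
  refine ⟨_, q, inferInstance, ?_, ?_, ?_, ?_⟩
  · rintro ⟨C, x, hx, rfl⟩
    exact ⟨x, (hq _ _).2 ⟨hx, rfl⟩⟩
  · intro S hS
    refine ⟨fun C => ∃ x ∈ C.1, S x, fun x => ⟨fun h => ?_, ?_⟩⟩
    · exact ⟨⟨cls x, x, ⟨S, hS, h⟩, rfl⟩, (hq _ _).2 ⟨⟨S, hS, h⟩, rfl⟩, x,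
        fun _ _ => Iff.rfl, h⟩
    · rintro ⟨C, hC, y, hy, h⟩
      rw [((hq _ _).1 hC).2] at hy
      exact (hy S hS).2 h
  · intro x x' h
    have h1 : (∃ S ∈ F, S x) ↔ ∃ S ∈ F, S x' :=
      exists_congr fun S => and_congr_right fun hS => h S hS
    have h2 : cls x = cls x' := by
      ext y
      exact forall₂_congr fun S hS => by rw [h S hS]
    ext y
    rw [hq, hq, h1, h2]
  · intro x h
    obtain ⟨y, hy⟩ := Option.ne_none_iff_exists'.1 h
    exact ((hq _ _).1 hy).1

end Sets

section Tests

variable {G₀ G₁ G₂ G₃ : Hypergraph Λ ar}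

/-- The node set `Unit` without edges. -/
def pointGraph (Λ : Type) (ar : Λ → ℕ) : Hypergraph Λ ar where
  V := Unit
  E := Empty
  finite_V := inferInstance
  finite_E := inferInstance
  conn e := e.elim
  label e := e.elim
  length_conn e := e.elim

/-- The node of the graph with one node. -/
def pointGraphNode (Λ : Type) (ar : Λ → ℕ) : (pointGraph Λ ar).V := ()

open Classical in
/-- The morphism to the graph with one node that is defined on the nodes in `P`. -/
noncomputable def toPoint {G : Hypergraph Λ ar} (P : G.V → Prop) : PMor G (pointGraph Λ ar) where
  onV v := if P v then some (pointGraphNode Λ ar) else none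
  onE _ := none
  label_eq _ _ h := by simp at h
  conn_eq _ _ h := by simp at h

theorem toPoint_onV {G : Hypergraph Λ ar} (P : G.V → Prop) (v : G.V) (u : (pointGraph Λ ar).V) :
    (toPoint P).onV v = some u ↔ P v := by
  have hu : pointGraphNode Λ ar = u := rfl
  simp only [toPoint]
  split_ifs with h
  · simp [h, hu]
  · simp [h]

/-- The graph with node set `V` that has exactly one edge for each label and each sequence of
nodes of the right length. -/
def saturatedGraph [Finite Λ] (ar : Λ → ℕ) (V : Type) [Finite V] : Hypergraph Λ ar where
  V := V
  E := Σ l : Λ, Fin (ar l) → V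
  finite_V := inferInstance
  finite_E := inferInstance
  conn e := List.ofFn e.2
  label e := e.1
  length_conn _ := List.length_ofFn

/-- `s` is the sequence of nodes of some edge of the saturated graph, provided that all its entries
are defined. -/
theorem exists_saturatedEdge [Finite Λ] {V : Type} [Finite V] (l : Λ) (s : List (Option V))
    (hl : s.length = ar l) (hs : none ∉ s) :
    ∃ k : (saturatedGraph ar V).E, (saturatedGraph ar V).label k = l ∧
      s = ((saturatedGraph ar V).conn k).map some := by
  have h1 : ∀ i : Fin (ar l), ∃ v, s[i.1]? = some (some v) := by
    intro i
    have hi : i.1 < s.length := by rw [hl]; exact i.2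
    rw [List.getElem?_eq_getElem hi]
    cases h : s[i.1] with
    | none => exact (hs (by rw [← h]; exact List.getElem_mem hi)).elim
    | some v => exact ⟨v, rfl⟩
  choose t ht using h1
  refine ⟨⟨l, t⟩, rfl, ?_⟩
  apply List.ext_getElem?
  intro i
  simp only [saturatedGraph, List.getElem?_map, List.getElem?_ofFn]
  by_cases hi : i < ar l
  · simp [hi, ht ⟨i, hi⟩]
  · simp [hi, hl]

theorem saturatedEdge_unique [Finite Λ] {V : Type} [Finite V] {k k' : (saturatedGraph ar V).E}
    (h : (saturatedGraph ar V).label k = (saturatedGraph ar V).label k')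
    (h' : ((saturatedGraph ar V).conn k).map some = ((saturatedGraph ar V).conn k').map some) :
    k = k' := by
  obtain ⟨l, t⟩ := k
  obtain ⟨l', t'⟩ := k'
  obtain rfl : l = l' := h
  have h1 := List.map_injective_iff.2 (Option.some_injective _) h'
  have h2 : t = t' := List.ofFn_injective h1
  rw [h2]

open Classical in
/-- The morphism to the saturated graph with node set `V` that has `p` as its map on nodes and
is defined on the edges that satisfy `P` and have all their nodes in the domain of `p`. -/
noncomputable def toSaturated [Finite Λ] {G : Hypergraph Λ ar} {V : Type} [Finite V]
    (p : G.V → Option V) (P : G.E → Prop) : PMor G (saturatedGraph ar V) where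
  onV := p
  onE e := if h : P e ∧ ∃ k : (saturatedGraph ar V).E, (saturatedGraph ar V).label k = G.label e ∧
    (G.conn e).map p = ((saturatedGraph ar V).conn k).map some then some h.2.choose else none
  label_eq e e' h := by
    split_ifs at h with h1
    rw [← Option.some.inj h]
    exact h1.2.choose_spec.1.symm
  conn_eq e e' h := by
    split_ifs at h with h1
    rw [← Option.some.inj h]
    exact h1.2.choose_spec.2

theorem toSaturated_onE [Finite Λ] {G : Hypergraph Λ ar} {V : Type} [Finite V]
    (p : G.V → Option V) (P : G.E → Prop) (e : G.E) (k : (saturatedGraph ar V).E) :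
    (toSaturated p P).onE e = some k ↔ P e ∧ (saturatedGraph ar V).label k = G.label e ∧
      (G.conn e).map p = ((saturatedGraph ar V).conn k).map some := by
  constructor
  · intro h
    refine ⟨?_, ((toSaturated p P).label_eq _ _ h).symm, (toSaturated p P).conn_eq _ _ h⟩
    simp only [toSaturated] at h
    split_ifs at h with h1
    exact h1.1
  · rintro ⟨h1, h2, h3⟩
    have h4 : ∃ k : (saturatedGraph ar V).E, (saturatedGraph ar V).label k = G.label e ∧
      (G.conn e).map p = ((saturatedGraph ar V).conn k).map some := ⟨k, h2, h3⟩
    simp only [toSaturated, dif_pos (And.intro h1 h4)]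
    exact congrArg some (saturatedEdge_unique (h4.choose_spec.1.trans h2.symm)
      (h4.choose_spec.2.symm.trans h3))

theorem exists_toSaturated_onE [Finite Λ] {G : Hypergraph Λ ar} {V : Type} [Finite V]
    (p : G.V → Option V) (P : G.E → Prop) (e : G.E) (h : P e)
    (h' : ∀ v ∈ G.conn e, p v ≠ none) : ∃ k, (toSaturated p P).onE e = some k := by
  obtain ⟨k, h1, h2⟩ := exists_saturatedEdge (G.label e) ((G.conn e).map p)
    (by rw [List.length_map, G.length_conn]) (by
      intro h1
      obtain ⟨v, hv, hv'⟩ := List.mem_map.1 h1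
      exact h' v hv hv')
  exact ⟨k, (toSaturated_onE p P e k).2 ⟨h, h1, h2⟩⟩

/-- All nodes of the edges in `P` are in the domain of the morphism. -/
def NodesDefined {G H : Hypergraph Λ ar} (φ : PMor G H) (P : G.E → Prop) : Prop :=
  ∀ e, P e → ∀ v ∈ G.conn e, φ.onV v ≠ none

theorem nodesDefined_of_onE {G H : Hypergraph Λ ar} (φ : PMor G H) {P : G.E → Prop}
    (h : ∀ e, P e → φ.onE e ≠ none) : NodesDefined φ P := by
  intro e he v hv
  obtain ⟨d, hd⟩ := Option.ne_none_iff_exists'.1 (h e he)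
  obtain ⟨w, -, hw⟩ := φ.exists_onV_of_onE hd hv
  simp [hw]

/-- The elementary description of pushouts: a commuting square is a pushout as soon as it has the
universal property for cocones that have a single value.  For the nodes these are cocones with
values in the graph with one node, for the edges those with values in a saturated graph, and the
latter are only defined on edges all whose nodes survive. -/
structure IsElementaryPushout (φ : PMor G₀ G₁) (ψ : PMor G₀ G₂) (ψ' : PMor G₁ G₃)
    (φ' : PMor G₂ G₃) : Prop where
  comm : ψ'.comp φ = φ'.comp ψ
  surjV : JointlySurjective ψ'.onV φ'.onV
  surjE : JointlySurjective ψ'.onE φ'.onE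
  descV : ∀ P Q, IsCocone φ.onV ψ.onV P Q → Descends ψ'.onV φ'.onV P Q
  descE : ∀ P Q, IsCocone φ.onE ψ.onE P Q → NodesDefined ψ' P → NodesDefined φ' Q →
    Descends ψ'.onE φ'.onE P Q

/-- Mediating morphisms are defined on nodes and on edges separately.  An edge in the domain of a
cocone has all its nodes in the domain, so the mediating map on nodes is defined on them and the
condition on edges applies. -/
theorem IsElementaryPushout.isPushout {φ : PMor G₀ G₁} {ψ : PMor G₀ G₂} {ψ' : PMor G₁ G₃}
    {φ' : PMor G₂ G₃} (h : IsElementaryPushout φ ψ ψ' φ') : IsPushout φ ψ ψ' φ' := by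
  refine ⟨h.comm, fun K f g hfg => ?_⟩
  have hfgV : ∀ x, (φ.onV x).bind f.onV = (ψ.onV x).bind g.onV :=
    fun x => congrArg (fun χ => χ.onV x) hfg
  have hfgE : ∀ x, (φ.onE x).bind f.onE = (ψ.onE x).bind g.onE :=
    fun x => congrArg (fun χ => χ.onE x) hfg
  obtain ⟨ηV, hV1, hV2⟩ := exists_factorization h.surjV f.onV g.onV fun y =>
    h.descV _ _ (isCocone_eq_some hfgV y)
  obtain ⟨ηE, hE1, hE2⟩ := exists_factorization h.surjE f.onE g.onE fun y => by
    refine h.descE _ _ (isCocone_eq_some hfgE y) ?_ ?_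
    · intro e he v hv h0
      obtain ⟨w, -, hw⟩ := f.exists_onV_of_onE he hv
      have := hV1 v
      rw [h0, hw] at this
      simp at this
    · intro e he v hv h0
      obtain ⟨w, -, hw⟩ := g.exists_onV_of_onE he hv
      have := hV2 v
      rw [h0, hw] at this
      simp at this
  -- the two maps preserve labels and connections, as every edge of `G₃` comes from `G₁` or `G₂`
  have key : ∀ {G : Hypergraph Λ ar} (q : PMor G G₃) (f : PMor G K),
      (∀ a, (q.onV a).bind ηV = f.onV a) → (∀ a, (q.onE a).bind ηE = f.onE a) →
      ∀ a t k, q.onE a = some t → ηE t = some k →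
        G₃.label t = K.label k ∧ (G₃.conn t).map ηV = (K.conn k).map some := by
    intro G q f hqV hqE a t k ht hk
    have hf : f.onE a = some k := by rw [← hqE, ht, Option.bind_some, hk]
    refine ⟨(q.label_eq _ _ ht).symm.trans (f.label_eq _ _ hf), ?_⟩
    rw [← f.conn_eq _ _ hf]
    have h1 : (G.conn a).map f.onV = ((G.conn a).map q.onV).map fun o => o.bind ηV := by
      rw [List.map_map]
      exact List.map_congr_left fun v _ => (hqV v).symm
    rw [h1, q.conn_eq _ _ ht, List.map_map]
    rfl
  have key' : ∀ t k, ηE t = some k →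
      G₃.label t = K.label k ∧ (G₃.conn t).map ηV = (K.conn k).map some := by
    intro t k hk
    rcases h.surjE t with ⟨a, ha⟩ | ⟨a, ha⟩
    · exact key ψ' f hV1 hE1 a t k ha hk
    · exact key φ' g hV2 hE2 a t k ha hk
  refine ⟨⟨ηV, ηE, fun e e' he => (key' e e' he).1, fun e e' he => (key' e e' he).2⟩,
    ⟨PMor.ext hV1 hE1, PMor.ext hV2 hE2⟩, ?_⟩
  rintro η' ⟨rfl, rfl⟩
  ext1 t
  · exact factorization_unique h.surjV (fun a => (hV1 a).symm) (fun a => (hV2 a).symm) t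
  · exact factorization_unique h.surjE (fun a => (hE1 a).symm) (fun a => (hE2 a).symm) t

/-- Pushouts satisfy the elementary description: apply the universal property to cocones with
values in the graph with one node and in the saturated graph on the nodes of the apex. -/
theorem IsPushout.elementary [Finite Λ] {φ : PMor G₀ G₁} {ψ : PMor G₀ G₂} {ψ' : PMor G₁ G₃}
    {φ' : PMor G₂ G₃} (h : IsPushout φ ψ ψ' φ') : IsElementaryPushout φ ψ ψ' φ' := by
  classical
  have := G₃.finite_V
  refine ⟨h.1, ?_, ?_, ?_, ?_⟩
  -- a node `t` in neither image could be added to the domain of a mediating morphism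
  · by_contra hn
    simp only [JointlySurjective] at hn
    push Not at hn
    obtain ⟨t, ht1, ht2⟩ := hn
    let η : (G₃.V → Prop) → PMor G₃ (pointGraph Λ ar) := toPoint
    obtain ⟨η₀, -, hu⟩ := h.2 _ ((η fun _ => False).comp ψ') ((η fun _ => False).comp φ')
      (by rw [PMor.comp_assoc, PMor.comp_assoc, h.1])
    have h1 := hu (η fun _ => False) ⟨rfl, rfl⟩
    have key : ∀ {G : Hypergraph Λ ar} (q : PMor G G₃), (∀ a, q.onV a ≠ some t) →
        (η fun s => s = t).comp q = (η fun _ => False).comp q := by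
      intro G q hq
      ext1 a
      · ext u
        simp only [PMor.comp_onV, Option.bind_eq_some_iff, η, toPoint_onV]
        constructor
        · rintro ⟨s, hs, rfl⟩
          exact (hq a hs).elim
        · rintro ⟨s, -, hs⟩
          exact hs.elim
      · rfl
    have h2 := hu (η fun s => s = t) ⟨key ψ' ht1, key φ' ht2⟩
    have h3 := congrArg (fun χ => χ.onV t) (h1.trans h2.symm)
    have h4 := (toPoint_onV (fun s => s = t) t (pointGraphNode Λ ar)).2 rfl
    exact (toPoint_onV (fun _ => False) t (pointGraphNode Λ ar)).1 (h3.trans h4)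
  -- likewise for an edge `t`, which the saturated graph can receive
  · by_contra hn
    simp only [JointlySurjective] at hn
    push Not at hn
    obtain ⟨t, ht1, ht2⟩ := hn
    let η : (G₃.E → Prop) → PMor G₃ (saturatedGraph ar G₃.V) := toSaturated some
    obtain ⟨η₀, -, hu⟩ := h.2 _ ((η fun _ => False).comp ψ') ((η fun _ => False).comp φ')
      (by rw [PMor.comp_assoc, PMor.comp_assoc, h.1])
    have h1 := hu (η fun _ => False) ⟨rfl, rfl⟩
    have h0 : ∀ (P : G₃.E → Prop) s, ¬ P s → (η P).onE s = none := by
      intro P s hs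
      by_contra h0
      obtain ⟨k, hk⟩ := Option.ne_none_iff_exists'.1 h0
      exact hs ((toSaturated_onE _ _ _ _).1 hk).1
    have h2 := hu (η fun s => s = t) ⟨by
      ext1 a
      · rfl
      · cases ha : ψ'.onE a with
        | none => simp [ha]
        | some s =>
          have : s ≠ t := fun hs => ht1 a (by rw [ha, hs])
          simp [ha, h0 (fun s => s = t) s this, h0 (fun _ => False) s], by
      ext1 a
      · rfl
      · cases ha : φ'.onE a with
        | none => simp [ha]
        | some s =>
          have : s ≠ t := fun hs => ht2 a (by rw [ha, hs])
          simp [ha, h0 (fun s => s = t) s this, h0 (fun _ => False) s]⟩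
    have h3 := congrArg (fun χ => χ.onE t) (h1.trans h2.symm)
    obtain ⟨k, hk⟩ := exists_toSaturated_onE (some : G₃.V → _) (fun s => s = t) t rfl (by simp)
    simp only [η] at h3
    rw [hk] at h3
    exact ((toSaturated_onE _ _ _ _).1 h3).1
  -- the predicate on the nodes of `G₃` is the domain of the mediating morphism
  · intro P Q hPQ
    have hfg : (toPoint P).comp φ = (toPoint Q).comp ψ := by
      ext1 x
      · ext u
        simp only [PMor.comp_onV, Option.bind_eq_some_iff, toPoint_onV]
        exact hPQ x
      · exact (Option.bind_fun_none _).trans (Option.bind_fun_none _).symm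
    obtain ⟨η, ⟨h1, h2⟩, -⟩ := h.2 _ _ _ hfg
    refine ⟨fun t => η.onV t = some (pointGraphNode Λ ar), fun a => ?_, fun a => ?_⟩
    · rw [← toPoint_onV P a (pointGraphNode Λ ar), ← h1]
      simp only [PMor.comp_onV, Option.bind_eq_some_iff]
    · rw [← toPoint_onV Q a (pointGraphNode Λ ar), ← h2]
      simp only [PMor.comp_onV, Option.bind_eq_some_iff]
  -- by saturation, `P` and `Q` are the domains on edges of morphisms that agree with the square on
  -- nodes
  · intro P Q hPQ hP hQ
    have hVc : ∀ x, (φ.onV x).bind ψ'.onV = (ψ.onV x).bind φ'.onV :=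
      fun x => congrArg (fun χ => χ.onV x) h.1
    let f := toSaturated ψ'.onV P
    let g := toSaturated φ'.onV Q
    have aux : ∀ {G H : Hypergraph Λ ar} (φ : PMor G H) (p : H.V → Option G₃.V) e a,
        φ.onE e = some a → (H.conn a).map p = (G.conn e).map fun v => (φ.onV v).bind p := by
      intro G H φ p e a ha
      have h1 : ((G.conn e).map fun v => (φ.onV v).bind p) =
          ((G.conn e).map φ.onV).map fun o => o.bind p := by rw [List.map_map]; rfl
      rw [h1, φ.conn_eq _ _ ha, List.map_map]
      rfl
    have hfg : f.comp φ = g.comp ψ := by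
      ext1 x
      · exact hVc x
      · ext k
        simp only [PMor.comp_onE, Option.bind_eq_some_iff, f, g, toSaturated_onE]
        constructor
        · rintro ⟨a, ha, hPa, hl, hc⟩
          obtain ⟨b, hb, hQb⟩ := (hPQ x).1 ⟨a, ha, hPa⟩
          refine ⟨b, hb, hQb, ?_, ?_⟩
          · rw [hl, ← φ.label_eq _ _ ha, ψ.label_eq _ _ hb]
          · rw [← hc, aux φ _ _ _ ha, aux ψ _ _ _ hb]
            exact List.map_congr_left fun v _ => (hVc v).symm
        · rintro ⟨a, ha, hPa, hl, hc⟩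
          obtain ⟨b, hb, hQb⟩ := (hPQ x).2 ⟨a, ha, hPa⟩
          refine ⟨b, hb, hQb, ?_, ?_⟩
          · rw [hl, ← ψ.label_eq _ _ ha, φ.label_eq _ _ hb]
          · rw [← hc, aux φ _ _ _ hb, aux ψ _ _ _ ha]
            exact List.map_congr_left fun v _ => hVc v
    obtain ⟨η, ⟨h1, h2⟩, -⟩ := h.2 _ f g hfg
    refine ⟨fun t => ∃ k, η.onE t = some k, fun a => ?_, fun a => ?_⟩
    · have h3 : P a ↔ ∃ k, f.onE a = some k :=
        ⟨fun h => exists_toSaturated_onE _ _ _ h (hP a h),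
          fun ⟨k, hk⟩ => ((toSaturated_onE _ _ _ _).1 hk).1⟩
      rw [h3, ← h1]
      simp only [PMor.comp_onE, Option.bind_eq_some_iff]
      tauto
    · have h3 : Q a ↔ ∃ k, g.onE a = some k :=
        ⟨fun h => exists_toSaturated_onE _ _ _ h (hQ a h),
          fun ⟨k, hk⟩ => ((toSaturated_onE _ _ _ _).1 hk).1⟩
      rw [h3, ← h2]
      simp only [PMor.comp_onE, Option.bind_eq_some_iff]
      tauto

end Tests

section Pushouts

variable {G₀ G₁ G₂ G₃ : Hypergraph Λ ar}

/-- Every span of partial morphisms has a pushout: the quotient of the disjoint union by all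
compatible pairs of predicates, where predicates on edges must imply that all nodes of the edge
survive. -/
theorem exists_isPushout (φ : PMor G₀ G₁) (ψ : PMor G₀ G₂) :
    ∃ (G₃ : Hypergraph Λ ar) (ψ' : PMor G₁ G₃) (φ' : PMor G₂ G₃),
      IsElementaryPushout φ ψ ψ' φ' := by
  classical
  have := G₁.finite_V
  have := G₁.finite_E
  have := G₂.finite_V
  have := G₂.finite_E
  obtain ⟨V, q, hfin, hsurj, hdesc, heq, hne⟩ := exists_quotient
    {S : G₁.V ⊕ G₂.V → Prop | IsCocone φ.onV ψ.onV (fun a => S (.inl a)) fun b => S (.inr b)}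
  have hcommV : ∀ x, ((φ.onV x).bind fun a => q (.inl a)) =
      (ψ.onV x).bind fun b => q (.inr b) := by
    intro x
    cases ha : φ.onV x with
    | none =>
      cases hb : ψ.onV x with
      | none => rfl
      | some b =>
        by_contra hq
        obtain ⟨S, hS, hSb⟩ := hne (.inr b) fun h => hq (by simp [h])
        obtain ⟨a, ha', -⟩ := (hS x).2 ⟨b, hb, hSb⟩
        simp [ha] at ha'
    | some a =>
      cases hb : ψ.onV x with
      | none =>
        by_contra hq
        obtain ⟨S, hS, hSb⟩ := hne (.inl a) fun h => hq (by simp [h])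
        obtain ⟨b, hb', -⟩ := (hS x).1 ⟨a, ha, hSb⟩
        simp [hb] at hb'
      | some b =>
        refine heq _ _ fun S hS => ?_
        have := hS x
        simpa [ha, hb] using this
  -- labels and sequences of nodes of the edges of the disjoint union
  let lab : G₁.E ⊕ G₂.E → Λ := Sum.elim G₁.label G₂.label
  let con : G₁.E ⊕ G₂.E → List (Option V) :=
    Sum.elim (fun e => (G₁.conn e).map fun v => q (.inl v))
      fun e => (G₂.conn e).map fun v => q (.inr v)
  have hcon_len : ∀ e, (con e).length = ar (lab e) := by
    rintro (e | e)
    · simpa [con, lab] using G₁.length_conn e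
    · simpa [con, lab] using G₂.length_conn e
  let FE : Set (G₁.E ⊕ G₂.E → Prop) := {S |
    IsCocone φ.onE ψ.onE (fun a => S (.inl a)) (fun b => S (.inr b)) ∧ ∀ e, S e → none ∉ con e}
  obtain ⟨E, qE, hfinE, hsurjE, hdescE, heqE, hneE⟩ := exists_quotient FE
  have hcommE : ∀ x, ((φ.onE x).bind fun a => qE (.inl a)) =
      (ψ.onE x).bind fun b => qE (.inr b) := by
    intro x
    cases ha : φ.onE x with
    | none =>
      cases hb : ψ.onE x with
      | none => rfl
      | some b =>
        by_contra hq
        obtain ⟨S, hS, hSb⟩ := hneE (.inr b) fun h => hq (by simp [h])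
        obtain ⟨a, ha', -⟩ := (hS.1 x).2 ⟨b, hb, hSb⟩
        simp [ha] at ha'
    | some a =>
      cases hb : ψ.onE x with
      | none =>
        by_contra hq
        obtain ⟨S, hS, hSb⟩ := hneE (.inl a) fun h => hq (by simp [h])
        obtain ⟨b, hb', -⟩ := (hS.1 x).1 ⟨a, ha, hSb⟩
        simp [hb] at hb'
      | some b =>
        refine heqE _ _ fun S hS => ?_
        have := hS.1 x
        simpa [ha, hb] using this
  have hdata : ∀ x a b, φ.onE x = some a → ψ.onE x = some b →
      lab (.inl a) = lab (.inr b) ∧ con (.inl a) = con (.inr b) := by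
    intro x a b ha hb
    refine ⟨(φ.label_eq _ _ ha).symm.trans (ψ.label_eq _ _ hb), ?_⟩
    have h1 : con (.inl a) = ((G₁.conn a).map some).map fun o => o.bind fun v => q (.inl v) := by
      rw [List.map_map]
      rfl
    have h2 : con (.inr b) = ((G₂.conn b).map some).map fun o => o.bind fun v => q (.inr v) := by
      rw [List.map_map]
      rfl
    rw [h1, h2, ← φ.conn_eq _ _ ha, ← ψ.conn_eq _ _ hb, List.map_map, List.map_map]
    exact List.map_congr_left fun v _ => hcommV v
  -- elements of the same class have the same label and the same nodes
  have hsame : ∀ e e' d, qE e = some d → qE e' = some d → lab e = lab e' ∧ con e = con e' := by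
    intro e e' d he he'
    obtain ⟨S, hS, hSe⟩ := hneE e (by simp [he])
    obtain ⟨T, hT⟩ := hdescE (fun y => S y ∧ lab e = lab y ∧ con e = con y) ⟨by
      intro x
      constructor
      · rintro ⟨a, ha, hSa, h1, h2⟩
        obtain ⟨b, hb, hSb⟩ := (hS.1 x).1 ⟨a, ha, hSa⟩
        obtain ⟨h3, h4⟩ := hdata x a b ha hb
        exact ⟨b, hb, hSb, h1.trans h3, h2.trans h4⟩
      · rintro ⟨b, hb, hSb, h1, h2⟩
        obtain ⟨a, ha, hSa⟩ := (hS.1 x).2 ⟨b, hb, hSb⟩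
        obtain ⟨h3, h4⟩ := hdata x a b ha hb
        exact ⟨a, ha, hSa, h1.trans h3.symm, h2.trans h4.symm⟩, fun y hy => hS.2 y hy.1⟩
    obtain ⟨y, hy, hTy⟩ := (hT e).1 ⟨hSe, rfl, rfl⟩
    obtain rfl := Option.some.inj (he.symm.trans hy)
    exact ((hT e').2 ⟨_, he', hTy⟩).2
  choose rep hrep using hsurjE
  have hex : ∀ d, ∃ s : List V, con (rep d) = s.map some := by
    intro d
    obtain ⟨S, hS, hSe⟩ := hneE (rep d) (by simp [hrep d])
    have h0 := hS.2 _ hSe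
    generalize con (rep d) = l at h0
    induction l with
    | nil => exact ⟨[], rfl⟩
    | cons o l ih =>
      obtain ⟨s, rfl⟩ := ih fun h => h0 (List.mem_cons_of_mem _ h)
      cases o with
      | none => exact (h0 List.mem_cons_self).elim
      | some v => exact ⟨v :: s, rfl⟩
  choose s hs using hex
  let G₃ : Hypergraph Λ ar := ⟨V, E, hfin, hfinE, s, fun d => lab (rep d), fun d => by
    rw [← hcon_len, hs, List.length_map]⟩
  let ψ' : PMor G₁ G₃ := ⟨fun a => q (.inl a), fun a => qE (.inl a),
    fun e d he => (hsame _ _ d he (hrep d)).1,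
    fun e d he => (hsame _ _ d he (hrep d)).2.trans (hs d)⟩
  let φ' : PMor G₂ G₃ := ⟨fun a => q (.inr a), fun a => qE (.inr a),
    fun e d he => (hsame _ _ d he (hrep d)).1,
    fun e d he => (hsame _ _ d he (hrep d)).2.trans (hs d)⟩
  refine ⟨G₃, ψ', φ', ⟨PMor.ext hcommV hcommE, ?_, ?_, ?_, ?_⟩⟩
  · intro t
    obtain ⟨a | b, h⟩ := hsurj t
    · exact .inl ⟨a, h⟩
    · exact .inr ⟨b, h⟩
  · intro t
    obtain ⟨a | b, h⟩ : ∃ e, qE e = some t := ⟨_, hrep t⟩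
    · exact .inl ⟨a, h⟩
    · exact .inr ⟨b, h⟩
  · intro P Q hPQ
    obtain ⟨T, hT⟩ := hdesc (Sum.elim P Q) hPQ
    exact ⟨T, fun a => hT (.inl a), fun b => hT (.inr b)⟩
  · intro P Q hPQ hP hQ
    obtain ⟨T, hT⟩ := hdescE (Sum.elim P Q) ⟨hPQ, by
      rintro (e | e) he h0
      · obtain ⟨v, hv, hv'⟩ := List.mem_map.1 h0
        exact hP e he v hv hv'
      · obtain ⟨v, hv, hv'⟩ := List.mem_map.1 h0
        exact hQ e he v hv hv'⟩
    exact ⟨T, fun a => hT (.inl a), fun b => hT (.inr b)⟩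

/-- Pushout squares are invariant under isomorphisms of the graphs in their corners. -/
theorem IsPushout.congr {φ : PMor G₀ G₁} {ψ : PMor G₀ G₂} {ψ' : PMor G₁ G₃} {φ' : PMor G₂ G₃}
    (h : IsPushout φ ψ ψ' φ') {H₀ H₁ H₂ H₃ : Hypergraph Λ ar}
    {i₀ : PMor H₀ G₀} {j₀ : PMor G₀ H₀} (h₀ : i₀.comp j₀ = PMor.id _)
    {i₁ : PMor H₁ G₁} {j₁ : PMor G₁ H₁} (h₁ : i₁.comp j₁ = PMor.id _)
    (h₁' : j₁.comp i₁ = PMor.id _)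
    {i₂ : PMor H₂ G₂} {j₂ : PMor G₂ H₂} (h₂ : i₂.comp j₂ = PMor.id _)
    (h₂' : j₂.comp i₂ = PMor.id _)
    {i₃ : PMor H₃ G₃} {j₃ : PMor G₃ H₃} (h₃ : i₃.comp j₃ = PMor.id _)
    (h₃' : j₃.comp i₃ = PMor.id _) :
    IsPushout ((j₁.comp φ).comp i₀) ((j₂.comp ψ).comp i₀) ((j₃.comp ψ').comp i₁)
      ((j₃.comp φ').comp i₂) := by
  have cancel : ∀ {A B C D : Hypergraph Λ ar} {i : PMor A B} {j : PMor B A}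
      (_ : i.comp j = PMor.id _) (f : PMor B C) (g : PMor D B),
      (f.comp i).comp (j.comp g) = f.comp g := by
    intro A B C D i j h f g
    rw [PMor.comp_assoc, ← PMor.comp_assoc i, h, PMor.id_comp]
  have cancel' : ∀ {A B C : Hypergraph Λ ar} {i : PMor A B} {j : PMor B A}
      (_ : i.comp j = PMor.id _) (f : PMor B C), (f.comp i).comp j = f := by
    intro A B C i j h f
    rw [PMor.comp_assoc, h, PMor.comp_id]
  constructor
  · simp only [← PMor.comp_assoc, cancel' h₁, cancel' h₂]
    rw [PMor.comp_assoc j₃ ψ', h.1, ← PMor.comp_assoc j₃]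
  · intro K f g hfg
    have h1 : (f.comp j₁).comp φ = (g.comp j₂).comp ψ := by
      have := congrArg (fun χ => χ.comp j₀) hfg
      simp only [← PMor.comp_assoc] at this
      rwa [cancel' h₀, cancel' h₀] at this
    obtain ⟨η, ⟨hη1, hη2⟩, hu⟩ := h.2 K _ _ h1
    refine ⟨η.comp i₃, ⟨?_, ?_⟩, ?_⟩
    · rw [← PMor.comp_assoc, cancel h₃, hη1, cancel' h₁']
    · rw [← PMor.comp_assoc, cancel h₃, hη2, cancel' h₂']
    · rintro η' ⟨e1, e2⟩
      have := hu (η'.comp j₃) ⟨by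
        rw [← e1, ← PMor.comp_assoc, cancel' h₁, ← PMor.comp_assoc], by
        rw [← e2, ← PMor.comp_assoc, cancel' h₂, ← PMor.comp_assoc]⟩
      rw [← this, cancel' h₃']

/-- An element of `G₂` outside the image of `ψ` is not identified with any other element. -/
theorem IsElementaryPushout.eq_of_onV_eq {φ : PMor G₀ G₁} {ψ : PMor G₀ G₂} {ψ' : PMor G₁ G₃}
    {φ' : PMor G₂ G₃} (h : IsElementaryPushout φ ψ ψ' φ') {b b' : G₂.V} {t : G₃.V}
    (hb : ∀ x, ψ.onV x ≠ some b) (ht : φ'.onV b = some t) (ht' : φ'.onV b' = some t) : b' = b := by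
  obtain ⟨T, -, hT⟩ := h.descV (fun _ => False) (fun y => y = b) (by
    intro x
    simp only [and_false, exists_false, false_iff, not_exists, not_and]
    rintro y hy rfl
    exact hb x hy)
  obtain ⟨s, hs, hTs⟩ := (hT b).1 rfl
  obtain rfl := Option.some.inj (ht.symm.trans hs)
  exact (hT b').2 ⟨_, ht', hTs⟩

theorem IsElementaryPushout.eq_of_onE_eq {φ : PMor G₀ G₁} {ψ : PMor G₀ G₂} {ψ' : PMor G₁ G₃}
    {φ' : PMor G₂ G₃} (h : IsElementaryPushout φ ψ ψ' φ') {b b' : G₂.E} {t : G₃.E}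
    (hb : ∀ x, ψ.onE x ≠ some b) (ht : φ'.onE b = some t) (ht' : φ'.onE b' = some t) : b' = b := by
  obtain ⟨T, -, hT⟩ := h.descE (fun _ => False) (fun y => y = b) (by
    intro x
    simp only [and_false, exists_false, false_iff, not_exists, not_and]
    rintro y hy rfl
    exact hb x hy) (fun _ h => h.elim)
    (nodesDefined_of_onE φ' fun e he => by simp [he, ht])
  obtain ⟨s, hs, hTs⟩ := (hT b).1 rfl
  obtain rfl := Option.some.inj (ht.symm.trans hs)
  exact (hT b').2 ⟨_, ht', hTs⟩

/-- Subgraph morphisms are preserved by total pushouts.  For injectivity, the singleton of `x` is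
half of a compatible pair of predicates, because `μ` is injective. -/
theorem preservedByTotalPushouts_isSubgraphMor [Finite Λ] :
    PreservedByTotalPushouts (Λ := Λ) (ar := ar) PMor.IsSubgraphMor := by
  intro G₀ G₁ G₂ G₃ μ g g' μ' hμ hg h
  have h := h.elementary
  have hV : ∀ x, (μ.onV x).bind g'.onV = (g.onV x).bind μ'.onV :=
    fun x => congrArg (fun χ => χ.onV x) h.comm
  have hE : ∀ x, (μ.onE x).bind g'.onE = (g.onE x).bind μ'.onE :=
    fun x => congrArg (fun χ => χ.onE x) h.comm
  have hcoc : ∀ {X₀ X₁ X₂ X₃ : Type} {p : X₀ → Option X₁} {q : X₀ → Option X₂}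
      {p' : X₁ → Option X₃} {q' : X₂ → Option X₃} (_ : ∀ x, (p x).bind p' = (q x).bind q')
      (_ : ∀ v v' w, p v = some w → p v' = some w → v = v') (x : X₂) (w : X₃)
      (_ : q' x = some w),
      IsCocone p q (fun a => ∃ b, p b = some a ∧ q b = some x) (fun y => y = x) := by
    intro X₀ X₁ X₂ X₃ p q p' q' hc hi x w hx z
    constructor
    · rintro ⟨a, ha, b, hb, hb'⟩
      obtain rfl := hi _ _ _ ha hb
      exact ⟨x, hb', rfl⟩
    · rintro ⟨y, hy, rfl⟩
      cases hz : p z with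
      | none =>
        have := hc z
        simp [hz, hy, hx] at this
      | some a => exact ⟨a, rfl, z, hz, hy⟩
  refine ⟨⟨?_, ?_⟩, ?_, ?_⟩
  · intro x x' w hx hx'
    obtain ⟨T, -, hT⟩ := h.descV _ _ (hcoc hV hμ.1.1 x w hx)
    obtain ⟨t, ht, hTt⟩ := (hT x).1 rfl
    obtain rfl := Option.some.inj (ht.symm.trans hx)
    exact ((hT x').2 ⟨_, hx', hTt⟩).symm
  · intro x x' w hx hx'
    obtain ⟨T, -, hT⟩ := h.descE _ _ (hcoc hE hμ.1.2 x w hx)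
      (nodesDefined_of_onE _ (by
        rintro a ⟨b, hb, hb'⟩ h0
        have := hE b
        simp [hb, hb', h0, hx] at this))
      (nodesDefined_of_onE _ (by
        rintro a rfl h0
        simp [hx] at h0))
    obtain ⟨t, ht, hTt⟩ := (hT x).1 rfl
    obtain rfl := Option.some.inj (ht.symm.trans hx)
    exact ((hT x').2 ⟨_, hx', hTt⟩).symm
  · intro w
    rcases h.surjV w with ⟨a, ha⟩ | h1
    · obtain ⟨b, hb⟩ := hμ.2.1 a
      obtain ⟨c, hc⟩ := hg.1 b
      refine ⟨c, ?_⟩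
      have := hV b
      simpa [hb, hc, ha, eq_comm] using this
    · exact h1
  · intro w
    rcases h.surjE w with ⟨a, ha⟩ | h1
    · obtain ⟨b, hb⟩ := hμ.2.2 a
      obtain ⟨c, hc⟩ := hg.2 b
      refine ⟨c, ?_⟩
      have := hE b
      simpa [hb, hc, ha, eq_comm] using this
    · exact h1

end Pushouts

/-! ### Pushouts and subgraphs -/

section

variable {L R G H S : Hypergraph Λ ar}

/-- The nodes of `G` that are in the image of `m` or in the domain of `f`.  In the applications `f`
is a composition `G ⇀ H ⇀ S`, and its domain is the part of `G` that survives in `S`. -/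
def keptV (m : PMor L G) (f : PMor G S) (v : G.V) : Prop :=
  (∃ x, m.onV x = some v) ∨ ∃ s, f.onV v = some s

/-- The edges of `G` that are in the image of `m` or in the domain of `f`. -/
def keptE (m : PMor L G) (f : PMor G S) (e : G.E) : Prop :=
  (∃ x, m.onE x = some e) ∨ ∃ s, f.onE e = some s

theorem keptV_of_keptE (m : PMor L G) (f : PMor G S) (e : G.E) (he : keptE m f e) (v : G.V)
    (hv : v ∈ G.conn e) : keptV m f v := by
  rcases he with ⟨x, hx⟩ | ⟨s, hs⟩
  · obtain ⟨w, -, hw⟩ := m.exists_onV_of_onE' hx hv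
    exact .inl ⟨w, hw⟩
  · obtain ⟨w, -, hw⟩ := f.exists_onV_of_onE hs hv
    exact .inr ⟨w, hw⟩

/-- The subgraph of `G` formed by the image of `m` and the domain of `f`. -/
def kept (m : PMor L G) (f : PMor G S) : Hypergraph Λ ar :=
  G.restrict (keptV m f) (keptE m f) (keptV_of_keptE m f)

/-- The inclusion of the subgraph `kept m f`. -/
def keptIncl (m : PMor L G) (f : PMor G S) : PMor (kept m f) G :=
  G.incl (keptV m f) (keptE m f) (keptV_of_keptE m f)

theorem keptIncl_total (m : PMor L G) (f : PMor G S) : (keptIncl m f).Total :=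
  G.incl_total _ _ _

theorem keptIncl_injective (m : PMor L G) (f : PMor G S) : (keptIncl m f).Injective :=
  G.incl_injective _ _ _

theorem exists_keptIncl_onV {m : PMor L G} {f : PMor G S} {v : G.V} (h : keptV m f v) :
    ∃ w, (keptIncl m f).onV w = some v :=
  ⟨⟨v, h⟩, rfl⟩

theorem exists_keptIncl_onE {m : PMor L G} {f : PMor G S} {v : G.E} (h : keptE m f v) :
    ∃ w, (keptIncl m f).onE w = some v :=
  ⟨⟨v, h⟩, rfl⟩

theorem exists_keptLift (m : PMor L G) (f : PMor G S) :
    ∃ m₀ : PMor L (kept m f), (keptIncl m f).comp m₀ = m :=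
  G.exists_lift _ _ _ m (fun x _ h => .inl ⟨x, h⟩) fun x _ h => .inl ⟨x, h⟩

theorem total_of_comp_total {K : Hypergraph Λ ar} {j : PMor G K} {m : PMor L G}
    (h : (j.comp m).Total) : m.Total := by
  constructor
  · intro v
    obtain ⟨w, hw⟩ := h.1 v
    obtain ⟨a, ha, -⟩ := Option.bind_eq_some_iff.1 hw
    exact ⟨a, ha⟩
  · intro v
    obtain ⟨w, hw⟩ := h.2 v
    obtain ⟨a, ha, -⟩ := Option.bind_eq_some_iff.1 hw
    exact ⟨a, ha⟩

theorem conflictFree_of_comp {K : Hypergraph Λ ar} {j : PMor G K} (hj : j.Total) {m : PMor L G}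
    {r : PMor L R} (h : (j.comp m).ConflictFree r) : m.ConflictFree r := by
  constructor
  · intro x y z hx hy
    obtain ⟨w, hw⟩ := hj.1 z
    exact h.1 x y w (by simp [hx, hw]) (by simp [hy, hw])
  · intro x y z hx hy
    obtain ⟨w, hw⟩ := hj.2 z
    exact h.2 x y w (by simp [hx, hw]) (by simp [hy, hw])

theorem PMor.ConflictFree.comp {K : Hypergraph Λ ar} {j : PMor G K} (hj : j.Injective)
    {m : PMor L G} {r : PMor L R} (h : m.ConflictFree r) : (j.comp m).ConflictFree r := by
  constructor
  · intro x y z hx hy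
    obtain ⟨a, ha, ha'⟩ := Option.bind_eq_some_iff.1 hx
    obtain ⟨b, hb, hb'⟩ := Option.bind_eq_some_iff.1 hy
    obtain rfl := hj.1 _ _ _ ha' hb'
    exact h.1 x y _ ha hb
  · intro x y z hx hy
    obtain ⟨a, ha, ha'⟩ := Option.bind_eq_some_iff.1 hx
    obtain ⟨b, hb, hb'⟩ := Option.bind_eq_some_iff.1 hy
    obtain rfl := hj.2 _ _ _ ha' hb'
    exact h.2 x y _ ha hb

/-- Extending a cocone along an embedding `j` of one of its feet. -/
theorem isCocone_extend {X₀ X₁ X₂ X₂' : Type} {f : X₀ → Option X₁} {g : X₀ → Option X₂}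
    {g' : X₀ → Option X₂'} {j : X₂ → Option X₂'} (hg : ∀ x, (g x).bind j = g' x)
    (hj : ∀ a b c, j a = some c → j b = some c → a = b) {P : X₁ → Prop} {Q : X₂ → Prop}
    (h : IsCocone f g P Q) (ht : ∀ a, ∃ c, j a = some c) :
    IsCocone f g' P fun c => ∃ b, j b = some c ∧ Q b := by
  intro x
  rw [h x]
  constructor
  · rintro ⟨b, hb, hQ⟩
    obtain ⟨c, hc⟩ := ht b
    exact ⟨c, by rw [← hg, hb, Option.bind_some, hc], b, hc, hQ⟩
  · rintro ⟨c, hc, b, hb, hQ⟩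
    rw [← hg] at hc
    obtain ⟨b', hb', hc'⟩ := Option.bind_eq_some_iff.1 hc
    obtain rfl := hj _ _ _ hc' hb
    exact ⟨_, hb', hQ⟩

/-- If the rule `r` is applied at a match that lies in a subgraph of `G`, the result of rewriting
the subgraph is a subgraph of the result of rewriting `G`. -/
theorem exists_embedding_of_pushouts {G₀ H₀ : Hypergraph Λ ar} {r : PMor L R} {m : PMor L G}
    {m' : PMor R H} {r' : PMor G H} (h : IsElementaryPushout r m m' r')
    {j : PMor G₀ G} (hjt : j.Total) (hji : j.Injective) {m₀ : PMor L G₀} (hm : j.comp m₀ = m)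
    {m₀' : PMor R H₀} {r₀' : PMor G₀ H₀} (h₀ : IsElementaryPushout r m₀ m₀' r₀') :
    ∃ κ : PMor H₀ H, κ.Total ∧ κ.Injective ∧ κ.comp m₀' = m' ∧ κ.comp r₀' = r'.comp j := by
  obtain ⟨κ, ⟨h1, h2⟩, -⟩ := h₀.isPushout.2 H m' (r'.comp j) (by
    rw [PMor.comp_assoc, hm, h.comm])
  have h0V : ∀ x, (r.onV x).bind m₀'.onV = (m₀.onV x).bind r₀'.onV :=
    fun x => congrArg (fun χ => χ.onV x) h₀.comm
  have h0E : ∀ x, (r.onE x).bind m₀'.onE = (m₀.onE x).bind r₀'.onE :=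
    fun x => congrArg (fun χ => χ.onE x) h₀.comm
  -- the predicate "is sent to `t`" extends to `G` and hence descends to `H`
  have keyV : ∀ t : H₀.V, ∃ T : H.V → Prop,
      (∀ a, m₀'.onV a = some t ↔ ∃ s, m'.onV a = some s ∧ T s) ∧
      ∀ b, r₀'.onV b = some t ↔ ∃ s, (r'.comp j).onV b = some s ∧ T s := by
    intro t
    obtain ⟨T, hT, hT'⟩ := h.descV _ _ (isCocone_extend
      (fun x => congrArg (fun χ => χ.onV x) hm) hji.1 (isCocone_eq_some h0V t) hjt.1)
    refine ⟨T, hT, fun b => ?_⟩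
    obtain ⟨c, hc⟩ := hjt.1 b
    simp only [PMor.comp_onV, hc, Option.bind_some]
    rw [← hT' c]
    constructor
    · exact fun hb => ⟨b, hc, hb⟩
    · rintro ⟨b', hb', hb''⟩
      obtain rfl := hji.1 _ _ _ hc hb'
      exact hb''
  have defV : (∀ a t, m₀'.onV a = some t → ∃ s, m'.onV a = some s) ∧
      ∀ b t, r₀'.onV b = some t → ∃ s, (r'.comp j).onV b = some s := by
    constructor
    · intro a t ha
      obtain ⟨T, hT, -⟩ := keyV t
      obtain ⟨s, hs, -⟩ := (hT a).1 ha
      exact ⟨s, hs⟩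
    · intro a t ha
      obtain ⟨T, -, hT⟩ := keyV t
      obtain ⟨s, hs, -⟩ := (hT a).1 ha
      exact ⟨s, hs⟩
  have keyE : ∀ t : H₀.E, ∃ T : H.E → Prop,
      (∀ a, m₀'.onE a = some t ↔ ∃ s, m'.onE a = some s ∧ T s) ∧
      ∀ b, r₀'.onE b = some t ↔ ∃ s, (r'.comp j).onE b = some s ∧ T s := by
    intro t
    obtain ⟨T, hT, hT'⟩ := h.descE _ _ (isCocone_extend
      (fun x => congrArg (fun χ => χ.onE x) hm) hji.2 (isCocone_eq_some h0E t) hjt.2)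
      (by
        intro e he v hv h0
        obtain ⟨w, -, hw⟩ := m₀'.exists_onV_of_onE he hv
        obtain ⟨s, hs⟩ := defV.1 _ _ hw
        simp [hs] at h0)
      (by
        rintro e ⟨b, hb, hb'⟩ v hv h0
        obtain ⟨u, hu, hu'⟩ := j.exists_onV_of_onE' hb hv
        obtain ⟨w, -, hw⟩ := r₀'.exists_onV_of_onE hb' hu
        obtain ⟨s, hs⟩ := defV.2 _ _ hw
        simp [hu', h0] at hs)
    refine ⟨T, hT, fun b => ?_⟩
    obtain ⟨c, hc⟩ := hjt.2 b
    simp only [PMor.comp_onE, hc, Option.bind_some]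
    rw [← hT' c]
    constructor
    · exact fun hb => ⟨b, hc, hb⟩
    · rintro ⟨b', hb', hb''⟩
      obtain rfl := hji.2 _ _ _ hc hb'
      exact hb''
  -- every element of `H₀` has a value under `κ` which determines it
  have finV : ∀ t, ∃ s, κ.onV t = some s ∧ ∀ t', κ.onV t' = some s → t' = t := by
    intro t
    obtain ⟨T, hT, hT'⟩ := keyV t
    have h3 : ∃ s, κ.onV t = some s ∧ T s := by
      rcases h₀.surjV t with ⟨a, ha⟩ | ⟨a, ha⟩
      · rw [← PMor.onV_eq_of_comp_eq h1 ha]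
        exact (hT a).1 ha
      · rw [← PMor.onV_eq_of_comp_eq h2 ha]
        exact (hT' a).1 ha
    obtain ⟨s, hs, hTs⟩ := h3
    refine ⟨s, hs, fun t' ht' => ?_⟩
    rcases h₀.surjV t' with ⟨a, ha⟩ | ⟨a, ha⟩
    · rw [← PMor.onV_eq_of_comp_eq h1 ha] at ht'
      exact Option.some.inj (ha.symm.trans ((hT a).2 ⟨s, ht', hTs⟩))
    · rw [← PMor.onV_eq_of_comp_eq h2 ha] at ht'
      exact Option.some.inj (ha.symm.trans ((hT' a).2 ⟨s, ht', hTs⟩))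
  have finE : ∀ t, ∃ s, κ.onE t = some s ∧ ∀ t', κ.onE t' = some s → t' = t := by
    intro t
    obtain ⟨T, hT, hT'⟩ := keyE t
    have h3 : ∃ s, κ.onE t = some s ∧ T s := by
      rcases h₀.surjE t with ⟨a, ha⟩ | ⟨a, ha⟩
      · rw [← PMor.onE_eq_of_comp_eq h1 ha]
        exact (hT a).1 ha
      · rw [← PMor.onE_eq_of_comp_eq h2 ha]
        exact (hT' a).1 ha
    obtain ⟨s, hs, hTs⟩ := h3
    refine ⟨s, hs, fun t' ht' => ?_⟩
    rcases h₀.surjE t' with ⟨a, ha⟩ | ⟨a, ha⟩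
    · rw [← PMor.onE_eq_of_comp_eq h1 ha] at ht'
      exact Option.some.inj (ha.symm.trans ((hT a).2 ⟨s, ht', hTs⟩))
    · rw [← PMor.onE_eq_of_comp_eq h2 ha] at ht'
      exact Option.some.inj (ha.symm.trans ((hT' a).2 ⟨s, ht', hTs⟩))
  refine ⟨κ, ⟨fun t => ?_, fun t => ?_⟩, ⟨?_, ?_⟩, h1, h2⟩
  · obtain ⟨s, hs, -⟩ := finV t
    exact ⟨s, hs⟩
  · obtain ⟨s, hs, -⟩ := finE t
    exact ⟨s, hs⟩
  · intro t t' s ht ht'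
    obtain ⟨s', hs', hu⟩ := finV t
    obtain rfl := Option.some.inj (hs'.symm.trans ht)
    exact (hu t' ht').symm
  · intro t t' s ht ht'
    obtain ⟨s', hs', hu⟩ := finE t
    obtain rfl := Option.some.inj (hs'.symm.trans ht)
    exact (hu t' ht').symm

theorem card_kept_le [Finite Λ] {r : PMor L R} {m : PMor L G} {m' : PMor R H} {r' : PMor G H}
    (h : IsElementaryPushout r m m' r') {μ : PMor H S} (hμ : μ.Injective) :
    Nat.card (kept m (μ.comp r')).V ≤ Nat.card L.V + Nat.card S.V ∧
      Nat.card (kept m (μ.comp r')).E ≤ Nat.card L.E + Nat.card S.E := by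
  classical
  have := L.finite_V
  have := L.finite_E
  have := S.finite_V
  have := S.finite_E
  -- an element outside the image of `m` is determined by its image in `S`
  have key : ∀ {X Y Z W : Type} [Finite X] [Finite Z] (m : X → Option Y) (q : Y → Option W)
      (μ : W → Option Z), (∀ a b c, μ a = some c → μ b = some c → a = b) →
      (∀ b b' t, (∀ x, m x ≠ some b) → q b = some t → q b' = some t → b' = b) →
      Nat.card {y // (∃ x, m x = some y) ∨ ∃ s, (q y).bind μ = some s} ≤
        Nat.card X + Nat.card Z := by
    intro X Y Z W _ _ m q μ hμ hq
    rw [← Nat.card_sum]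
    have hex : ∀ y : {y // (∃ x, m x = some y) ∨ ∃ s, (q y).bind μ = some s},
        ∃ z : X ⊕ Z, (∀ x, z = .inl x → m x = some y.1) ∧
          ∀ s, z = .inr s → (∀ x, m x ≠ some y.1) ∧ (q y.1).bind μ = some s := by
      rintro ⟨y, hy⟩
      by_cases h : ∃ x, m x = some y
      · obtain ⟨x, hx⟩ := h
        exact ⟨.inl x, by simpa using hx, by simp⟩
      · obtain ⟨s, hs⟩ := hy.resolve_left h
        push Not at h
        exact ⟨.inr s, by simp, by simpa [hs] using h⟩
    choose F hF hF' using hex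
    refine Nat.card_le_card_of_injective F fun y y' hyy => Subtype.ext ?_
    rcases hz : F y with x | s
    · have h1 := hF y x hz
      have h2 := hF y' x (hyy ▸ hz)
      exact Option.some.inj (h1.symm.trans h2)
    · have h1 := hF' y s hz
      have h2 := hF' y' s (hyy ▸ hz)
      obtain ⟨a, ha, ha'⟩ := Option.bind_eq_some_iff.1 h1.2
      obtain ⟨b, hb, hb'⟩ := Option.bind_eq_some_iff.1 h2.2
      obtain rfl := hμ _ _ _ ha' hb'
      exact (hq _ _ _ h1.1 ha hb).symm
  exact ⟨key m.onV r'.onV μ.onV hμ.1 fun b b' t h1 h2 h3 => h.eq_of_onV_eq h1 h2 h3,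
    key m.onE r'.onE μ.onE hμ.2 fun b b' t h1 h2 h3 => h.eq_of_onE_eq h1 h2 h3⟩

/-- If the subgraph `kept m (μ ∘ r')` of `G` is rewritten at the same match, the result still
contains `S`. -/
theorem exists_isSubgraphMor_of_kept {H₀ : Hypergraph Λ ar} {r : PMor L R} {m : PMor L G}
    {m' : PMor R H} {r' : PMor G H} (h : IsElementaryPushout r m m' r') {μ : PMor H S}
    (hμ : μ.IsSubgraphMor) {m₀ : PMor L (kept m (μ.comp r'))}
    (hm : (keptIncl m (μ.comp r')).comp m₀ = m) {m₀' : PMor R H₀}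
    {r₀' : PMor (kept m (μ.comp r')) H₀} (h₀ : IsElementaryPushout r m₀ m₀' r₀') :
    ∃ κ : PMor H₀ H, κ.Total ∧ κ.Injective ∧ κ.comp m₀' = m' ∧
      κ.comp r₀' = r'.comp (keptIncl m (μ.comp r')) ∧ (μ.comp κ).IsSubgraphMor := by
  obtain ⟨κ, ht, hi, h1, h2⟩ := exists_embedding_of_pushouts h (keptIncl_total _ _)
    (keptIncl_injective _ _) hm h₀
  refine ⟨κ, ht, hi, h1, h2, hμ.1.comp hi, ?_, ?_⟩
  · intro s
    obtain ⟨t, ht⟩ := hμ.2.1 s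
    have h3 : ∃ t₀, κ.onV t₀ = some t := by
      rcases h.surjV t with ⟨a, ha⟩ | ⟨g, hg⟩
      · rw [← h1] at ha
        obtain ⟨t₀, -, h⟩ := Option.bind_eq_some_iff.1 ha
        exact ⟨t₀, h⟩
      · have hk : keptV m (μ.comp r') g := .inr ⟨s, by simp [hg, ht]⟩
        obtain ⟨w, hw⟩ := exists_keptIncl_onV hk
        have h4 : (κ.comp r₀').onV w = some t := by rw [h2]; simp [hw, hg]
        obtain ⟨t₀, -, h⟩ := Option.bind_eq_some_iff.1 h4
        exact ⟨t₀, h⟩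
    obtain ⟨t₀, h⟩ := h3
    exact ⟨t₀, by simp [h, ht]⟩
  · intro s
    obtain ⟨t, ht⟩ := hμ.2.2 s
    have h3 : ∃ t₀, κ.onE t₀ = some t := by
      rcases h.surjE t with ⟨a, ha⟩ | ⟨g, hg⟩
      · rw [← h1] at ha
        obtain ⟨t₀, -, h⟩ := Option.bind_eq_some_iff.1 ha
        exact ⟨t₀, h⟩
      · have hk : keptE m (μ.comp r') g := .inr ⟨s, by simp [hg, ht]⟩
        obtain ⟨w, hw⟩ := exists_keptIncl_onE hk
        have h4 : (κ.comp r₀').onE w = some t := by rw [h2]; simp [hw, hg]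
        obtain ⟨t₀, -, h⟩ := Option.bind_eq_some_iff.1 h4
        exact ⟨t₀, h⟩
    obtain ⟨t₀, h⟩ := h3
    exact ⟨t₀, by simp [h, ht]⟩

/-- The set-theoretic part of pushout closure: the feet of a pushout square are cut down to subsets
`X₁'` and `X₂'`, and its last corner to the domain of `ν`. -/
theorem descends_restrict {X₀ X₁ X₁' X₂ X₂' X₃ Y : Type} {f : X₀ → Option X₁} {g : X₀ → Option X₂}
    {f' : X₁ → Option X₃} {g' : X₂ → Option X₃} {ν : X₃ → Option Y}
    {i : X₁' → X₁} {ρ : X₁ → Option X₁'} {k : X₂' → X₂} {σ : X₂ → Option X₂'}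
    {P : X₁' → Prop} {Q : X₂' → Prop}
    (hρ : ∀ x y, ρ x = some y ↔ i y = x) (hσ : ∀ x y, σ x = some y ↔ k y = x)
    (hν : ∀ a b c, ν a = some c → ν b = some c → a = b)
    (hc : ∀ x, (f x).bind f' = (g x).bind g')
    (hi : ∀ x, ∃ y, ((f' (i x)).bind ν) = some y)
    (hk : ∀ x, (∃ z, g z = some (k x)) ∨ ∃ y, ((g' (k x)).bind ν) = some y)
    (hPQ : IsCocone (fun x => (f x).bind ρ) (fun x => (g x).bind σ) P Q)
    (hd : IsCocone f g (fun a => ∃ b, ρ a = some b ∧ P b) (fun a => ∃ b, σ a = some b ∧ Q b) →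
      Descends f' g' (fun a => ∃ b, ρ a = some b ∧ P b) fun a => ∃ b, σ a = some b ∧ Q b) :
    Descends (fun a => (f' (i a)).bind ν) (fun a => (g' (k a)).bind ν) P Q := by
  have hcoc : IsCocone f g (fun a => ∃ b, ρ a = some b ∧ P b)
      (fun a => ∃ b, σ a = some b ∧ Q b) := by
    intro x
    have := hPQ x
    simp only [Option.bind_eq_some_iff] at this
    constructor
    · rintro ⟨a, ha, b, hb, hP⟩
      obtain ⟨b', ⟨a', ha', hb'⟩, hQ⟩ := this.1 ⟨b, ⟨a, ha, hb⟩, hP⟩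
      exact ⟨a', ha', b', hb', hQ⟩
    · rintro ⟨a, ha, b, hb, hP⟩
      obtain ⟨b', ⟨a', ha', hb'⟩, hQ⟩ := this.2 ⟨b, ⟨a, ha, hb⟩, hP⟩
      exact ⟨a', ha', b', hb', hQ⟩
  obtain ⟨T, hT, hT'⟩ := hd hcoc
  refine ⟨fun y => ∃ t, ν t = some y ∧ T t, fun a => ?_, fun b => ?_⟩
  · have h1 : P a ↔ ∃ b, ρ (i a) = some b ∧ P b := by
      constructor
      · exact fun h => ⟨a, (hρ _ _).2 rfl, h⟩
      · rintro ⟨b, hb, hP⟩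
        have h2 := (hρ (i a) a).2 rfl
        obtain rfl := Option.some.inj (h2.symm.trans hb)
        exact hP
    refine h1.trans ((hT _).trans ?_)
    constructor
    · rintro ⟨t, ht, hTt⟩
      obtain ⟨y, hy⟩ := hi a
      rw [ht, Option.bind_some] at hy
      exact ⟨y, Option.bind_eq_some_iff.2 ⟨t, ht, hy⟩, t, hy, hTt⟩
    · rintro ⟨y, hy, t, ht, hTt⟩
      obtain ⟨t', ht', ht''⟩ := Option.bind_eq_some_iff.1 hy
      obtain rfl := hν _ _ _ ht'' ht
      exact ⟨_, ht', hTt⟩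
  · have h1 : Q b ↔ ∃ c, σ (k b) = some c ∧ Q c := by
      constructor
      · exact fun h => ⟨b, (hσ _ _).2 rfl, h⟩
      · rintro ⟨c, hc, hQ⟩
        have h2 := (hσ (k b) b).2 rfl
        obtain rfl := Option.some.inj (h2.symm.trans hc)
        exact hQ
    refine h1.trans ((hT' _).trans ?_)
    constructor
    · rintro ⟨t, ht, hTt⟩
      -- if the image of `k b` were deleted by `ν`, its partners would lie outside `X₁'`
      have hy : ∃ y, ν t = some y := by
        rcases hk b with ⟨z, hz⟩ | ⟨y, hy⟩
        · have h2 := (hT' (k b)).2 ⟨t, ht, hTt⟩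
          obtain ⟨a, ha, b', hb', -⟩ := (hcoc z).2 ⟨_, hz, h2⟩
          obtain rfl := (hρ _ _).1 hb'
          obtain ⟨y, hy⟩ := hi b'
          have h3 := hc z
          rw [ha, hz, Option.bind_some, Option.bind_some, ht] at h3
          rw [h3, Option.bind_some] at hy
          exact ⟨y, hy⟩
        · rw [ht, Option.bind_some] at hy
          exact ⟨y, hy⟩
      obtain ⟨y, hy⟩ := hy
      exact ⟨y, Option.bind_eq_some_iff.2 ⟨t, ht, hy⟩, t, hy, hTt⟩
    · rintro ⟨y, hy, t, ht, hTt⟩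
      obtain ⟨t', ht', ht''⟩ := Option.bind_eq_some_iff.1 hy
      obtain rfl := hν _ _ _ ht'' ht
      exact ⟨_, ht', hTt⟩

/-- A morphism whose domain lies in the image of `j` factors through the partial inverse of `j`. -/
theorem comp_comp_inverse {K : Hypergraph Λ ar} {j : PMor K G} {μ : PMor G K}
    (hV : ∀ v w, μ.onV w = some v ↔ j.onV v = some w)
    (hE : ∀ v w, μ.onE w = some v ↔ j.onE v = some w) (f : PMor G S)
    (hfV : ∀ v, (∃ s, f.onV v = some s) → ∃ w, j.onV w = some v)
    (hfE : ∀ v, (∃ s, f.onE v = some s) → ∃ w, j.onE w = some v) : (f.comp j).comp μ = f := by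
  ext1 a
  · ext s
    simp only [PMor.comp_onV, Option.bind_eq_some_iff]
    constructor
    · rintro ⟨w, hw, v, hv, hs⟩
      obtain rfl := Option.some.inj (hv.symm.trans ((hV _ _).1 hw))
      exact hs
    · intro hs
      obtain ⟨w, hw⟩ := hfV a ⟨s, hs⟩
      exact ⟨w, (hV _ _).2 hw, a, hw, hs⟩
  · ext s
    simp only [PMor.comp_onE, Option.bind_eq_some_iff]
    constructor
    · rintro ⟨w, hw, v, hv, hs⟩
      obtain rfl := Option.some.inj (hv.symm.trans ((hE _ _).1 hw))
      exact hs
    · intro hs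
      obtain ⟨w, hw⟩ := hfE a ⟨s, hs⟩
      exact ⟨w, (hE _ _).2 hw, a, hw, hs⟩

/-- The core of pushout closure: `R` is cut down to the domain of `μ ∘ m'`, and `G` to the image of
`m` and the domain of `μ ∘ r'`. -/
theorem pushoutClosed_isSubgraphMor [Finite Λ] :
    PushoutClosed (Λ := Λ) (ar := ar) PMor.IsSubgraphMor := by
  intro L R G H S r m m' r' μ hm hcf hpo hμ
  have h := hpo.elementary
  set p := μ.comp m' with hp
  set q := μ.comp r' with hq
  have hpE : ∀ e, (∃ d, p.onE e = some d) → ∀ v ∈ R.conn e, ∃ w, p.onV v = some w := by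
    rintro e ⟨d, hd⟩ v hv
    obtain ⟨w, -, hw⟩ := p.exists_onV_of_onE hd hv
    exact ⟨w, hw⟩
  let R' := R.restrict (fun v => ∃ w, p.onV v = some w) (fun e => ∃ d, p.onE e = some d) hpE
  let iR : PMor R' R := R.incl _ _ hpE
  obtain ⟨μR, hμR, -, hRV, hRE⟩ :=
    (R.incl_total _ _ hpE).exists_retraction (R.incl_injective _ _ hpE)
  obtain ⟨μG, hμG, -, hGV, hGE⟩ := (keptIncl_total m q).exists_retraction (keptIncl_injective m q)
  have hμR_V : ∀ (a : R.V) (w : R'.V), μR.onV a = some w ↔ w.1 = a := fun a w =>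
    (hRV w a).trans Option.some_inj
  have hμR_E : ∀ (a : R.E) (w : R'.E), μR.onE a = some w ↔ w.1 = a := fun a w =>
    (hRE w a).trans Option.some_inj
  have hμG_V : ∀ (a : G.V) (w : (kept m q).V), μG.onV a = some w ↔ w.1 = a := fun a w =>
    (hGV w a).trans Option.some_inj
  have hμG_E : ∀ (a : G.E) (w : (kept m q).E), μG.onE a = some w ↔ w.1 = a := fun a w =>
    (hGE w a).trans Option.some_inj
  let n : PMor R' S := p.comp iR
  let s : PMor (kept m q) S := q.comp (keptIncl m q)
  have hn : n.comp μR = p := comp_comp_inverse hRV hRE p (fun v h => ⟨⟨v, h⟩, rfl⟩)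
    fun e h => ⟨⟨e, h⟩, rfl⟩
  have hs : s.comp μG = q := comp_comp_inverse hGV hGE q (fun v h => ⟨⟨v, .inr h⟩, rfl⟩)
    fun e h => ⟨⟨e, .inr h⟩, rfl⟩
  have hpo' : IsElementaryPushout (μR.comp r) (μG.comp m) n s := by
    refine ⟨?_, ?_, ?_, ?_, ?_⟩
    · rw [← PMor.comp_assoc, hn, ← PMor.comp_assoc, hs, hp, hq, PMor.comp_assoc, PMor.comp_assoc,
        h.comm]
    · intro w
      obtain ⟨t, ht⟩ := hμ.2.1 w
      rcases h.surjV t with ⟨a, ha⟩ | ⟨a, ha⟩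
      · have h1 : (n.comp μR).onV a = some w := by rw [hn]; simp [hp, ha, ht]
        obtain ⟨b, -, hb⟩ := Option.bind_eq_some_iff.1 h1
        exact .inl ⟨b, hb⟩
      · have h1 : (s.comp μG).onV a = some w := by rw [hs]; simp [hq, ha, ht]
        obtain ⟨b, -, hb⟩ := Option.bind_eq_some_iff.1 h1
        exact .inr ⟨b, hb⟩
    · intro w
      obtain ⟨t, ht⟩ := hμ.2.2 w
      rcases h.surjE t with ⟨a, ha⟩ | ⟨a, ha⟩
      · have h1 : (n.comp μR).onE a = some w := by rw [hn]; simp [hp, ha, ht]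
        obtain ⟨b, -, hb⟩ := Option.bind_eq_some_iff.1 h1
        exact .inl ⟨b, hb⟩
      · have h1 : (s.comp μG).onE a = some w := by rw [hs]; simp [hq, ha, ht]
        obtain ⟨b, -, hb⟩ := Option.bind_eq_some_iff.1 h1
        exact .inr ⟨b, hb⟩
    · intro P Q hPQ
      exact descends_restrict (i := fun x : R'.V => x.1) (k := fun x : (kept m q).V => x.1) hμR_V
        (fun a b => hμG_V a b) hμ.1.1
        (fun x => congrArg (fun χ => χ.onV x) h.comm) (fun x => x.2) (fun x => x.2) hPQ
        (h.descV _ _)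
    · intro P Q hPQ hP hQ
      refine descends_restrict (i := fun x : R'.E => x.1) (k := fun x : (kept m q).E => x.1) hμR_E
        (fun a b => hμG_E a b) hμ.1.2
        (fun x => congrArg (fun χ => χ.onE x) h.comm) (fun x => x.2) (fun x => x.2) hPQ
        fun hc => h.descE _ _ hc ?_ ?_
      · rintro a ⟨b, hb, hPb⟩ v hv h0
        obtain ⟨w, hw, hw'⟩ := μR.exists_onV_of_onE hb hv
        refine hP b hPb w hw ?_
        rw [← PMor.onV_eq_of_comp_eq hn hw', hp, PMor.comp_onV, h0, Option.bind_none]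
      · rintro a ⟨b, hb, hPb⟩ v hv h0
        obtain ⟨w, hw, hw'⟩ := μG.exists_onV_of_onE hb hv
        refine hQ b hPb w hw ?_
        rw [← PMor.onV_eq_of_comp_eq hs hw', hq, PMor.comp_onV, h0, Option.bind_none]
  refine ⟨R', kept m q, μR, μG, n, s, hμR, hμG, hn, hs, hpo'.isPushout, ⟨?_, ?_⟩, ⟨?_, ?_⟩,
    hcf.comp hμG.1⟩
  · intro x
    obtain ⟨v, hv⟩ := hm.1 x
    exact ⟨⟨v, .inl ⟨x, hv⟩⟩, by
      rw [PMor.comp_onV, hv, Option.bind_some]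
      exact (hμG_V _ _).2 rfl⟩
  · intro x
    obtain ⟨v, hv⟩ := hm.2 x
    exact ⟨⟨v, .inl ⟨x, hv⟩⟩, by
      rw [PMor.comp_onE, hv, Option.bind_some]
      exact (hμG_E _ _).2 rfl⟩
  · exact fun x => x.2
  · exact fun x => x.2

end

/-! ### Rewriting steps and the subgraph order -/

section

variable {L R G H S : Hypergraph Λ ar}

theorem IsPOC.congr {r : PMor L R} {m' : PMor R S} (h : IsPOC r m' G) {G' : Hypergraph Λ ar}
    (hG : Isomorphic G G') : IsPOC r m' G' := by
  obtain ⟨m, r', hm, hcf, hpo⟩ := h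
  obtain ⟨i, j, h1, h2, hit, his, -⟩ := isomorphic_iff_exists_inverse.1 hG
  have := hpo.congr (PMor.id_comp (PMor.id L)) (PMor.id_comp (PMor.id R)) (PMor.id_comp (PMor.id R))
    h1 h2 (PMor.id_comp (PMor.id S)) (PMor.id_comp (PMor.id S))
  simp only [PMor.id_comp, PMor.comp_id] at this
  exact ⟨i.comp m, r'.comp j, hit.comp hm, hcf.comp his.1, this⟩

theorem conflictFree_congr {L' R' : Hypergraph Λ ar} {m : PMor L G} {r : PMor L R}
    (h : m.ConflictFree r) {i : PMor L' L} {j : PMor R R'} (hj : j.Total) :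
    (m.comp i).ConflictFree ((j.comp r).comp i) := by
  have key : ∀ {X X' Y Y' Z : Type} (m : X → Option Z) (r : X → Option Y) (i : X' → Option X)
      (j : Y → Option Y'), (∀ y, ∃ z, j y = some z) →
      (∀ x y z, m x = some z → m y = some z → ((r x).isSome ↔ (r y).isSome)) →
      ∀ x y z, (i x).bind m = some z → (i y).bind m = some z →
        (((i x).bind fun a => (r a).bind j).isSome ↔
          ((i y).bind fun a => (r a).bind j).isSome) := by
    intro X X' Y Y' Z m r i j hj h x y z hx hy
    obtain ⟨a, ha, ha'⟩ := Option.bind_eq_some_iff.1 hx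
    obtain ⟨b, hb, hb'⟩ := Option.bind_eq_some_iff.1 hy
    have hsome : ∀ o : Option Y, (o.bind j).isSome = o.isSome := by
      rintro (_ | y)
      · rfl
      · obtain ⟨z, hz⟩ := hj y
        simp [hz]
    rw [ha, hb, Option.bind_some, Option.bind_some, hsome, hsome]
    exact h a b z ha' hb'
  exact ⟨key _ _ _ _ hj.1 h.1, key _ _ _ _ hj.2 h.2⟩

/-- Rewriting is invariant under isomorphisms of the rule and of the graphs. -/
theorem Rule.Rewrites.congr {ρ ρ' : Rule Λ ar} (h : ρ.Rewrites G H)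
    {i₀ : PMor ρ'.L ρ.L} {j₀ : PMor ρ.L ρ'.L} (h₀ : i₀.comp j₀ = PMor.id _)
    (h₀' : j₀.comp i₀ = PMor.id _) {i₁ : PMor ρ'.R ρ.R} {j₁ : PMor ρ.R ρ'.R}
    (h₁ : i₁.comp j₁ = PMor.id _) (h₁' : j₁.comp i₁ = PMor.id _)
    (hρ : ρ'.map = (j₁.comp ρ.map).comp i₀) {G' H' : Hypergraph Λ ar} (hG : Isomorphic G G')
    (hH : Isomorphic H H') : ρ'.Rewrites G' H' := by
  obtain ⟨m, m', r', hm, hcf, hpo⟩ := h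
  obtain ⟨i₂, j₂, h₂, h₂', hit, his, -⟩ := isomorphic_iff_exists_inverse.1 hG
  obtain ⟨i₃, j₃, h₃, h₃', -⟩ := isomorphic_iff_exists_inverse.1 hH
  refine ⟨(i₂.comp m).comp i₀, (i₃.comp m').comp i₁, (i₃.comp r').comp j₂, ?_, ?_, ?_⟩
  · exact (hit.comp hm).comp (total_of_comp_total (h₀' ▸ PMor.total_id))
  · rw [hρ]
    exact conflictFree_congr (hcf.comp his.1) (total_of_comp_total (h₁ ▸ PMor.total_id))
  · rw [hρ]
    exact hpo.congr h₀ h₁ h₁' h₂ h₂' h₃ h₃'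

theorem Rule.Rewrites.congr_graphs {ρ : Rule Λ ar} (h : ρ.Rewrites G H) {G' H' : Hypergraph Λ ar}
    (hG : Isomorphic G G') (hH : Isomorphic H H') : ρ.Rewrites G' H' :=
  h.congr (PMor.id_comp (PMor.id _)) (PMor.id_comp (PMor.id _)) (PMor.id_comp (PMor.id _))
    (PMor.id_comp (PMor.id _)) (by simp) hG hH

/-- Every rule may be replaced by a rule between graphs that are given by codes. -/
theorem Rule.exists_code (ρ : Rule Λ ar) :
    ∃ (L R : GraphCode Λ ar) (r : PMor L.graph R.graph),
      ∀ G H, ρ.Rewrites G H ↔ Rule.Rewrites ⟨L.graph, R.graph, r⟩ G H := by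
  obtain ⟨L, hL⟩ := GraphCode.exists_code ρ.L
  obtain ⟨R, hR⟩ := GraphCode.exists_code ρ.R
  obtain ⟨i₀, j₀, h₀, h₀', -⟩ := isomorphic_iff_exists_inverse.1 hL
  obtain ⟨i₁, j₁, h₁, h₁', -⟩ := isomorphic_iff_exists_inverse.1 hR
  have hid : ∀ G : Hypergraph Λ ar, Isomorphic G G := fun G =>
    ⟨PMor.id G, PMor.total_id, PMor.isSubgraphMor_id.1, PMor.isSubgraphMor_id.2⟩
  refine ⟨L, R, (j₁.comp ρ.map).comp i₀, fun G H => ⟨fun h => ?_, fun h => ?_⟩⟩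
  · exact h.congr (ρ' := ⟨L.graph, R.graph, (j₁.comp ρ.map).comp i₀⟩) h₀' h₀ h₁' h₁ rfl
      (hid G) (hid H)
  · refine h.congr (ρ' := ρ) h₀ h₀' h₁ h₁' ?_ (hid G) (hid H)
    dsimp only
    rw [← PMor.comp_assoc, PMor.comp_assoc, h₀', PMor.comp_id, ← PMor.comp_assoc, h₁', PMor.id_comp]

/-- Larger graphs can simulate rewriting steps of smaller ones. -/
theorem Step.exists_of_embeds [Finite Λ] {𝓡 : Set (Rule Λ ar)} (h : Step 𝓡 G H)
    {G' : Hypergraph Λ ar} (hG : Embeds G G') : ∃ H', Step 𝓡 G' H' ∧ Embeds H H' := by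
  obtain ⟨ρ, hρ, m, m', r', hm, hcf, hpo⟩ := h
  obtain ⟨j, hjt, hji⟩ := hG
  obtain ⟨H', n, s, hpo'⟩ := exists_isPushout ρ.map (j.comp m)
  obtain ⟨κ, hκ, hκ', -⟩ := exists_embedding_of_pushouts hpo' hjt hji rfl hpo.elementary
  exact ⟨H', ⟨ρ, hρ, j.comp m, n, s, hjt.comp hm, hcf.comp hji, hpo'.isPushout⟩, κ, hκ, hκ'⟩

/-- If `G` is rewritten to a graph above `S`, then so is a subgraph of `G` of bounded size. -/
theorem Rule.Rewrites.exists_bounded [Finite Λ] {ρ : Rule Λ ar} (h : ρ.Rewrites G H)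
    (hS : Embeds S H) : ∃ G₀ H₀, Embeds G₀ G ∧ ρ.Rewrites G₀ H₀ ∧ Embeds S H₀ ∧
      Nat.card G₀.V ≤ Nat.card ρ.L.V + Nat.card S.V ∧
      Nat.card G₀.E ≤ Nat.card ρ.L.E + Nat.card S.E := by
  obtain ⟨m, m', r', hm, hcf, hpo⟩ := h
  obtain ⟨μ, hμ⟩ := embeds_iff_exists_isSubgraphMor.1 hS
  have hpo := hpo.elementary
  obtain ⟨m₀, hm₀⟩ := exists_keptLift m (μ.comp r')
  obtain ⟨H₀, m₀', r₀', h₀⟩ := exists_isPushout ρ.map m₀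
  obtain ⟨κ, -, -, -, -, hκ⟩ := exists_isSubgraphMor_of_kept hpo hμ hm₀ h₀
  refine ⟨_, H₀, ⟨_, keptIncl_total _ _, keptIncl_injective _ _⟩,
    ⟨m₀, m₀', r₀', total_of_comp_total (by rw [hm₀]; exact hm),
      conflictFree_of_comp (keptIncl_total _ _) (by rw [hm₀]; exact hcf), h₀.isPushout⟩,
    embeds_iff_exists_isSubgraphMor.2 ⟨_, hκ⟩, card_kept_le hpo hμ.1⟩

/-- Every pushout complement object contains one of bounded size. -/
theorem IsPOC.exists_bounded [Finite Λ] {r : PMor L R} {m' : PMor R S} (h : IsPOC r m' G) :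
    ∃ G₀, Embeds G₀ G ∧ IsPOC r m' G₀ ∧ Nat.card G₀.V ≤ Nat.card L.V + Nat.card S.V ∧
      Nat.card G₀.E ≤ Nat.card L.E + Nat.card S.E := by
  obtain ⟨m, r', hm, hcf, hpo⟩ := h
  have hpo := hpo.elementary
  obtain ⟨m₀, hm₀⟩ := exists_keptLift m ((PMor.id S).comp r')
  obtain ⟨H₀, m₀', r₀', h₀⟩ := exists_isPushout r m₀
  obtain ⟨κ, ht, hi, h1, h2, hκ⟩ := exists_isSubgraphMor_of_kept hpo PMor.isSubgraphMor_id hm₀ h₀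
  rw [PMor.id_comp] at hκ
  refine ⟨_, ⟨_, keptIncl_total _ _, keptIncl_injective _ _⟩,
    ⟨m₀, κ.comp r₀', total_of_comp_total (by rw [hm₀]; exact hm),
      conflictFree_of_comp (keptIncl_total _ _) (by rw [hm₀]; exact hcf), ?_⟩,
    card_kept_le hpo PMor.isSubgraphMor_id.1⟩
  -- `κ` is total, injective and surjective, so `H₀` may be replaced by `S`
  obtain ⟨μ, -, hμ, hV, hE⟩ := ht.exists_retraction hi
  have h5 := comp_comp_inverse hV hE (PMor.id S) (fun v _ => hκ.2.1 v) fun v _ => hκ.2.2 v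
  rw [PMor.id_comp] at h5
  have := h₀.isPushout.congr (PMor.id_comp (PMor.id L)) (PMor.id_comp (PMor.id R))
    (PMor.id_comp (PMor.id R)) (PMor.id_comp (PMor.id _)) (PMor.id_comp (PMor.id _)) hμ h5
  simp only [PMor.id_comp, PMor.comp_id] at this
  rwa [h1] at this

end

/-! ### Well-quasi-ordering of graphs with bounded paths -/

/-- Each component of the simple graph contains a vertex such that all paths starting there are
shorter than `t`. -/
def IsShallow {V : Type} (G : SimpleGraph V) (t : ℕ) : Prop :=
  ∀ x, ∃ v, G.Reachable v x ∧ ∀ (u : V) (p : G.Walk v u), p.IsPath → p.length < t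

/-- If all paths from `v` are shorter than `t + 1`, then all paths that start at a neighbour of `v`
and avoid `v` are shorter than `t`. -/
theorem isShallow_induce {V : Type} {G : SimpleGraph V} {v : V} {t : ℕ}
    (hv : ∀ (u : V) (p : G.Walk v u), p.IsPath → p.length < t + 1) :
    IsShallow (G.induce {x | G.Reachable v x ∧ x ≠ v}) t := by
  classical
  rintro ⟨x, hx, hxv⟩
  obtain ⟨p, hp⟩ := hx.exists_isPath
  cases p with
  | nil => exact (hxv rfl).elim
  | @cons _ u _ hvu q =>
    rw [SimpleGraph.Walk.cons_isPath_iff] at hp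
    have hq : ∀ y ∈ q.support, y ∈ {x | G.Reachable v x ∧ x ≠ v} := by
      intro y hy
      refine ⟨hvu.reachable.trans ⟨q.takeUntil y hy⟩, ?_⟩
      rintro rfl
      exact hp.2 hy
    refine ⟨⟨u, hq u q.start_mem_support⟩, ⟨q.induce _ hq⟩, ?_⟩
    intro w p' hp'
    obtain ⟨q', hq1, hq2, hq3⟩ : ∃ q' : G.Walk u w.1, q'.IsPath ∧ q'.length = p'.length ∧
        v ∉ q'.support := by
      let ι := SimpleGraph.Embedding.induce (G := G) {x | G.Reachable v x ∧ x ≠ v}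
      refine ⟨p'.map ι.toHom, SimpleGraph.Walk.IsPath.map ι.injective hp',
        SimpleGraph.Walk.length_map _ _, fun hmem => ?_⟩
      have hmem' := (SimpleGraph.Walk.support_map ι.toHom p') ▸ hmem
      obtain ⟨y, -, hy⟩ := List.mem_map.1 hmem'
      exact y.2.2 hy
    have := hv _ (.cons hvu q') ((SimpleGraph.Walk.cons_isPath_iff _ _).2 ⟨hq1, hq3⟩)
    rw [SimpleGraph.Walk.length_cons] at this
    omega

/-- A finite set whose elements are coloured by `A` and whose pairs of elements are coloured
by `B`. -/
structure ColoredSet (A B : Type) : Type 1 where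
  X : Type
  finite_X : Finite X
  col : X → A
  rel : X → X → B

namespace ColoredSet

variable {A B : Type}

/-- Embeddings preserve the colours of elements and of pairs. -/
def Emb (s t : ColoredSet A B) : Prop :=
  ∃ f : s.X → t.X, Function.Injective f ∧ (∀ x, t.col (f x) = s.col x) ∧
    ∀ x y, t.rel (f x) (f y) = s.rel x y

theorem Emb.refl (s : ColoredSet A B) : Emb s s :=
  ⟨_root_.id, Function.injective_id, fun _ => rfl, fun _ _ => rfl⟩

theorem Emb.trans {s t u : ColoredSet A B} (h : Emb s t) (h' : Emb t u) : Emb s u := by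
  obtain ⟨f, hf, hc, hr⟩ := h
  obtain ⟨g, hg, hc', hr'⟩ := h'
  exact ⟨g ∘ f, hg.comp hf, fun x => (hc' _).trans (hc x), fun x y => (hr' _ _).trans (hr x y)⟩

/-- Two elements are adjacent if a pair formed by them has a colour other than `b₀`. -/
def graph (b₀ : B) (s : ColoredSet A B) : SimpleGraph s.X :=
  SimpleGraph.fromRel fun x y => s.rel x y ≠ b₀

/-- Each component contains an element such that all paths starting there are shorter
than `t`. -/
def Shallow (b₀ : B) (t : ℕ) (s : ColoredSet A B) : Prop :=
  IsShallow (s.graph b₀) t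

/-- The part of the component of `v` that remains when `v` is removed.  The colours of the
remaining elements record their relation to `v`. -/
def branch (b₀ : B) (s : ColoredSet A B) (v : s.X) : ColoredSet (A × B × B) B where
  X := {x // (s.graph b₀).Reachable v x ∧ x ≠ v}
  finite_X := by
    have := s.finite_X
    infer_instance
  col x := (s.col x.1, s.rel v x.1, s.rel x.1 v)
  rel x y := s.rel x.1 y.1

theorem graph_branch (b₀ : B) (s : ColoredSet A B) (v : s.X) :
    (s.branch b₀ v).graph b₀ =
      (s.graph b₀).induce {x | (s.graph b₀).Reachable v x ∧ x ≠ v} := by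
  ext x y
  change _ ↔ (s.graph b₀).Adj x.1 y.1
  unfold graph
  rw [SimpleGraph.fromRel_adj, SimpleGraph.fromRel_adj]
  exact and_congr_left' (not_congr Subtype.ext_iff)

theorem shallow_branch (b₀ : B) (s : ColoredSet A B) (v : s.X) (t : ℕ)
    (hv : ∀ (u : s.X) (p : (s.graph b₀).Walk v u), p.IsPath → p.length < t + 1) :
    (s.branch b₀ v).Shallow b₀ t := by
  have h := isShallow_induce hv
  rw [← graph_branch] at h
  exact h

/-- A colored rooted component: the colour of the root, and the branch below it. -/
def RootedLE (p q : (A × B) × ColoredSet (A × B × B) B) : Prop := p.1 = q.1 ∧ Emb p.2 q.2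

instance : IsPreorder ((A × B) × ColoredSet (A × B × B) B) RootedLE where
  refl _ := ⟨rfl, Emb.refl _⟩
  trans _ _ _ h h' := ⟨h.1.trans h'.1, h.2.trans h'.2⟩

/-- An embedding of branches with equal roots extends to the components. -/
theorem exists_extend_root {b₀ : B} {s t : ColoredSet A B} {v : s.X} {w : t.X}
    (h : RootedLE ((s.col v, s.rel v v), s.branch b₀ v) ((t.col w, t.rel w w), t.branch b₀ w)) :
    ∃ g : s.X → t.X, ∀ x, (s.graph b₀).Reachable v x →
      (t.graph b₀).Reachable w (g x) ∧ t.col (g x) = s.col x ∧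
      ∀ y, (s.graph b₀).Reachable v y → (g x = g y → x = y) ∧ t.rel (g x) (g y) = s.rel x y := by
  classical
  obtain ⟨hroot, e, he, hc, hr⟩ := h
  obtain ⟨h1, h2⟩ := Prod.mk.inj hroot
  let g : s.X → t.X := fun x =>
    if h : (s.graph b₀).Reachable v x ∧ x ≠ v then (e ⟨x, h⟩).1 else w
  have hgv : g v = w := by simp [g]
  have hg : ∀ x (h : (s.graph b₀).Reachable v x ∧ x ≠ v), g x = (e ⟨x, h⟩).1 := fun x h => by
    simp only [g, dif_pos h]
  have hcol : ∀ x (h : (s.graph b₀).Reachable v x ∧ x ≠ v), t.col (g x) = s.col x ∧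
      t.rel w (g x) = s.rel v x ∧ t.rel (g x) w = s.rel x v := fun x h => by
    rw [hg x h]
    have := hc ⟨x, h⟩
    simpa [branch] using this
  refine ⟨g, fun x hx => ?_⟩
  by_cases hxv : x = v
  · subst hxv
    rw [hgv]
    refine ⟨SimpleGraph.Reachable.refl _, h1.symm, fun y hy => ?_⟩
    by_cases hyv : y = x
    · subst hyv
      rw [hgv]
      exact ⟨fun _ => rfl, h2.symm⟩
    · refine ⟨fun hgy => ?_, (hcol y ⟨hy, hyv⟩).2.1⟩
      rw [hg y ⟨hy, hyv⟩] at hgy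
      exact ((e ⟨y, hy, hyv⟩).2.2 hgy.symm).elim
  · refine ⟨?_, (hcol x ⟨hx, hxv⟩).1, fun y hy => ?_⟩
    · rw [hg x ⟨hx, hxv⟩]
      exact (e ⟨x, hx, hxv⟩).2.1
    · by_cases hyv : y = v
      · subst hyv
        rw [hgv]
        refine ⟨fun hgx => ?_, (hcol x ⟨hx, hxv⟩).2.2⟩
        rw [hg x ⟨hx, hxv⟩] at hgx
        exact ((e ⟨x, hx, hxv⟩).2.2 hgx).elim
      · rw [hg x ⟨hx, hxv⟩, hg y ⟨hy, hyv⟩]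
        exact ⟨fun h => congrArg Subtype.val (he (Subtype.ext h)), hr _ _⟩

/-- A comparison of two lists of pairwise distinct items yields an injection. -/
theorem exists_injective_of_sublistForall₂ {α β γ δ : Type*} [DecidableEq α] {r : γ → δ → Prop}
    {f : α → γ} {g : β → δ} {l : List α} {l' : List β} (hl' : l'.Nodup) (hall : ∀ a, a ∈ l)
    (h : List.SublistForall₂ r (l.map f) (l'.map g)) :
    ∃ σ : α → β, Function.Injective σ ∧ ∀ a, r (f a) (g (σ a)) := by
  obtain ⟨l₁, h1, h2⟩ := List.sublistForall₂_iff.1 h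
  obtain ⟨l₂, h3, rfl⟩ := List.sublist_map_iff.1 h2
  have hnd := hl'.sublist h3
  have hlen : l.length = l₂.length := by simpa using h1.length_eq
  have hi : ∀ a, l.idxOf a < l₂.length := fun a => hlen ▸ List.idxOf_lt_length_of_mem (hall a)
  refine ⟨fun a => l₂[l.idxOf a]'(hi a), fun a b hab => ?_, fun a => ?_⟩
  · have h4 := (hnd.getElem_inj_iff).1 hab
    exact (List.idxOf_inj (hall a)).1 h4
  · have h5 := List.forall₂_iff_get.1 h1
    have h6 := h5.2 (l.idxOf a) (by simpa using List.idxOf_lt_length_of_mem (hall a))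
      (by simpa using hi a)
    simpa using h6

/-- Sets in which all components have short paths from some element are well-quasi-ordered: remove
such an element from each component, and compare the finite families of branches by Higman's
lemma. -/
theorem partiallyWellOrderedOn_shallow [Finite B] (b₀ : B) (t : ℕ) :
    ∀ (A : Type) [Finite A],
      Set.PartiallyWellOrderedOn {s : ColoredSet A B | s.Shallow b₀ t} Emb := by
  classical
  induction t with
  | zero =>
    intro A _
    rw [Set.partiallyWellOrderedOn_iff_exists_lt]
    intro f hf
    have hempty : (f 0).X → False := fun x => by
      obtain ⟨v, -, hv⟩ := hf 0 x
      exact absurd (hv v .nil (by simp)) (Nat.not_lt_zero _)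
    exact ⟨0, 1, one_pos, fun x => (hempty x).elim, fun x => (hempty x).elim,
      fun x => (hempty x).elim, fun x => (hempty x).elim⟩
  | succ t ih =>
    intro A _
    have h1 : Set.PartiallyWellOrderedOn
        ((Set.univ : Set (A × B)) ×ˢ {s : ColoredSet (A × B × B) B | s.Shallow b₀ t})
        RootedLE :=
      (Set.finite_univ.partiallyWellOrderedOn (r := Eq)).prod (ih (A × B × B))
    have h2 := Set.PartiallyWellOrderedOn.partiallyWellOrderedOn_sublistForall₂ RootedLE h1
    rw [Set.partiallyWellOrderedOn_iff_exists_lt]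
    intro f hf
    have hroot : ∀ n, ∀ C : ((f n).graph b₀).ConnectedComponent, ∃ v : (f n).X,
        ((f n).graph b₀).connectedComponentMk v = C ∧
        ∀ (u : (f n).X) (p : ((f n).graph b₀).Walk v u), p.IsPath → p.length < t + 1 := by
      intro n C
      induction C using SimpleGraph.ConnectedComponent.ind with
      | _ x =>
        obtain ⟨v, hv, hv'⟩ := hf n x
        exact ⟨v, SimpleGraph.ConnectedComponent.sound hv, hv'⟩
    choose root hrootC hrootP using hroot
    let item : ∀ n, ((f n).graph b₀).ConnectedComponent → (A × B) × ColoredSet (A × B × B) B :=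
      fun n C => (((f n).col (root n C), (f n).rel (root n C) (root n C)),
        (f n).branch b₀ (root n C))
    have hfin : ∀ n, ∃ l : List ((f n).graph b₀).ConnectedComponent, l.Nodup ∧ ∀ C, C ∈ l := by
      intro n
      have := (f n).finite_X
      have : Finite ((f n).graph b₀).ConnectedComponent :=
        Quot.finite _
      have := Fintype.ofFinite ((f n).graph b₀).ConnectedComponent
      exact ⟨Finset.univ.toList, Finset.nodup_toList _, fun C => by simp⟩
    choose comps hnd hall using hfin
    obtain ⟨m, n, hmn, hle⟩ := h2.exists_lt (f := fun n => (comps n).map (item n)) (by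
      intro n p hp
      obtain ⟨C, -, rfl⟩ := List.mem_map.1 hp
      exact ⟨Set.mem_univ _, shallow_branch _ _ _ _ (hrootP n C)⟩)
    refine ⟨m, n, hmn, ?_⟩
    obtain ⟨σ, hσ, hσr⟩ := exists_injective_of_sublistForall₂ (hnd n) (hall m) hle
    choose g hg using fun C => exists_extend_root (hσr C)
    let mk := ((f m).graph b₀).connectedComponentMk
    have hreach : ∀ x, ((f m).graph b₀).Reachable (root m (mk x)) x := fun x =>
      SimpleGraph.ConnectedComponent.exact (hrootC m (mk x))
    have hmk : ∀ x, ((f n).graph b₀).connectedComponentMk (g (mk x) x) = σ (mk x) := fun x => by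
      rw [← hrootC n (σ (mk x))]
      exact (SimpleGraph.ConnectedComponent.sound (hg _ x (hreach x)).1).symm
    have hrel₀ : ∀ k (x y : (f k).X), ((f k).graph b₀).connectedComponentMk x ≠
        ((f k).graph b₀).connectedComponentMk y → (f k).rel x y = b₀ := by
      intro k x y hxy
      by_contra hb
      refine hxy (SimpleGraph.ConnectedComponent.sound (SimpleGraph.Adj.reachable ?_))
      refine (SimpleGraph.fromRel_adj _ _ _).2 ⟨?_, .inl hb⟩
      rintro rfl
      exact hxy rfl
    refine ⟨fun x => g (mk x) x, fun x y hxy => ?_, fun x => (hg _ x (hreach x)).2.1, fun x y => ?_⟩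
    · have h3 : mk x = mk y := hσ (by rw [← hmk x, ← hmk y]; exact congrArg _ hxy)
      have hy := hreach y
      rw [← h3] at hy
      dsimp only at hxy
      rw [← h3] at hxy
      exact ((hg _ x (hreach x)).2.2 y hy).1 hxy
    · by_cases h3 : mk x = mk y
      · have hy := hreach y
        rw [← h3] at hy
        dsimp only
        rw [← h3]
        exact ((hg _ x (hreach x)).2.2 y hy).2
      · rw [hrel₀ m x y h3, hrel₀ n]
        rw [hmk, hmk]
        exact fun h => h3 (hσ h)

end ColoredSet

section Incidence

/-- The incidence structure of a hypergraph.  The colour of a pair formed by a node and an edge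
records the positions at which the edge is connected to the node. -/
def Hypergraph.incidence (G : Hypergraph Λ ar) :
    ColoredSet (Option Λ) ((l : Λ) → Fin (ar l) → Prop) where
  X := G.V ⊕ G.E
  finite_X := by
    have := G.finite_V
    have := G.finite_E
    infer_instance
  col := Sum.elim (fun _ => none) fun e => some (G.label e)
  rel x y := match x, y with
    | .inl v, .inr e => fun _ i => (G.conn e)[i.1]? = some v
    | _, _ => fun _ _ => False

theorem Hypergraph.adj_incidence (G : Hypergraph Λ ar) {x y : G.V ⊕ G.E}
    (h : (G.incidence.graph fun _ _ => False).Adj x y) :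
    (∃ v e, x = .inl v ∧ y = .inr e ∧ v ∈ G.conn e) ∨
      ∃ v e, y = .inl v ∧ x = .inr e ∧ v ∈ G.conn e := by
  have key : ∀ x y : G.V ⊕ G.E, G.incidence.rel x y ≠ (fun _ _ => False) →
      ∃ v e, x = .inl v ∧ y = .inr e ∧ v ∈ G.conn e := by
    rintro (v | e) (w | d) h
    · exact (h rfl).elim
    · refine ⟨v, d, rfl, rfl, ?_⟩
      by_contra hv
      refine h ?_
      funext l i
      exact eq_false fun hi => hv (List.mem_of_getElem? hi)
    · exact (h rfl).elim
    · exact (h rfl).elim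
  rcases ((SimpleGraph.fromRel_adj _ _ _).1 h).2 with h | h
  · exact .inl (key _ _ h)
  · exact .inr (key _ _ h)

/-- Embeddings of the incidence structures preserve labels, and the colours of pairs determine the
sequences of nodes of the edges. -/
theorem embeds_of_emb_incidence {G H : Hypergraph Λ ar} (h : G.incidence.Emb H.incidence) :
    Embeds G H := by
  obtain ⟨f, hf, hc, hr⟩ := h
  have hV : ∀ v : G.V, ∃ w : H.V, f (.inl v) = .inl w := by
    intro v
    have := hc (.inl v)
    cases h : f (.inl v) with
    | inl w => exact ⟨w, rfl⟩
    | inr e => simp [h, Hypergraph.incidence] at this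
  have hE : ∀ e : G.E, ∃ d : H.E, f (.inr e) = .inr d ∧ H.label d = G.label e := by
    intro e
    have := hc (.inr e)
    cases h : f (.inr e) with
    | inl w => simp [h, Hypergraph.incidence] at this
    | inr d => exact ⟨d, rfl, by simpa [h, Hypergraph.incidence] using this⟩
  choose fV hfV using hV
  choose fE hfE hlab using hE
  refine ⟨⟨fun v => some (fV v), fun e => some (fE e), ?_, ?_⟩, ⟨fun v => ⟨_, rfl⟩,
    fun e => ⟨_, rfl⟩⟩, ?_, ?_⟩
  · intro e e' h
    obtain rfl := Option.some.inj h
    exact (hlab e).symm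
  · intro e e' h
    obtain rfl := Option.some.inj h
    apply List.ext_getElem?
    intro i
    have hlen : (H.conn (fE e)).length = (G.conn e).length := by
      rw [H.length_conn, G.length_conn, hlab]
    by_cases hi : i < (G.conn e).length
    · have h1 : (G.conn e)[i]? = some (G.conn e)[i] := List.getElem?_eq_getElem hi
      have h2 := hr (.inl (G.conn e)[i]) (.inr e)
      rw [hfV, hfE] at h2
      have h3 := congrFun (congrFun h2 (G.label e)) ⟨i, by rwa [← G.length_conn]⟩
      have h4 : (H.conn (fE e))[i]? = some (fV (G.conn e)[i]) := h3.mpr h1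
      rw [List.getElem?_map, List.getElem?_map, h1, h4]
      rfl
    · rw [List.getElem?_eq_none (by simpa using hi),
        List.getElem?_eq_none (by simpa [hlen] using hi)]
  · intro v v' w h h'
    have : fV v = fV v' := Option.some.inj (h.trans h'.symm)
    exact Sum.inl_injective (hf (by rw [hfV, hfV, this]))
  · intro v v' w h h'
    have : fE v = fE v' := Option.some.inj (h.trans h'.symm)
    exact Sum.inr_injective (hf (by rw [hfE, hfE, this]))

/-- Paths in the incidence structure alternate between nodes and edges. -/
theorem shallow_incidence {k : ℕ} {G : Hypergraph Λ ar} (hG : G ∈ boundedPath Λ ar k) :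
    G.incidence.Shallow (fun _ _ => False) (2 * k + 3) := by
  intro x
  refine ⟨x, SimpleGraph.Reachable.refl _, fun u p hp => ?_⟩
  by_contra hlen
  push Not at hlen
  have hinj := hp.getVert_injOn
  have hadj : ∀ i, i < p.length →
      (∃ v e, p.getVert i = .inl v ∧ p.getVert (i + 1) = .inr e ∧ v ∈ G.conn e) ∨
      ∃ v e, p.getVert (i + 1) = .inl v ∧ p.getVert i = .inr e ∧ v ∈ G.conn e := fun i hi =>
    G.adj_incidence (p.adj_getVert_succ hi)
  -- the first node on the path has index `0` or `1`
  obtain ⟨s, hs, v₀, hv₀⟩ : ∃ s ≤ 1, ∃ v, p.getVert s = .inl v := by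
    rcases hadj 0 (by omega) with ⟨v, e, h1, -⟩ | ⟨v, e, h1, -⟩
    · exact ⟨0, by omega, v, h1⟩
    · exact ⟨1, le_rfl, v, h1⟩
  have halt : ∀ i, s + 2 * i ≤ p.length → ∃ v, p.getVert (s + 2 * i) = .inl v := by
    intro i
    induction i with
    | zero => exact fun _ => ⟨v₀, hv₀⟩
    | succ i ih =>
      intro hi
      obtain ⟨v, hv⟩ := ih (by omega)
      rcases hadj (s + 2 * i) (by omega) with ⟨w, e, -, h2, -⟩ | ⟨w, e, -, h2, -⟩
      · rcases hadj (s + 2 * i + 1) (by omega) with ⟨w', e', h3, -⟩ | ⟨w', e', h3, -⟩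
        · exact (Sum.inl_ne_inr (h3.symm.trans h2)).elim
        · exact ⟨w', h3⟩
      · exact (Sum.inl_ne_inr (hv.symm.trans h2)).elim
  have hstep : ∀ i, s + 2 * i + 2 ≤ p.length → ∃ e, p.getVert (s + 2 * i + 1) = .inr e ∧
      ∀ v, p.getVert (s + 2 * i) = .inl v ∨ p.getVert (s + 2 * i + 2) = .inl v →
        v ∈ G.conn e := by
    intro i hi
    obtain ⟨v, hv⟩ := halt i (by omega)
    obtain ⟨v', hv'⟩ := halt (i + 1) (by omega)
    have hv' : p.getVert (s + 2 * i + 1 + 1) = .inl v' := hv'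
    rcases hadj (s + 2 * i) (by omega) with ⟨w, e, h1, h2, h3⟩ | ⟨w, e, -, h2, -⟩
    · rcases hadj (s + 2 * i + 1) (by omega) with ⟨w', e', h4, -⟩ | ⟨w', e', h4, h5, h6⟩
      · exact (Sum.inl_ne_inr (h4.symm.trans h2)).elim
      · obtain rfl := Sum.inr_injective (h2.symm.trans h5)
        refine ⟨e, h2, ?_⟩
        rintro y (hy | hy)
        · obtain rfl := Sum.inl_injective (h1.symm.trans hy)
          exact h3
        · obtain rfl := Sum.inl_injective (h4.symm.trans hy)
          exact h6
    · exact (Sum.inl_ne_inr (hv.symm.trans h2)).elim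
  have hv : ∀ i : Fin (k + 1 + 1), ∃ v, p.getVert (s + 2 * i.1) = .inl v := fun i =>
    halt i.1 (by have := i.2; omega)
  have he : ∀ i : Fin (k + 1), ∃ e, p.getVert (s + 2 * i.1 + 1) = .inr e ∧
      ∀ v, p.getVert (s + 2 * i.1) = .inl v ∨ p.getVert (s + 2 * i.1 + 2) = .inl v →
        v ∈ G.conn e := fun i => hstep i.1 (by have := i.2; omega)
  choose v hv using hv
  choose e he he' using he
  have := hG (k + 1) v e ⟨fun i j hij => ?_, fun i j hij => ?_, fun i => ⟨?_, ?_⟩⟩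
  · omega
  · have h1 := hinj (x₁ := s + 2 * i.1) (x₂ := s + 2 * j.1)
      (by have := i.2; simp only [Set.mem_ofPred_eq]; omega)
      (by have := j.2; simp only [Set.mem_ofPred_eq]; omega) (by rw [hv, hv, hij])
    exact Fin.ext (by omega)
  · have h1 := hinj (x₁ := s + 2 * i.1 + 1) (x₂ := s + 2 * j.1 + 1)
      (by have := i.2; simp only [Set.mem_ofPred_eq]; omega)
      (by have := j.2; simp only [Set.mem_ofPred_eq]; omega) (by rw [he, he, hij])
    exact Fin.ext (by omega)
  · exact he' i _ (.inl (hv i.castSucc))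
  · exact he' i _ (.inr (hv i.succ))

/-- Graphs with bounded paths are well-quasi-ordered by the subgraph order. -/
theorem exists_subgraphOf_of_boundedPath [Finite Λ] (k : ℕ) (x : ℕ → Hypergraph Λ ar)
    (hx : ∀ n, x n ∈ boundedPath Λ ar k) : ∃ i j, i < j ∧ SubgraphOf (x i) (x j) := by
  have : Finite ((l : Λ) → Fin (ar l) → Prop) := by infer_instance
  obtain ⟨i, j, hij, h⟩ := (ColoredSet.partiallyWellOrderedOn_shallow
    (fun (_ : Λ) (_ : Fin (ar _)) => False) (2 * k + 3) (Option Λ)).exists_lt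
    (f := fun n => (x n).incidence) fun n => shallow_incidence (hx n)
  exact ⟨i, j, hij, subgraphOf_iff_embeds.2 (embeds_of_emb_incidence h)⟩

theorem boundedPath_downward_closed {k : ℕ} {G H : Hypergraph Λ ar} (h : Embeds G H)
    (hH : H ∈ boundedPath Λ ar k) : G ∈ boundedPath Λ ar k := by
  obtain ⟨j, ht, hi⟩ := h
  obtain ⟨f, hf⟩ := ht.exists_mapV
  obtain ⟨g, hg⟩ := ht.exists_mapE
  intro n v e ⟨hv, he, hinc⟩
  have hmem : ∀ w d, w ∈ G.conn d → f w ∈ H.conn (g d) := by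
    intro w d hw
    obtain ⟨u, hu, hu'⟩ := j.exists_onV_of_onE (hg d) hw
    rw [hf] at hu'
    rwa [Option.some.inj hu']
  exact hH n (f ∘ v) (g ∘ e) ⟨
    fun a b hab => hv (hi.1 _ _ _ (hf _) (by rw [hf]; exact congrArg some hab.symm)),
    fun a b hab => he (hi.2 _ _ _ (hg _) (by rw [hg]; exact congrArg some hab.symm)),
    fun i => ⟨hmem _ _ (hinc i).1, hmem _ _ (hinc i).2⟩⟩

end Incidence

/-! ### Primitive recursive functions on lists -/

/-- All words of length `n` over the alphabet `A`. -/
def words {β : Type} (n : ℕ) (A : List β) : List (List β) :=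
  Nat.rec [[]] (fun _ W => W.flatMap fun w => A.map fun a => a :: w) n

theorem mem_words {β : Type} {n : ℕ} {A w : List β} :
    w ∈ words n A ↔ w.length = n ∧ ∀ a ∈ w, a ∈ A := by
  induction n generalizing w with
  | zero =>
    change w ∈ [[]] ↔ _
    simp only [List.mem_singleton, List.length_eq_zero_iff]
    exact ⟨fun h => ⟨h, by simp [h]⟩, And.left⟩
  | succ n ih =>
    change w ∈ (words n A).flatMap (fun w => A.map fun a => a :: w) ↔ _
    rw [List.mem_flatMap]
    constructor
    · rintro ⟨v, hv, h⟩
      obtain ⟨a, ha, rfl⟩ := List.mem_map.1 h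
      obtain ⟨h1, h2⟩ := ih.1 hv
      refine ⟨by simp [h1], ?_⟩
      simpa [ha] using h2
    · rintro ⟨h1, h2⟩
      cases w with
      | nil => simp at h1
      | cons a v =>
        exact ⟨v, ih.2 ⟨by simpa using h1, fun b hb => h2 b (by simp [hb])⟩,
          List.mem_map.2 ⟨a, h2 a (by simp), rfl⟩⟩

section Primrec

attribute [fun_prop] Primrec
attribute [fun_prop] Primrec.const Primrec.comp Primrec.pair

variable {α β γ σ : Type} [Primcodable α] [Primcodable β] [Primcodable γ] [Primcodable σ]

@[fun_prop] theorem primrec_id : Primrec fun a : α => a := Primrec.id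

@[fun_prop] theorem primrec_fst {f : α → β × γ} (hf : Primrec f) : Primrec fun a => (f a).1 :=
  Primrec.fst.comp hf

@[fun_prop] theorem primrec_snd {f : α → β × γ} (hf : Primrec f) : Primrec fun a => (f a).2 :=
  Primrec.snd.comp hf

@[fun_prop] theorem primrec_some {f : α → β} (hf : Primrec f) : Primrec fun a => some (f a) :=
  Primrec.option_some.comp hf

@[fun_prop] theorem primrec_isSome {f : α → Option β} (hf : Primrec f) :
    Primrec fun a => (f a).isSome := Primrec.option_isSome.comp hf

@[fun_prop] theorem primrec_option_bind {f : α → Option β} {g : α → β → Option σ}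
    (hf : Primrec f) (hg : Primrec fun p : α × β => g p.1 p.2) :
    Primrec fun a => (f a).bind (g a) := Primrec.option_bind hf hg

@[fun_prop] theorem primrec_option_map {f : α → Option β} {g : α → β → σ}
    (hf : Primrec f) (hg : Primrec fun p : α × β => g p.1 p.2) :
    Primrec fun a => (f a).map (g a) := Primrec.option_map hf hg

@[fun_prop] theorem primrec_option_getD {f : α → Option β} {g : α → β}
    (hf : Primrec f) (hg : Primrec g) :
    Primrec fun a => (f a).getD (g a) := Primrec.option_getD.comp hf hg

@[fun_prop] theorem primrec_and {f g : α → Bool} (hf : Primrec f) (hg : Primrec g) :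
    Primrec fun a => f a && g a := Primrec.and.comp hf hg

@[fun_prop] theorem primrec_or {f g : α → Bool} (hf : Primrec f) (hg : Primrec g) :
    Primrec fun a => f a || g a := Primrec.or.comp hf hg

@[fun_prop] theorem primrec_not {f : α → Bool} (hf : Primrec f) : Primrec fun a => !(f a) :=
  Primrec.not.comp hf

@[fun_prop] theorem primrec_decide_eq [DecidableEq β] {f g : α → β} (hf : Primrec f)
    (hg : Primrec g) : Primrec fun a => decide (f a = g a) := 
  Primrec.eq.decide.comp hf hg

@[fun_prop] theorem primrec_add {f g : α → ℕ} (hf : Primrec f) (hg : Primrec g) :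
    Primrec fun a => f a + g a := Primrec.nat_add.comp hf hg

@[fun_prop] theorem primrec_encode {f : α → β} (hf : Primrec f) :
    Primrec fun a => Encodable.encode (f a) := Primrec.encode.comp hf

@[fun_prop] theorem primrec_cons {f : α → β} {g : α → List β} (hf : Primrec f) (hg : Primrec g) :
    Primrec fun a => f a :: g a := Primrec.list_cons.comp hf hg

@[fun_prop] theorem primrec_append {f g : α → List β} (hf : Primrec f) (hg : Primrec g) :
    Primrec fun a => f a ++ g a := Primrec.list_append.comp hf hg

@[fun_prop] theorem primrec_length {f : α → List β} (hf : Primrec f) :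
    Primrec fun a => (f a).length := Primrec.list_length.comp hf

@[fun_prop] theorem primrec_range {f : α → ℕ} (hf : Primrec f) :
    Primrec fun a => List.range (f a) := Primrec.list_range.comp hf

@[fun_prop] theorem primrec_getElem? {f : α → List β} {g : α → ℕ} (hf : Primrec f)
    (hg : Primrec g) : Primrec fun a => (f a)[g a]? := Primrec.list_getElem?.comp hf hg

@[fun_prop] theorem primrec_getD {f : α → List β} {g : α → ℕ} {d : β} (hf : Primrec f)
    (hg : Primrec g) : Primrec fun a => (f a).getD (g a) d := (Primrec.list_getD d).comp hf hg

@[fun_prop] theorem primrec_map {f : α → List β} {g : α → β → σ} (hf : Primrec f)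
    (hg : Primrec fun p : α × β => g p.1 p.2) : Primrec fun a => (f a).map (g a) :=
  Primrec.list_map hf hg

@[fun_prop] theorem primrec_flatMap {f : α → List β} {g : α → β → List σ} (hf : Primrec f)
    (hg : Primrec fun p : α × β => g p.1 p.2) : Primrec fun a => (f a).flatMap (g a) :=
  Primrec.list_flatMap hf hg

@[fun_prop] theorem primrec_filterMap {f : α → List β} {g : α → β → Option σ} (hf : Primrec f)
    (hg : Primrec fun p : α × β => g p.1 p.2) : Primrec fun a => (f a).filterMap (g a) :=
  Primrec.listFilterMap hf hg

@[fun_prop] theorem primrec_any {f : α → List β} {g : α → β → Bool} (hf : Primrec f)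
    (hg : Primrec fun p : α × β => g p.1 p.2) : Primrec fun a => (f a).any (g a) := by
  have h1 : Primrec₂ fun (a : α) (p : β × Bool) => g a p.1 || p.2 := by
    unfold Primrec₂
    exact Primrec.or.comp (hg.comp (Primrec.pair Primrec.fst (Primrec.fst.comp Primrec.snd)))
      (Primrec.snd.comp Primrec.snd)
  have h := Primrec.list_foldr hf (Primrec.const false) h1
  refine h.of_eq fun a => ?_
  induction f a with
  | nil => rfl
  | cons b l ih => simp_all

@[fun_prop] theorem primrec_all {f : α → List β} {g : α → β → Bool} (hf : Primrec f)
    (hg : Primrec fun p : α × β => g p.1 p.2) : Primrec fun a => (f a).all (g a) := by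
  have h : Primrec fun a => !((f a).any fun b => !(g a b)) := by fun_prop
  refine h.of_eq fun a => ?_
  rw [List.not_any_eq_all_not]
  simp

@[fun_prop] theorem primrec_cond {c : α → Bool} {f g : α → β} (hc : Primrec c) (hf : Primrec f)
    (hg : Primrec g) : Primrec fun a => bif c a then f a else g a := Primrec.cond hc hf hg

@[fun_prop] theorem primrec_filter {f : α → List β} {g : α → β → Bool} (hf : Primrec f)
    (hg : Primrec fun p : α × β => g p.1 p.2) : Primrec fun a => (f a).filter (g a) := by
  have h : Primrec fun a => (f a).flatMap fun b => bif g a b then [b] else [] := by fun_prop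
  refine h.of_eq fun a => ?_
  induction f a with
  | nil => rfl
  | cons b l ih =>
    rw [List.flatMap_cons, ih, List.filter_cons]
    cases g a b <;> rfl

@[fun_prop] theorem primrec_words {f : α → ℕ} {g : α → List β} (hf : Primrec f)
    (hg : Primrec g) : Primrec fun a => words (f a) (g a) := by
  have h : Primrec₂ fun (a : α) (p : ℕ × List (List β)) =>
      p.2.flatMap fun w => (g a).map fun b => b :: w := by
    unfold Primrec₂
    fun_prop
  exact (Primrec.nat_rec' hf (Primrec.const [[]]) h)

end Primrec

/-! ### Enumeration of morphisms and graphs -/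

/-- The value at `i` of the partial function with the list of values `l`. -/
def look (l : List (Option ℕ)) (i : ℕ) : Option ℕ := l.getD i none

namespace GraphCode

/-- The number of nodes. -/
def nV (a : GraphCode Λ ar) : ℕ := a.1.1

/-- The number of edges. -/
def nE (a : GraphCode Λ ar) : ℕ := a.1.2.length

/-- The label of the edge `i`. -/
def lab (a : GraphCode Λ ar) (i : ℕ) : Option Λ := (a.1.2[i]?).map Prod.fst

/-- The sequence of nodes of the edge `i`. -/
def con (a : GraphCode Λ ar) (i : ℕ) : List ℕ := ((a.1.2[i]?).map Prod.snd).getD []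

theorem lab_graph (a : GraphCode Λ ar) (e : Fin a.1.2.length) :
    a.lab e = some (a.graph.label e) := by
  simp [lab, graph]

theorem con_graph (a : GraphCode Λ ar) (e : Fin a.1.2.length) :
    (a.graph.conn e).map (fun v : Fin a.1.1 => v.val) = a.con e := by
  simp [con, graph]

end GraphCode

section Codes

variable {a b c : GraphCode Λ ar}

theorem look_code_V (φ : PMor a.graph b.graph) (v : Fin a.1.1) :
    look φ.code.1 v = (φ.onV v).map fun w : Fin b.1.1 => w.val := by
  simp [look, PMor.code]

theorem look_code_E (φ : PMor a.graph b.graph) (v : Fin a.1.2.length) :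
    look φ.code.2 v = (φ.onE v).map fun w : Fin b.1.2.length => w.val := by
  simp [look, PMor.code]

theorem PMor.code_injective : Function.Injective (PMor.code (a := a) (b := b)) := by
  intro φ ψ h
  have hval : ∀ n, Function.Injective (Option.map fun w : Fin n => w.val) := fun n =>
    Option.map_injective Fin.val_injective
  apply PMor.ext
  · intro v
    exact hval _ ((look_code_V φ v).symm.trans ((congrArg (fun x => look x.1 v.1) h).trans
      (look_code_V ψ v)))
  · intro v
    exact hval _ ((look_code_E φ v).symm.trans ((congrArg (fun x => look x.2 v.1) h).trans
      (look_code_E ψ v)))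

/-- Test whether the partial functions `f` on nodes and edges preserve labels and connections. -/
def validMor (a b : GraphCode Λ ar) [Encodable Λ] (f : MorCode) : Bool :=
  (List.range a.nE).all fun i => (List.range b.nE).all fun j =>
    !(decide (look f.2 i = some j)) ||
      (decide (Encodable.encode (a.lab i) = Encodable.encode (b.lab j)) &&
        decide ((a.con i).map (look f.1) = (b.con j).map some))

/-- The codes of all partial morphisms between two graphs. -/
def homs [Encodable Λ] (a b : GraphCode Λ ar) : List MorCode :=
  (words a.nV (none :: (List.range b.nV).map some)).flatMap fun p =>
    ((words a.nE (none :: (List.range b.nE).map some)).map fun q => (p, q)).filter fun f =>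
      validMor a b f

theorem validMor_iff [Encodable Λ] {f : MorCode} : validMor a b f = true ↔
    ∀ (e : Fin a.1.2.length) (e' : Fin b.1.2.length), look f.2 e = some e'.val →
      a.graph.label e = b.graph.label e' ∧
        (a.con e).map (look f.1) = (b.con e').map some := by
  simp only [validMor, List.all_eq_true, List.mem_range, Bool.or_eq_true, Bool.not_eq_true',
    decide_eq_false_iff_not, Bool.and_eq_true, decide_eq_true_eq, Encodable.encode_inj]
  constructor
  · intro h e e' hee
    rcases h e.1 e.2 e'.1 e'.2 with h | h
    · exact (h hee).elim
    · rw [a.lab_graph, b.lab_graph] at h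
      exact ⟨Option.some.inj h.1, h.2⟩
  · intro h i hi j hj
    by_cases hij : look f.2 i = some j
    · right
      have := h ⟨i, hi⟩ ⟨j, hj⟩ hij
      refine ⟨?_, this.2⟩
      exact (a.lab_graph ⟨i, hi⟩).trans ((congrArg some this.1).trans (b.lab_graph ⟨j, hj⟩).symm)
    · exact .inl hij

/-- The element `i` of `Fin n`, if it exists. -/
def toFin (n i : ℕ) : Option (Fin n) := if h : i < n then some ⟨i, h⟩ else none

theorem map_bind_toFin {n : ℕ} {o : Option ℕ} (h : ∀ i, o = some i → i < n) :
    (o.bind (toFin n)).map (fun w : Fin n => w.val) = o := by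
  cases o with
  | none => rfl
  | some i => simp [toFin, h i rfl]

theorem ofFn_look {n : ℕ} {l : List (Option ℕ)} (h : l.length = n) :
    (List.ofFn fun v : Fin n => look l v) = l := by
  subst h
  apply List.ext_getElem (by simp)
  intro i h1 h2
  simp [look]

theorem mem_alphabet {n : ℕ} {o : Option ℕ} :
    o ∈ none :: (List.range n).map some ↔ ∀ i, o = some i → i < n := by
  cases o <;> simp

theorem look_mem {A l : List (Option ℕ)} (h : ∀ o ∈ l, o ∈ A) (h0 : none ∈ A) (i : ℕ) :
    look l i ∈ A := by
  unfold look
  rw [List.getD_eq_getElem?_getD]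
  cases hi : l[i]? with
  | none => exact h0
  | some o => exact h _ (List.mem_of_getElem? hi)

theorem map_map_eq {A B C : Type} (l : List A) (f : A → B) (g : B → C) (h : A → C)
    (hgf : ∀ x, g (f x) = h x) : (l.map f).map g = l.map h := by
  rw [List.map_map]
  exact List.map_congr_left fun x _ => hgf x

/-- The list `homs a b` consists of the codes of the morphisms from `a` to `b`. -/
theorem mem_homs [Encodable Λ] {f : MorCode} :
    f ∈ homs a b ↔ ∃ φ : PMor a.graph b.graph, φ.code = f := by
  have hval : ∀ n, Function.Injective (Option.map fun w : Fin n => w.val) := fun n =>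
    Option.map_injective Fin.val_injective
  have hmem : f ∈ homs a b ↔ (f.1.length = a.nV ∧ ∀ o ∈ f.1, o ∈ none :: (List.range b.nV).map some)
      ∧ (f.2.length = a.nE ∧ ∀ o ∈ f.2, o ∈ none :: (List.range b.nE).map some) ∧
        validMor a b f = true := by
    simp only [homs, List.mem_flatMap, List.mem_filter, List.mem_map, mem_words]
    constructor
    · rintro ⟨p, hp, ⟨q, hq, rfl⟩, h⟩
      exact ⟨hp, hq, h⟩
    · rintro ⟨hp, hq, h⟩
      exact ⟨f.1, hp, ⟨f.2, hq, rfl⟩, h⟩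
  rw [hmem, validMor_iff]
  constructor
  · rintro ⟨⟨h1, h2⟩, ⟨h3, h4⟩, h5⟩
    have hV : ∀ v, (look f.1 v |>.bind (toFin b.1.1)).map (fun w : Fin b.1.1 => w.val) =
        look f.1 v := fun v => map_bind_toFin (mem_alphabet.1 (look_mem h2 (by simp) v))
    have hE : ∀ v, (look f.2 v |>.bind (toFin b.1.2.length)).map
        (fun w : Fin b.1.2.length => w.val) =
        look f.2 v := fun v => map_bind_toFin (mem_alphabet.1 (look_mem h4 (by simp) v))
    have hE' : ∀ (e : Fin a.1.2.length) (e' : Fin b.1.2.length),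
        (look f.2 e).bind (toFin b.1.2.length) = some e' → look f.2 e = some e'.val := by
      intro e e' h
      rw [← hE, h]
      rfl
    refine ⟨⟨fun v : Fin a.1.1 => (look f.1 v).bind (toFin b.1.1),
      fun e : Fin a.1.2.length => (look f.2 e).bind (toFin b.1.2.length),
      fun e e' h => (h5 e e' (hE' e e' h)).1, fun e e' h => ?_⟩, ?_⟩
    · have h6 := (h5 e e' (hE' e e' h)).2
      apply List.map_injective_iff.2 (hval b.1.1)
      refine Eq.trans ?_ ((congrArg (List.map (look f.1)) (a.con_graph e)).trans
        (h6.trans ((congrArg (List.map some) (b.con_graph e')).symm.trans ?_)))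
      · exact (map_map_eq _ _ _ _ fun v : Fin a.1.1 => hV v).trans
          (map_map_eq _ _ _ _ fun v => rfl).symm
      · exact (map_map_eq _ _ _ (fun v : Fin b.1.1 => some v.val) fun v => rfl).trans
          (map_map_eq _ some (Option.map fun w : Fin b.1.1 => w.val) _ fun v => rfl).symm
    · refine Prod.ext ?_ ?_
      · refine Eq.trans ?_ (ofFn_look h1)
        exact congrArg List.ofFn (funext fun v => hV _)
      · refine Eq.trans ?_ (ofFn_look h3)
        exact congrArg List.ofFn (funext fun v => hE _)
  · rintro ⟨φ, rfl⟩
    refine ⟨⟨List.length_ofFn, fun o ho => ?_⟩, ⟨List.length_ofFn, fun o ho => ?_⟩, ?_⟩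
    · obtain ⟨v, rfl⟩ := (List.mem_ofFn' _ _).1 ho
      refine mem_alphabet.2 fun i hi => ?_
      obtain ⟨w, -, rfl⟩ := Option.map_eq_some_iff.1 hi
      exact w.2
    · obtain ⟨v, rfl⟩ := (List.mem_ofFn' _ _).1 ho
      refine mem_alphabet.2 fun i hi => ?_
      obtain ⟨w, -, rfl⟩ := Option.map_eq_some_iff.1 hi
      exact w.2
    · intro e e' h
      rw [look_code_E] at h
      obtain ⟨d, hd, hd'⟩ := Option.map_eq_some_iff.1 h
      obtain rfl := Fin.ext hd'
      refine ⟨φ.label_eq _ _ hd, ?_⟩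
      have h6 := congrArg (List.map (Option.map fun w : Fin b.1.1 => w.val)) (φ.conn_eq _ _ hd)
      refine (congrArg (List.map _) (a.con_graph e)).symm.trans (Eq.trans ?_ (h6.trans
        (Eq.trans ?_ (congrArg (List.map some) (b.con_graph d)))))
      · exact (map_map_eq _ _ _ _ fun v => look_code_V φ v).trans
          (map_map_eq _ _ _ _ fun v => rfl).symm
      · exact (map_map_eq _ some (Option.map fun w : Fin b.1.1 => w.val)
          (fun v : Fin b.1.1 => some v.val) fun v => rfl).trans
            (map_map_eq _ _ _ _ fun v => rfl).symm

theorem any_homs [Encodable Λ] {p : MorCode → Bool} :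
    (homs a b).any p = true ↔ ∃ φ : PMor a.graph b.graph, p φ.code = true := by
  simp only [List.any_eq_true, mem_homs]
  exact ⟨fun ⟨_, ⟨φ, h⟩, h'⟩ => ⟨φ, h ▸ h'⟩, fun ⟨φ, h⟩ => ⟨_, ⟨φ, rfl⟩, h⟩⟩

theorem all_homs [Encodable Λ] {p : MorCode → Bool} :
    (homs a b).all p = true ↔ ∀ φ : PMor a.graph b.graph, p φ.code = true := by
  simp only [List.all_eq_true, mem_homs]
  exact ⟨fun h φ => h _ ⟨φ, rfl⟩, fun h _ ⟨φ, h'⟩ => h' ▸ h φ⟩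

/-- Composition of codes of morphisms. -/
def compC (g f : MorCode) : MorCode :=
  (f.1.map fun o => o.bind (look g.1), f.2.map fun o => o.bind (look g.2))

theorem code_comp (ψ : PMor b.graph c.graph) (φ : PMor a.graph b.graph) :
    (ψ.comp φ).code = compC ψ.code φ.code := by
  refine Prod.ext ?_ ?_
  · refine Eq.trans ?_ List.map_ofFn.symm
    refine congrArg List.ofFn (funext fun v => ?_)
    change ((φ.onV v).bind ψ.onV).map _ = ((φ.onV v).map _).bind _
    cases φ.onV v with
    | none => rfl
    | some w => exact (look_code_V ψ w).symm
  · refine Eq.trans ?_ List.map_ofFn.symm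
    refine congrArg List.ofFn (funext fun v => ?_)
    change ((φ.onE v).bind ψ.onE).map _ = ((φ.onE v).map _).bind _
    cases φ.onE v with
    | none => rfl
    | some w => exact (look_code_E ψ w).symm

/-- The code of the identity. -/
def idC (a : GraphCode Λ ar) : MorCode :=
  ((List.range a.nV).map some, (List.range a.nE).map some)

theorem code_id : (PMor.id a.graph).code = idC a := by
  refine Prod.ext ?_ ?_
  · apply List.ext_getElem
    · simp [PMor.code, idC, GraphCode.nV]
    · intro i h1 h2
      simp [PMor.code, idC]
      rfl
  · apply List.ext_getElem
    · simp [PMor.code, idC, GraphCode.nE]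
    · intro i h1 h2
      simp [PMor.code, idC]
      rfl

end Codes

section Primrec

variable [Primcodable Λ] [Finite Λ] {α : Type} [Primcodable α]

theorem primrec_val : Primrec fun a : GraphCode Λ ar => a.1 :=
  Primrec.subtype_val (hp := codeWF_primrec ar)

@[fun_prop] theorem primrec_look {f : α → List (Option ℕ)} {g : α → ℕ} (hf : Primrec f)
    (hg : Primrec g) : Primrec fun a => look (f a) (g a) := by
  unfold look
  fun_prop

@[fun_prop] theorem primrec_nV {f : α → GraphCode Λ ar} (hf : Primrec f) :
    Primrec fun a => (f a).nV := Primrec.fst.comp (primrec_val.comp hf)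

@[fun_prop] theorem primrec_nE {f : α → GraphCode Λ ar} (hf : Primrec f) :
    Primrec fun a => (f a).nE := Primrec.list_length.comp (Primrec.snd.comp (primrec_val.comp hf))

@[fun_prop] theorem primrec_lab {f : α → GraphCode Λ ar} {g : α → ℕ} (hf : Primrec f)
    (hg : Primrec g) : Primrec fun a => (f a).lab (g a) := by
  have h : Primrec fun a => (f a).1 := primrec_val.comp hf
  unfold GraphCode.lab
  fun_prop

@[fun_prop] theorem primrec_con {f : α → GraphCode Λ ar} {g : α → ℕ} (hf : Primrec f)
    (hg : Primrec g) : Primrec fun a => (f a).con (g a) := by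
  have h : Primrec fun a => (f a).1 := primrec_val.comp hf
  unfold GraphCode.con
  fun_prop

@[fun_prop] theorem primrec_validMor {f g : α → GraphCode Λ ar} {h : α → MorCode}
    (hf : Primrec f) (hg : Primrec g) (hh : Primrec h) :
    Primrec fun a => validMor (f a) (g a) (h a) := by
  unfold validMor
  fun_prop

@[fun_prop] theorem primrec_homs {f g : α → GraphCode Λ ar}
    (hf : Primrec f) (hg : Primrec g) :
    Primrec fun a => homs (f a) (g a) := by
  unfold homs
  fun_prop

@[fun_prop] theorem primrec_compC {g f : α → MorCode} (hg : Primrec g) (hf : Primrec f) :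
    Primrec fun a => compC (g a) (f a) := by
  unfold compC
  fun_prop

@[fun_prop] theorem primrec_idC {f : α → GraphCode Λ ar} (hf : Primrec f) :
    Primrec fun a => idC (f a) := by
  unfold idC
  fun_prop

end Primrec

/-! ### Decision procedures for coded graphs -/

section Codes

variable {a b c d : GraphCode Λ ar}

/-- Test for the totality of a coded morphism. -/
def totalB (f : MorCode) : Bool := f.1.all (fun o => o.isSome) && f.2.all (fun o => o.isSome)

/-- Test whether elements at which `l` has the same value are both in the domain of `l'` or
both outside. -/
def conflictFreeB (l l' : List (Option ℕ)) : Bool :=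
  (List.range l.length).all fun x => (List.range l.length).all fun y =>
    !(decide (look l x = look l y)) || decide ((look l' x).isSome = (look l' y).isSome)

/-- Test whether the coded morphism `m` is total and conflict-free with respect to `r`. -/
def matchB (m r : MorCode) : Bool :=
  totalB m && (conflictFreeB m.1 r.1 && conflictFreeB m.2 r.2)

theorem totalB_iff {φ : PMor a.graph b.graph} : totalB φ.code = true ↔ φ.Total := by
  have h : ∀ {n m : ℕ} (f : Fin n → Option (Fin m)),
      ((List.ofFn fun v => (f v).map fun w => w.val).all (fun o => o.isSome) = true ↔
        ∀ v, ∃ w, f v = some w) := by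
    intro n m f
    rw [List.all_eq_true]
    simp only [List.mem_ofFn, forall_exists_index, forall_apply_eq_imp_iff, Option.isSome_map]
    exact forall_congr' fun v => Option.isSome_iff_exists
  rw [totalB, Bool.and_eq_true]
  exact and_congr (h _) (h _)

/-- For total `f`, it suffices to compare the values of `f` without regard to whether they are
defined. -/
theorem conflictFreeB_iff {n m k : ℕ} {f : Fin n → Option (Fin m)} {g : Fin n → Option (Fin k)}
    (hf : ∀ v, ∃ w, f v = some w) :
    conflictFreeB (List.ofFn fun v => (f v).map fun w => w.val)
      (List.ofFn fun v => (g v).map fun w => w.val) = true ↔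
    ∀ x y z, f x = some z → f y = some z → ((g x).isSome ↔ (g y).isSome) := by
  have hl : ∀ {k : ℕ} (g : Fin n → Option (Fin k)) (x : Fin n),
      look (List.ofFn fun v => (g v).map fun w => w.val) x = (g x).map fun w => w.val := by
    intro k g x
    simp [look]
  simp only [conflictFreeB, List.length_ofFn, List.all_eq_true, List.mem_range, Bool.or_eq_true,
    Bool.not_eq_true', decide_eq_false_iff_not, decide_eq_true_eq]
  constructor
  · intro h x y z hx hy
    rcases h x x.2 y y.2 with h | h
    · rw [hl, hl, hx, hy] at h
      exact (h rfl).elim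
    · rw [hl, hl, Option.isSome_map, Option.isSome_map] at h
      rw [h]
  · intro h x hx y hy
    by_cases hxy : f ⟨x, hx⟩ = f ⟨y, hy⟩
    · right
      obtain ⟨z, hz⟩ := hf ⟨x, hx⟩
      have := h ⟨x, hx⟩ ⟨y, hy⟩ z hz (hxy ▸ hz)
      have h1 := hl g ⟨x, hx⟩
      have h2 := hl g ⟨y, hy⟩
      dsimp only at h1 h2
      rw [h1, h2, Option.isSome_map, Option.isSome_map]
      exact Bool.eq_iff_iff.2 this
    · left
      have h1 := hl f ⟨x, hx⟩
      have h2 := hl f ⟨y, hy⟩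
      dsimp only at h1 h2
      rw [h1, h2]
      exact fun h => hxy (Option.map_injective Fin.val_injective h)

theorem matchB_iff {m : PMor a.graph c.graph} {r : PMor a.graph b.graph} :
    matchB m.code r.code = true ↔ m.Total ∧ m.ConflictFree r := by
  rw [matchB, Bool.and_eq_true, Bool.and_eq_true, totalB_iff]
  refine and_congr_right fun ht => ?_
  exact and_congr (conflictFreeB_iff ht.1) (conflictFreeB_iff ht.2)

/-- Test for the subgraph order: whether `a` is a retract of `b`. -/
def leB [Encodable Λ] (a b : GraphCode Λ ar) : Bool :=
  (homs a b).any fun j => (homs b a).any fun f => decide (compC f j = idC a)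

theorem leB_iff [Encodable Λ] : leB a b = true ↔ SubgraphOf a.graph b.graph := by
  rw [subgraphOf_iff_embeds, embeds_iff_exists_retract, leB, any_homs]
  refine exists_congr fun j => ?_
  rw [any_homs]
  refine exists_congr fun f => ?_
  rw [decide_eq_true_eq, ← code_comp, ← code_id]
  exact PMor.code_injective.eq_iff

/-- All labels. -/
noncomputable def labels (Λ : Type) [Finite Λ] : List Λ :=
  (@Finset.univ Λ (Fintype.ofFinite Λ)).toList

theorem mem_labels [Finite Λ] (l : Λ) : l ∈ labels Λ := by
  simp [labels]

/-- All pairs consisting of a label and a sequence of nodes smaller than `n`. -/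
noncomputable def edges [Finite Λ] (ar : Λ → ℕ) (n : ℕ) : List (Λ × List ℕ) :=
  (labels Λ).flatMap fun l => (words (ar l) (List.range n)).map fun w => (l, w)

/-- All coded graphs with at most `N` nodes and at most `M` edges. -/
noncomputable def graphsUpTo [Finite Λ] [Primcodable Λ] (ar : Λ → ℕ) (N M : ℕ) :
    List (GraphCode Λ ar) :=
  (List.range (N + 1)).flatMap fun n => (List.range (M + 1)).flatMap fun m =>
    (words m (edges ar n)).filterMap fun l => Encodable.decode (Encodable.encode (n, l))

theorem mem_graphsUpTo [Finite Λ] [Primcodable Λ] {N M : ℕ} {a : GraphCode Λ ar} (hN : a.nV ≤ N)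
    (hM : a.nE ≤ M) : a ∈ graphsUpTo ar N M := by
  simp only [graphsUpTo, List.mem_flatMap, List.mem_filterMap, mem_words, List.mem_range]
  refine ⟨a.nV, by omega, a.nE, by omega, a.1.2, ⟨rfl, fun e he => ?_⟩, ?_⟩
  · obtain ⟨h1, h2⟩ := a.2 e he
    simp only [edges, List.mem_flatMap, List.mem_map, mem_words, List.mem_range]
    exact ⟨e.1, mem_labels _, e.2, ⟨h1, h2⟩, rfl⟩
  · exact Encodable.encodek a

theorem exists_mem_graphsUpTo [Finite Λ] [Primcodable Λ] {N M : ℕ} {G : Hypergraph Λ ar}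
    (hN : Nat.card G.V ≤ N) (hM : Nat.card G.E ≤ M) :
    ∃ a ∈ graphsUpTo ar N M, Isomorphic a.graph G := by
  obtain ⟨a, ha⟩ := GraphCode.exists_code G
  have h := ha.embeds.card_le
  have h1 : Nat.card a.graph.V = a.nV := Nat.card_fin _
  have h2 : Nat.card a.graph.E = a.nE := Nat.card_fin _
  exact ⟨a, mem_graphsUpTo (by omega) (by omega), ha⟩

/-- The universal property of a square with respect to the cocones with a given apex. -/
def HasMediator {G₀ G₁ G₂ G₃ : Hypergraph Λ ar} (φ : PMor G₀ G₁) (ψ : PMor G₀ G₂)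
    (ψ' : PMor G₁ G₃) (φ' : PMor G₂ G₃) (K : Hypergraph Λ ar) : Prop :=
  ∀ (ψ'' : PMor G₁ K) (φ'' : PMor G₂ K), ψ''.comp φ = φ''.comp ψ →
    ∃! η : PMor G₃ K, η.comp ψ' = ψ'' ∧ η.comp φ' = φ''

/-- A commuting square is a pushout if it has the universal property with respect to its own apex
and to the apex of some pushout. -/
theorem IsPushout.of_hasMediator {G₀ G₁ G₂ G₃ H : Hypergraph Λ ar} {φ : PMor G₀ G₁}
    {ψ : PMor G₀ G₂} {ψ' : PMor G₁ G₃} {φ' : PMor G₂ G₃} {p : PMor G₁ H} {q : PMor G₂ H}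
    (h : IsPushout φ ψ p q) (hcomm : ψ'.comp φ = φ'.comp ψ)
    (h₃ : HasMediator φ ψ ψ' φ' G₃) (hH : HasMediator φ ψ ψ' φ' H) :
    IsPushout φ ψ ψ' φ' := by
  obtain ⟨η, ⟨hp, hq⟩, -⟩ := hH p q h.1
  obtain ⟨θ, ⟨hp', hq'⟩, -⟩ := h.2 G₃ ψ' φ' hcomm
  have hid : θ.comp η = PMor.id G₃ := by
    refine (h₃ ψ' φ' hcomm).unique ⟨?_, ?_⟩ ⟨PMor.id_comp _, PMor.id_comp _⟩
    · rw [PMor.comp_assoc, hp, hp']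
    · rw [PMor.comp_assoc, hq, hq']
  refine ⟨hcomm, fun K f g hfg => ?_⟩
  obtain ⟨κ, ⟨h1, h2⟩, hκ⟩ := h.2 K f g hfg
  refine ⟨κ.comp η, ⟨by rw [PMor.comp_assoc, hp, h1], by rw [PMor.comp_assoc, hq, h2]⟩, ?_⟩
  rintro ζ ⟨hζ, hζ'⟩
  have h3 := hκ (ζ.comp θ) ⟨by rw [PMor.comp_assoc, hp', hζ], by rw [PMor.comp_assoc, hq', hζ']⟩
  rw [← h3, PMor.comp_assoc, hid, PMor.comp_id]

theorem IsPushout.embeds {G₀ G₁ G₂ G₃ H : Hypergraph Λ ar} {φ : PMor G₀ G₁}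
    {ψ : PMor G₀ G₂} {ψ' : PMor G₁ G₃} {φ' : PMor G₂ G₃} {p : PMor G₁ H} {q : PMor G₂ H}
    (h : IsPushout φ ψ ψ' φ') (h' : IsPushout φ ψ p q) : Embeds G₃ H := by
  obtain ⟨η, ⟨hp, hq⟩, -⟩ := h.2 H p q h'.1
  obtain ⟨θ, ⟨hp', hq'⟩, -⟩ := h'.2 G₃ ψ' φ' h.1
  refine embeds_iff_exists_retract.2 ⟨η, θ, ?_⟩
  refine (h.2 G₃ ψ' φ' h.1).unique ⟨?_, ?_⟩ ⟨PMor.id_comp _, PMor.id_comp _⟩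
  · rw [PMor.comp_assoc, hp, hp']
  · rw [PMor.comp_assoc, hq, hq']

theorem IsElementaryPushout.card_le {G₀ G₁ G₂ G₃ : Hypergraph Λ ar} {φ : PMor G₀ G₁}
    {ψ : PMor G₀ G₂} {ψ' : PMor G₁ G₃} {φ' : PMor G₂ G₃} (h : IsElementaryPushout φ ψ ψ' φ') :
    Nat.card G₃.V ≤ Nat.card G₁.V + Nat.card G₂.V ∧
      Nat.card G₃.E ≤ Nat.card G₁.E + Nat.card G₂.E := by
  have key : ∀ {X Y Z : Type} [Finite X] [Finite Y] {p : X → Option Z} {q : Y → Option Z},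
      JointlySurjective p q → Nat.card Z ≤ Nat.card X + Nat.card Y := by
    intro X Y Z _ _ p q hpq
    have hs : ∀ z, ∃ x : X ⊕ Y, Sum.elim p q x = some z := fun z =>
      (hpq z).elim (fun ⟨a, ha⟩ => ⟨.inl a, ha⟩) fun ⟨b, hb⟩ => ⟨.inr b, hb⟩
    choose s hs using hs
    rw [← Nat.card_sum]
    refine Nat.card_le_card_of_injective s fun z z' hz => ?_
    exact Option.some.inj ((hs z).symm.trans ((congrArg _ hz).trans (hs z')))
  have := G₁.finite_V
  have := G₂.finite_V
  have := G₁.finite_E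
  have := G₂.finite_E
  exact ⟨key h.surjV, key h.surjE⟩

/-- Every span of coded graphs has a pushout in the list of graphs whose size is bounded by the sum
of the sizes of the feet. -/
theorem exists_code_isPushout [Finite Λ] [Primcodable Λ] (φ : PMor a.graph b.graph)
    (ψ : PMor a.graph c.graph) :
    ∃ d ∈ graphsUpTo ar (b.nV + c.nV) (b.nE + c.nE), ∃ (p : PMor b.graph d.graph)
      (q : PMor c.graph d.graph), IsPushout φ ψ p q := by
  obtain ⟨H, p, q, h⟩ := exists_isPushout φ ψ
  have hV : ∀ e : GraphCode Λ ar, Nat.card e.graph.V = e.nV := fun e => Nat.card_fin _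
  have hE : ∀ e : GraphCode Λ ar, Nat.card e.graph.E = e.nE := fun e => Nat.card_fin _
  have hc := h.card_le
  rw [hV, hV, hE, hE] at hc
  obtain ⟨d, hd, hdH⟩ := exists_mem_graphsUpTo hc.1 hc.2
  obtain ⟨i, j, h1, h2, -⟩ := isomorphic_iff_exists_inverse.1 hdH
  have := h.isPushout.congr (PMor.id_comp (PMor.id _)) (PMor.id_comp (PMor.id _))
    (PMor.id_comp (PMor.id _)) (PMor.id_comp (PMor.id _)) (PMor.id_comp (PMor.id _)) h2 h1
  simp only [PMor.id_comp, PMor.comp_id] at this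
  exact ⟨d, hd, _, _, this⟩

/-- Test for the universal property with respect to cocones with apex `K`. -/
def mediatorB [Encodable Λ] (b c d : GraphCode Λ ar) (r m m' r' : MorCode) (K : GraphCode Λ ar) :
    Bool :=
  (homs b K).all fun f => (homs c K).all fun g => !(decide (compC f r = compC g m)) ||
    ((homs d K).any fun η => (decide (compC η m' = f) && decide (compC η r' = g)) &&
      (homs d K).all fun ζ => !(decide (compC ζ m' = f) && decide (compC ζ r' = g)) ||
        decide (ζ = η))

theorem mediatorB_iff [Encodable Λ] {φ : PMor a.graph b.graph} {ψ : PMor a.graph c.graph}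
    {ψ' : PMor b.graph d.graph} {φ' : PMor c.graph d.graph} {K : GraphCode Λ ar} :
    mediatorB b c d φ.code ψ.code ψ'.code φ'.code K = true ↔
      HasMediator φ ψ ψ' φ' K.graph := by
  simp only [mediatorB, all_homs, any_homs, ← code_comp, PMor.code_injective.eq_iff,
    Bool.or_eq_true, Bool.and_eq_true, decide_eq_true_eq, Bool.not_eq_true', Bool.and_eq_false_iff,
    decide_eq_false_iff_not, HasMediator, ExistsUnique]
  refine forall_congr' fun f => forall_congr' fun g => ?_
  rw [← imp_iff_not_or]
  refine imp_congr_right fun _ => exists_congr fun η => and_congr_right fun _ =>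
    forall_congr' fun ζ => ?_
  rw [← not_and_or, ← imp_iff_not_or]

/-- Test whether a square of coded morphisms is a pushout. -/
noncomputable def pushoutB [Finite Λ] [Primcodable Λ] (b c d : GraphCode Λ ar)
    (r m m' r' : MorCode) : Bool :=
  decide (compC m' r = compC r' m) && (mediatorB b c d r m m' r' d &&
    (graphsUpTo ar (b.nV + c.nV) (b.nE + c.nE)).all fun K => mediatorB b c d r m m' r' K)

theorem pushoutB_iff [Finite Λ] [Primcodable Λ] {φ : PMor a.graph b.graph}
    {ψ : PMor a.graph c.graph} {ψ' : PMor b.graph d.graph} {φ' : PMor c.graph d.graph} :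
    pushoutB b c d φ.code ψ.code ψ'.code φ'.code = true ↔ IsPushout φ ψ ψ' φ' := by
  simp only [pushoutB, Bool.and_eq_true, List.all_eq_true, mediatorB_iff, ← code_comp,
    PMor.code_injective.eq_iff, decide_eq_true_eq]
  constructor
  · rintro ⟨h1, h2, h3⟩
    obtain ⟨H, hH, p, q, h⟩ := exists_code_isPushout φ ψ
    exact h.of_hasMediator h1 h2 (h3 H hH)
  · intro h
    exact ⟨h.1, h.2 _, fun K _ => h.2 _⟩

/-- Test whether the entries of a list are pairwise distinct. -/
def nodupB (l : List ℕ) : Bool :=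
  (List.range l.length).all fun i => (List.range l.length).all fun j =>
    decide (i = j) || !(decide (l.getD i 0 = l.getD j 0))

/-- Test whether the edge `e` is incident to the node `v`. -/
def incidentB (a : GraphCode Λ ar) (e v : ℕ) : Bool := (a.con e).any fun w => decide (w = v)

/-- Test for bounded paths.  Only paths of length `k + 1` have to be excluded, since longer paths
contain them. -/
def boundedPathB (k : ℕ) (a : GraphCode Λ ar) : Bool :=
  (words (k + 2) (List.range a.nV)).all fun v => (words (k + 1) (List.range a.nE)).all fun e =>
    !((nodupB v && nodupB e) && (List.range (k + 1)).all fun i =>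
      incidentB a (e.getD i 0) (v.getD i 0) && incidentB a (e.getD i 0) (v.getD (i + 1) 0))

theorem nodupB_ofFn {n m : ℕ} {f : Fin n → Fin m} :
    nodupB (List.ofFn fun i => (f i).val) = true ↔ Function.Injective f := by
  simp only [nodupB, List.length_ofFn, List.all_eq_true, List.mem_range, Bool.or_eq_true,
    decide_eq_true_eq, Bool.not_eq_true', decide_eq_false_iff_not]
  have hl : ∀ i : Fin n, (List.ofFn fun i => (f i).val).getD i.1 0 = (f i).val := by
    intro i
    simp
  constructor
  · intro h i j hij
    rcases h i i.2 j j.2 with h | h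
    · exact Fin.ext h
    · rw [hl, hl, hij] at h
      exact (h rfl).elim
  · intro h i hi j hj
    by_cases hij : i = j
    · exact .inl hij
    · right
      have h1 := hl ⟨i, hi⟩
      have h2 := hl ⟨j, hj⟩
      dsimp only at h1 h2
      rw [h1, h2]
      exact fun h' => hij (congrArg Fin.val (h (Fin.ext h')))

theorem incidentB_iff {e : Fin a.1.2.length} {v : Fin a.1.1} :
    incidentB a e v = true ↔ v ∈ a.graph.conn e := by
  simp only [incidentB, List.any_eq_true, decide_eq_true_eq, exists_eq_right]
  rw [← a.con_graph]
  exact List.mem_map_of_injective Fin.val_injective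

theorem mem_words_range {n m : ℕ} {l : List ℕ} : l ∈ words n (List.range m) ↔
    ∃ f : Fin n → Fin m, (List.ofFn fun i => (f i).val) = l := by
  rw [mem_words]
  constructor
  · rintro ⟨rfl, h⟩
    refine ⟨fun i => ⟨l[i], List.mem_range.1 (h _ (List.getElem_mem _))⟩, ?_⟩
    exact List.ofFn_getElem
  · rintro ⟨f, rfl⟩
    refine ⟨List.length_ofFn, fun i hi => ?_⟩
    obtain ⟨j, rfl⟩ := (List.mem_ofFn' _ _).1 hi
    exact List.mem_range.2 (f j).2

theorem boundedPathB_iff {k : ℕ} : boundedPathB k a = true ↔ a.graph ∈ boundedPath Λ ar k := by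
  simp only [boundedPathB, List.all_eq_true, mem_words_range, forall_exists_index,
    forall_apply_eq_imp_iff, Bool.not_eq_true', ← Bool.not_eq_true, Bool.and_eq_true, nodupB_ofFn,
    List.mem_range]
  have key : ∀ (v : Fin (k + 1 + 1) → Fin a.1.1) (e : Fin (k + 1) → Fin a.1.2.length),
      ((∀ i < k + 1, incidentB a ((List.ofFn fun i => (e i).val).getD i 0)
          ((List.ofFn fun i => (v i).val).getD i 0) = true ∧
        incidentB a ((List.ofFn fun i => (e i).val).getD i 0)
          ((List.ofFn fun i => (v i).val).getD (i + 1) 0) = true) ↔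
      ∀ i : Fin (k + 1), v i.castSucc ∈ a.graph.conn (e i) ∧ v i.succ ∈ a.graph.conn (e i)) := by
    intro v e
    have hl : ∀ {n m : ℕ} (f : Fin n → Fin m) (i : Fin n),
        (List.ofFn fun i => (f i).val).getD i.1 0 = (f i).val := by
      intro n m f i
      simp
    have hi : ∀ i : Fin (k + 1),
        (incidentB a ((List.ofFn fun i => (e i).val).getD i.1 0)
          ((List.ofFn fun i => (v i).val).getD i.1 0) = true ∧
        incidentB a ((List.ofFn fun i => (e i).val).getD i.1 0)
          ((List.ofFn fun i => (v i).val).getD (i.1 + 1) 0) = true) ↔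
        (v i.castSucc ∈ a.graph.conn (e i) ∧ v i.succ ∈ a.graph.conn (e i)) := by
      intro i
      have h1 := hl v i.castSucc
      have h2 := hl v i.succ
      rw [Fin.val_castSucc] at h1
      rw [Fin.val_succ] at h2
      rw [h1, h2, hl, incidentB_iff, incidentB_iff]
    exact ⟨fun h i => (hi i).1 (h i i.2), fun h i hi' => (hi ⟨i, hi'⟩).2 (h ⟨i, hi'⟩)⟩
  constructor
  · intro h n v e hve
    by_contra hn
    push Not at hn
    refine h (fun i => v ⟨i.1, by have := i.2; omega⟩) (fun i => e ⟨i.1, by have := i.2; omega⟩)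
      ⟨⟨fun i j hij => Fin.ext ?_, fun i j hij => Fin.ext ?_⟩, (key _ _).2 fun i => ?_⟩
    · have := congrArg Fin.val (hve.1 hij)
      exact this
    · have := congrArg Fin.val (hve.2.1 hij)
      exact this
    · exact hve.2.2 ⟨i.1, by have := i.2; omega⟩
  · rintro h v e ⟨⟨hv, he⟩, hi⟩
    have := h (k + 1) v e ⟨hv, he, (key v e).1 hi⟩
    omega

/-- Test whether `G` is a pushout complement object of `r` and `m'`. -/
noncomputable def pocB [Finite Λ] [Primcodable Λ] (L R S : GraphCode Λ ar) (r m' : MorCode)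
    (G : GraphCode Λ ar) : Bool :=
  (homs L G).any fun m => matchB m r && (homs G S).any fun r' => pushoutB R G S r m m' r'

theorem pocB_iff [Finite Λ] [Primcodable Λ] {L R S G : GraphCode Λ ar} {r : PMor L.graph R.graph}
    {m' : PMor R.graph S.graph} : pocB L R S r.code m'.code G = true ↔ IsPOC r m' G.graph := by
  simp only [pocB, any_homs, Bool.and_eq_true, matchB_iff, pushoutB_iff, IsPOC]
  constructor
  · rintro ⟨m, ⟨h1, h2⟩, r', h⟩
    exact ⟨m, r', h1, h2, h⟩
  · rintro ⟨m, r', h1, h2, h⟩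
    exact ⟨m, ⟨h1, h2⟩, r', h⟩

/-- Representatives of the pushout complement objects that are not too large. -/
noncomputable def pocList [Finite Λ] [Primcodable Λ] (L R S : GraphCode Λ ar) (r m' : MorCode) :
    List (GraphCode Λ ar) :=
  (graphsUpTo ar (L.nV + S.nV) (L.nE + S.nE)).filter fun G => pocB L R S r m' G

/-- Representatives of the minimal pushout complement objects. -/
noncomputable def minPocList [Finite Λ] [Primcodable Λ] (L R S : GraphCode Λ ar) (r m' : MorCode) :
    List (GraphCode Λ ar) :=
  (pocList L R S r m').filter fun G => (pocList L R S r m').all fun G' => !(leB G' G) || leB G G'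

/-- Test whether the rule `(L, R, r)` rewrites `G` to some graph above `T`. -/
noncomputable def rewritesAboveB [Finite Λ] [Primcodable Λ] (L R : GraphCode Λ ar) (r : MorCode)
    (G T : GraphCode Λ ar) : Bool :=
  (homs L G).any fun m => matchB m r &&
    (graphsUpTo ar (R.nV + G.nV) (R.nE + G.nE)).any fun H => leB T H &&
      (homs R H).any fun m' => (homs G H).any fun r' => pushoutB R G H r m m' r'

theorem rewritesAboveB_iff [Finite Λ] [Primcodable Λ] {L R G T : GraphCode Λ ar}
    {r : PMor L.graph R.graph} : rewritesAboveB L R r.code G T = true ↔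
      ∃ H, Rule.Rewrites ⟨L.graph, R.graph, r⟩ G.graph H ∧ SubgraphOf T.graph H := by
  rw [rewritesAboveB, any_homs]
  constructor
  · rintro ⟨m, h⟩
    rw [Bool.and_eq_true, matchB_iff, List.any_eq_true] at h
    obtain ⟨⟨h1, h2⟩, H, -, h⟩ := h
    rw [Bool.and_eq_true, leB_iff] at h
    simp only [any_homs, pushoutB_iff] at h
    obtain ⟨hT, m', r', h⟩ := h
    exact ⟨H.graph, ⟨m, m', r', h1, h2, h⟩, hT⟩
  · rintro ⟨H, ⟨m, m', r', h1, h2, h⟩, hT⟩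
    obtain ⟨K, hK, p, q, hpo⟩ := exists_code_isPushout r m
    rw [subgraphOf_iff_embeds] at hT
    refine ⟨m, ?_⟩
    rw [Bool.and_eq_true, matchB_iff, List.any_eq_true]
    refine ⟨⟨h1, h2⟩, K, hK, ?_⟩
    rw [Bool.and_eq_true, leB_iff]
    simp only [any_homs, pushoutB_iff]
    exact ⟨subgraphOf_iff_embeds.2 (hT.trans (h.embeds hpo)), p, q, hpo⟩

/-- A rule given by codes. -/
abbrev RuleCode (Λ : Type) (ar : Λ → ℕ) : Type :=
  (GraphCode Λ ar × GraphCode Λ ar) × MorCode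

/-- A finite basis of the predecessors of the graphs above `T`. -/
noncomputable def predList [Finite Λ] [Primcodable Λ] (rules : List (RuleCode Λ ar))
    (T : GraphCode Λ ar) : List (GraphCode Λ ar) :=
  rules.flatMap fun ρ => (graphsUpTo ar (ρ.1.1.nV + T.nV) (ρ.1.1.nE + T.nE)).filter fun G =>
    rewritesAboveB ρ.1.1 ρ.1.2 ρ.2 G T

end Codes

section Primrec

variable [Primcodable Λ] [Finite Λ] {α : Type} [Primcodable α]

@[fun_prop] theorem primrec_totalB {f : α → MorCode} (hf : Primrec f) :
    Primrec fun a => totalB (f a) := by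
  unfold totalB
  fun_prop

@[fun_prop] theorem primrec_conflictFreeB {f g : α → List (Option ℕ)} (hf : Primrec f)
    (hg : Primrec g) : Primrec fun a => conflictFreeB (f a) (g a) := by
  unfold conflictFreeB
  fun_prop

@[fun_prop] theorem primrec_matchB {f g : α → MorCode} (hf : Primrec f)
    (hg : Primrec g) : Primrec fun a => matchB (f a) (g a) := by
  unfold matchB
  fun_prop

@[fun_prop] theorem primrec_leB {f g : α → GraphCode Λ ar} (hf : Primrec f) (hg : Primrec g) :
    Primrec fun a => leB (f a) (g a) := by
  unfold leB
  fun_prop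

@[fun_prop] theorem primrec_edges {f : α → ℕ} (hf : Primrec f) :
    Primrec fun a => edges ar (f a) := by
  have h : Primrec ar := Primrec.dom_finite ar
  unfold edges
  fun_prop

@[fun_prop] theorem primrec_graphsUpTo {f g : α → ℕ} (hf : Primrec f) (hg : Primrec g) :
    Primrec fun a => graphsUpTo ar (f a) (g a) := by
  have h : Primrec fun n => (Encodable.decode n : Option (GraphCode Λ ar)) := Primrec.decode
  unfold graphsUpTo
  fun_prop

@[fun_prop] theorem primrec_mediatorB {b c d K : α → GraphCode Λ ar} {r m m' r' : α → MorCode}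
    (hb : Primrec b) (hc : Primrec c) (hd : Primrec d) (hr : Primrec r) (hm : Primrec m)
    (hm' : Primrec m') (hr' : Primrec r') (hK : Primrec K) :
    Primrec fun a => mediatorB (b a) (c a) (d a) (r a) (m a) (m' a) (r' a) (K a) := by
  unfold mediatorB
  fun_prop

@[fun_prop] theorem primrec_pushoutB {b c d : α → GraphCode Λ ar} {r m m' r' : α → MorCode}
    (hb : Primrec b) (hc : Primrec c) (hd : Primrec d) (hr : Primrec r) (hm : Primrec m)
    (hm' : Primrec m') (hr' : Primrec r') :
    Primrec fun a => pushoutB (b a) (c a) (d a) (r a) (m a) (m' a) (r' a) := by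
  unfold pushoutB
  fun_prop

@[fun_prop] theorem primrec_boundedPathB {k : ℕ} {f : α → GraphCode Λ ar} (hf : Primrec f) :
    Primrec fun a => boundedPathB k (f a) := by
  unfold boundedPathB nodupB incidentB
  fun_prop

@[fun_prop] theorem primrec_pocB {L R S G : α → GraphCode Λ ar} {r m' : α → MorCode}
    (hL : Primrec L) (hR : Primrec R) (hS : Primrec S) (hr : Primrec r) (hm' : Primrec m')
    (hG : Primrec G) : Primrec fun a => pocB (L a) (R a) (S a) (r a) (m' a) (G a) := by
  unfold pocB
  fun_prop

@[fun_prop] theorem primrec_pocList {L R S : α → GraphCode Λ ar} {r m' : α → MorCode}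
    (hL : Primrec L) (hR : Primrec R) (hS : Primrec S) (hr : Primrec r) (hm' : Primrec m') :
    Primrec fun a => pocList (L a) (R a) (S a) (r a) (m' a) := by
  unfold pocList
  fun_prop

@[fun_prop] theorem primrec_minPocList {L R S : α → GraphCode Λ ar} {r m' : α → MorCode}
    (hL : Primrec L) (hR : Primrec R) (hS : Primrec S) (hr : Primrec r) (hm' : Primrec m') :
    Primrec fun a => minPocList (L a) (R a) (S a) (r a) (m' a) := by
  unfold minPocList
  fun_prop

@[fun_prop] theorem primrec_rewritesAboveB {L R G T : α → GraphCode Λ ar} {r : α → MorCode}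
    (hL : Primrec L) (hR : Primrec R) (hr : Primrec r) (hG : Primrec G) (hT : Primrec T) :
    Primrec fun a => rewritesAboveB (L a) (R a) (r a) (G a) (T a) := by
  unfold rewritesAboveB
  fun_prop

@[fun_prop] theorem primrec_predList {rules : List (RuleCode Λ ar)} {T : α → GraphCode Λ ar}
    (hT : Primrec T) : Primrec fun a => predList rules (T a) := by
  unfold predList
  fun_prop

end Primrec

/-! ### Backward search in well-structured transition systems -/

section Backward

universe u

variable {S : Type u} {le R step : S → S → Prop}

theorem subset_upClosure (hrefl : ∀ s, le s s) (A : Set S) : A ⊆ upClosure le A :=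
  fun a ha => ⟨a, ha, hrefl a⟩

theorem upClosure_mono {A B : Set S} (h : A ⊆ B) : upClosure le A ⊆ upClosure le B :=
  fun _ ⟨a, ha, hax⟩ => ⟨a, h ha, hax⟩

theorem upClosure_subset_iff (hrefl : ∀ s, le s s) (htrans : ∀ s t r, le s t → le t r → le s r)
    {A B : Set S} : upClosure le A ⊆ upClosure le B ↔ A ⊆ upClosure le B := by
  refine ⟨fun h => (subset_upClosure hrefl A).trans h, ?_⟩
  rintro h x ⟨a, ha, hax⟩
  obtain ⟨b, hb, hba⟩ := h ha
  exact ⟨b, hb, htrans _ _ _ hba hax⟩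

/-- The upward closed sets of the backward search from `U` with respect to `R`.  They do not depend
on the choice of the bases. -/
def predIter (le R : S → S → Prop) (U : Set S) : ℕ → Set S
  | 0 => U
  | n + 1 => predIter le R U n ∪ upClosure le (pred R (predIter le R U n))

theorem predIter_mono {U : Set S} : Monotone (predIter le R U) :=
  monotone_nat_of_le_succ fun _ => Set.subset_union_left

theorem predIter_eq_of_stationary {U : Set S} {m n : ℕ}
    (hm : predIter le R U m = predIter le R U (m + 1)) (h : m ≤ n) :
    predIter le R U n = predIter le R U m := by
  induction n, h using Nat.le_induction with
  | base => rfl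
  | succ n _ ih =>
    rw [predIter, ih]
    exact hm.symm

theorem predIter_eq_of_stationary_of_stationary {U : Set S} {m n : ℕ}
    (hm : predIter le R U m = predIter le R U (m + 1))
    (hn : predIter le R U n = predIter le R U (n + 1)) :
    predIter le R U n = predIter le R U m := by
  rcases le_total m n with h | h
  · exact predIter_eq_of_stationary hm h
  · exact (predIter_eq_of_stationary hn h).symm

theorem mem_predIter_of_le (htrans : ∀ s t r, le s t → le t r → le s r) {B : Set S} {n : ℕ}
    {x y : S} (hx : x ∈ predIter le R (upClosure le B) n) (hxy : le x y) :
    y ∈ predIter le R (upClosure le B) n := by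
  have key : ∀ {A : Set S}, x ∈ upClosure le A → y ∈ upClosure le A := fun ⟨a, ha, hax⟩ =>
    ⟨a, ha, htrans _ _ _ hax hxy⟩
  induction n with
  | zero => exact key hx
  | succ n ih => exact hx.elim (fun h => .inl (ih h)) fun h => .inr (key h)

/-- All states found by the backward search reach the target, since larger states can simulate the
transitions of smaller ones. -/
theorem coversSet_of_mem_predIter (htrans : ∀ s t r, le s t → le t r → le s r)
    (hcompat : ∀ s₁ s₂ t₁, le s₁ t₁ → step s₁ s₂ →
      ∃ t₂, Relation.ReflTransGen step t₁ t₂ ∧ le s₂ t₂)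
    (hR : ∀ s t, R s t → step s t) {B : Set S} {n : ℕ} {x : S}
    (hx : x ∈ predIter le R (upClosure le B) n) : CoversSet step x (upClosure le B) := by
  induction n generalizing x with
  | zero => exact ⟨x, hx, .refl⟩
  | succ n ih =>
    rcases hx with hx | ⟨z, ⟨y, hy, hzy⟩, hzx⟩
    · exact ih hx
    · obtain ⟨y', hxy', hyy'⟩ := hcompat z y x hzx (hR _ _ hzy)
      obtain ⟨w, hw, hyw⟩ := ih (mem_predIter_of_le htrans hy hyy')
      exact ⟨w, hw, hxy'.trans hyw⟩

/-- A stationary set of the backward search contains all states that reach the target. -/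
theorem mem_predIter_of_coversSet (hrefl : ∀ s, le s s) {R' : S → S → Prop}
    (hR : ∀ s t, R' s t → R s t) {U : Set S} {m : ℕ}
    (hm : predIter le R U m = predIter le R U (m + 1)) {x : S} (hx : CoversSet R' x U) :
    x ∈ predIter le R U m := by
  obtain ⟨y, hy, hxy⟩ := hx
  induction hxy using Relation.ReflTransGen.head_induction_on with
  | refl => exact predIter_mono (Nat.zero_le m) hy
  | head h _ ih =>
    rw [hm]
    exact .inr (subset_upClosure hrefl _ ⟨_, ih, hR _ _ h⟩)

/-- Increasing sequences of upward closed sets which are generated by elements of a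
well-quasi-ordered set become stationary. -/
theorem exists_stationary {Q : Set S} (hrefl : ∀ s, le s s)
    (htrans : ∀ s t r, le s t → le t r → le s r)
    (hwqo : ∀ x : ℕ → S, (∀ n, x n ∈ Q) → ∃ i j, i < j ∧ le (x i) (x j)) (A : ℕ → Set S)
    (hA : ∀ n, A n ⊆ Q) (hmono : Monotone fun n => upClosure le (A n)) :
    ∃ m, upClosure le (A m) = upClosure le (A (m + 1)) := by
  by_contra! h
  have hx : ∀ n, ∃ x ∈ A (n + 1), x ∉ upClosure le (A n) := by
    intro n
    by_contra! hn
    exact h n (Set.Subset.antisymm (hmono n.le_succ)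
      ((upClosure_subset_iff hrefl htrans).2 hn))
  choose x hx hx' using hx
  obtain ⟨i, j, hij, hle⟩ := hwqo x fun n => hA _ (hx n)
  obtain ⟨a, ha, hai⟩ := hmono (Nat.succ_le_of_lt hij) (subset_upClosure hrefl _ (hx i))
  exact hx' j ⟨a, ha, htrans _ _ _ hai hle⟩

/-- One step of the backward search, computed from bases. -/
theorem upClosure_union_basis {A A' : Set S} {F : S → Set S}
    (hA : upClosure le A' = upClosure le (A ∪ ⋃ s ∈ A, F s))
    (hF : ∀ s ∈ A, upClosure le (F s) = upClosure le (pred R (upClosure le {s}))) :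
    upClosure le A' = upClosure le A ∪ upClosure le (pred R (upClosure le A)) := by
  rw [hA]
  apply Set.Subset.antisymm
  · rintro x ⟨y, hy | hy, hyx⟩
    · exact .inl ⟨y, hy, hyx⟩
    · obtain ⟨s, hs, hy⟩ := Set.mem_iUnion₂.1 hy
      have : x ∈ upClosure le (F s) := ⟨y, hy, hyx⟩
      rw [hF s hs] at this
      refine .inr (upClosure_mono ?_ this)
      rintro z ⟨w, hw, hzw⟩
      exact ⟨w, upClosure_mono (Set.singleton_subset_iff.2 hs) hw, hzw⟩
  · rintro x (hx | ⟨z, ⟨w, ⟨s, hs, hsw⟩, hzw⟩, hzx⟩)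
    · exact upClosure_mono Set.subset_union_left hx
    · have : x ∈ upClosure le (pred R (upClosure le {s})) :=
        ⟨z, ⟨w, ⟨s, rfl, hsw⟩, hzw⟩, hzx⟩
      rw [← hF s hs] at this
      refine upClosure_mono ?_ this
      exact fun y hy => .inr (Set.mem_iUnion₂.2 ⟨s, hs, hy⟩)

/-- The backward search with bases taken from `D` stays in `D`, and computes the sets
`predIter`. -/
theorem upClosure_backSeq {D : Set S} {pb : S → Set S}
    (hpb : ∀ s ∈ D, pb s ⊆ D ∧ upClosure le (pb s) = upClosure le (pred R (upClosure le {s})))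
    {B : Set S} (hB : B ⊆ D) (n : ℕ) :
    backSeq pb B n ⊆ D ∧ upClosure le (backSeq pb B n) = predIter le R (upClosure le B) n := by
  induction n with
  | zero => exact ⟨hB, rfl⟩
  | succ n ih =>
    refine ⟨Set.union_subset ih.1 (Set.iUnion₂_subset fun s hs => (hpb s (ih.1 hs)).1), ?_⟩
    rw [predIter, ← ih.2]
    exact upClosure_union_basis rfl fun s hs => (hpb s (ih.1 hs)).2

end Backward

section Algorithm

universe u

variable {S : Type u} {le R step : S → S → Prop} {C : Type} {ρ : C → S}

/-- The backward search on codes. -/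
def searchList (pb : C → List C) (l : List C) (n : ℕ) : List C :=
  Nat.rec l (fun _ l => l ++ l.flatMap pb) n

theorem searchList_succ (pb : C → List C) (l : List C) (n : ℕ) :
    searchList pb l (n + 1) = searchList pb l n ++ (searchList pb l n).flatMap pb := rfl

theorem upClosure_searchList {D : Set S} {pb : C → List C}
    (hpb : ∀ c, ρ c ∈ D → statesOf ρ (pb c) ⊆ D ∧
      upClosure le (statesOf ρ (pb c)) = upClosure le (pred R (upClosure le {ρ c})))
    {l : List C} (hl : statesOf ρ l ⊆ D) (n : ℕ) :
    statesOf ρ (searchList pb l n) ⊆ D ∧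
      upClosure le (statesOf ρ (searchList pb l n)) =
        predIter le R (upClosure le (statesOf ρ l)) n := by
  induction n with
  | zero => exact ⟨hl, rfl⟩
  | succ n ih =>
    have hD : ∀ c ∈ searchList pb l n, ρ c ∈ D := fun c hc => ih.1 ⟨c, hc, rfl⟩
    refine ⟨?_, ?_⟩
    · rintro s ⟨c, hc, rfl⟩
      rw [searchList_succ, List.mem_append, List.mem_flatMap] at hc
      rcases hc with hc | ⟨d, hd, hc⟩
      · exact hD c hc
      · exact (hpb d (hD d hd)).1 ⟨c, hc, rfl⟩
    · rw [predIter, ← ih.2]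
      refine upClosure_union_basis
        (F := fun s => {t | ∃ c ∈ searchList pb l n, ρ c = s ∧ t ∈ statesOf ρ (pb c)}) ?_ ?_
      · congr 1
        ext s
        constructor
        · rintro ⟨c, hc, rfl⟩
          rw [searchList_succ, List.mem_append, List.mem_flatMap] at hc
          rcases hc with hc | ⟨d, hd, hc⟩
          · exact .inl ⟨c, hc, rfl⟩
          · exact .inr (Set.mem_iUnion₂.2 ⟨ρ d, ⟨d, hd, rfl⟩, d, hd, rfl, c, hc, rfl⟩)
        · rintro (⟨c, hc, rfl⟩ | h)
          · exact ⟨c, List.mem_append_left _ hc, rfl⟩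
          · obtain ⟨-, -, d, hd, -, c, hc, rfl⟩ := Set.mem_iUnion₂.1 h
            exact ⟨c, List.mem_append_right _ (List.mem_flatMap.2 ⟨d, hd, hc⟩), rfl⟩
      · rintro s ⟨c, hc, rfl⟩
        rw [← (hpb c (hD c hc)).2]
        apply Set.Subset.antisymm
        · rintro x ⟨t, ⟨d, hd, hdc, ht⟩, htx⟩
          have h : x ∈ upClosure le (statesOf ρ (pb d)) := ⟨t, ht, htx⟩
          rwa [(hpb d (hD d hd)).2, hdc, ← (hpb c (hD c hc)).2] at h
        · exact upClosure_mono fun t ht => ⟨c, hc, rfl, ht⟩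

/-- The test whether the backward search is stationary at step `n`. -/
def stationaryB (leB : C → C → Bool) (pb : C → List C) (l : List C) (n : ℕ) : Bool :=
  (searchList pb l (n + 1)).all fun c => (searchList pb l n).any fun d => leB d c

theorem stationaryB_iff (hrefl : ∀ s, le s s)
    (htrans : ∀ s t r, le s t → le t r → le s r) {leB : C → C → Bool}
    (hle : ∀ c d, leB c d = true ↔ le (ρ c) (ρ d)) {pb : C → List C} {l : List C} {n : ℕ} :
    stationaryB leB pb l n = true ↔ upClosure le (statesOf ρ (searchList pb l n)) =
      upClosure le (statesOf ρ (searchList pb l (n + 1))) := by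
  have h1 : upClosure le (statesOf ρ (searchList pb l n)) ⊆
      upClosure le (statesOf ρ (searchList pb l (n + 1))) :=
    upClosure_mono fun s ⟨c, hc, hs⟩ => ⟨c, List.mem_append_left _ hc, hs⟩
  rw [Set.Subset.antisymm_iff, and_iff_right h1, upClosure_subset_iff hrefl htrans]
  simp only [stationaryB, List.all_eq_true, List.any_eq_true, hle]
  constructor
  · rintro h s ⟨c, hc, rfl⟩
    obtain ⟨d, hd, hdc⟩ := h c hc
    exact ⟨ρ d, ⟨d, hd, rfl⟩, hdc⟩
  · intro h c hc
    obtain ⟨s, ⟨d, hd, rfl⟩, hdc⟩ := h ⟨c, hc, rfl⟩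
    exact ⟨d, hd, hdc⟩

/-- The backward search, run until it becomes stationary. -/
def searchLimit (leB : C → C → Bool) (pb : C → List C) (l : List C) : Part (List C) :=
  (Nat.rfind fun n => Part.some (stationaryB leB pb l n)).map fun n => searchList pb l n

section Primrec

variable [Primcodable C]

theorem primrec_searchList {pb : C → List C} (hpb : Primrec pb) :
    Primrec fun p : List C × ℕ => searchList pb p.1 p.2 := by
  have h : Primrec₂ fun (_ : List C × ℕ) (p : ℕ × List C) => p.2 ++ p.2.flatMap pb := by
    unfold Primrec₂
    fun_prop
  exact Primrec.nat_rec' Primrec.snd Primrec.fst h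

theorem partrec_searchLimit {leB : C → C → Bool} (hle : Primrec fun p : C × C => leB p.1 p.2)
    {pb : C → List C} (hpb : Primrec pb) : Partrec (searchLimit leB pb) := by
  have h1 := primrec_searchList hpb
  have h2 : Primrec fun p : List C × ℕ => searchList pb p.1 (p.2 + 1) :=
    h1.comp (Primrec.pair Primrec.fst (Primrec.succ.comp Primrec.snd))
  have h3 : Primrec fun p : List C × ℕ => stationaryB leB pb p.1 p.2 := by
    unfold stationaryB
    refine primrec_all h2 (primrec_any (h1.comp Primrec.fst) ?_)
    exact hle.comp (Primrec.pair Primrec.snd (Primrec.snd.comp Primrec.fst))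
  refine Partrec.map (Partrec.rfind ?_) h1.to_comp.to₂
  exact h3.to_comp.partrec.to₂

end Primrec

/-- If the sequence `predIter` becomes stationary, then the search halts with a basis of its
limit. -/
theorem exists_mem_searchLimit (hrefl : ∀ s, le s s)
    (htrans : ∀ s t r, le s t → le t r → le s r) {leB : C → C → Bool}
    (hle : ∀ c d, leB c d = true ↔ le (ρ c) (ρ d)) {D : Set S} {pb : C → List C}
    (hpb : ∀ c, ρ c ∈ D → statesOf ρ (pb c) ⊆ D ∧
      upClosure le (statesOf ρ (pb c)) = upClosure le (pred R (upClosure le {ρ c})))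
    {l : List C} (hl : statesOf ρ l ⊆ D) {m : ℕ}
    (hm : predIter le R (upClosure le (statesOf ρ l)) m =
      predIter le R (upClosure le (statesOf ρ l)) (m + 1)) :
    ∃ J ∈ searchLimit leB pb l,
      upClosure le (statesOf ρ J) = predIter le R (upClosure le (statesOf ρ l)) m := by
  have h := fun n => (upClosure_searchList hpb hl n).2
  have hstat : ∀ n, stationaryB leB pb l n = true ↔
      predIter le R (upClosure le (statesOf ρ l)) n =
        predIter le R (upClosure le (statesOf ρ l)) (n + 1) := fun n => by
    rw [stationaryB_iff hrefl htrans hle, h, h]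
  have hdom : (Nat.rfind fun n => Part.some (stationaryB leB pb l n)).Dom :=
    Nat.rfind_dom.2 ⟨m, by rw [(hstat m).2 hm]; exact Part.mem_some _, fun _ => trivial⟩
  obtain ⟨n, hn⟩ := Part.dom_iff_mem.1 hdom
  refine ⟨_, Part.mem_map _ hn, ?_⟩
  rw [h]
  have hn' : true = stationaryB leB pb l n := Part.mem_some_iff.1 (Nat.rfind_spec hn)
  exact predIter_eq_of_stationary_of_stationary hm ((hstat n).1 hn'.symm)

end Algorithm

section Algorithm

universe u

variable {S : Type u} {le step : S → S → Prop} {C : Type} {ρ : C → S}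

/-- The transitions that start in `Q`. -/
def stepFrom (step : S → S → Prop) (Q : Set S) (s t : S) : Prop := s ∈ Q ∧ step s t

theorem predIn_eq (Q I : Set S) : predIn step Q I = pred (stepFrom step Q) I := by
  ext s
  exact ⟨fun ⟨⟨t, ht, h⟩, hs⟩ => ⟨t, ht, hs, h⟩, fun ⟨t, ht, hs, h⟩ => ⟨⟨t, ht, h⟩, hs⟩⟩

variable [Primcodable C] {Q : Set S} {leB : C → C → Bool} {pb : C → List C} {inQ : C → Bool}

/-- The restricted backward search always becomes stationary, so that its limit is a total
computable function. -/
theorem exists_computable_limit (hrefl : ∀ s, le s s)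
    (htrans : ∀ s t r, le s t → le t r → le s r)
    (hwqo : ∀ x : ℕ → S, (∀ n, x n ∈ Q) → ∃ i j, i < j ∧ le (x i) (x j))
    (hle : ∀ c d, leB c d = true ↔ le (ρ c) (ρ d)) (hleP : Primrec fun p : C × C => leB p.1 p.2)
    (hQ : ∀ c, inQ c = true ↔ ρ c ∈ Q) (hQP : Primrec inQ)
    (hpb : ∀ c, ρ c ∈ Q → statesOf ρ (pb c) ⊆ Q ∧
      upClosure le (statesOf ρ (pb c)) = upClosure le (predIn step Q (upClosure le {ρ c})))
    (hpbP : Primrec pb) :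
    ∃ lim : List C → List C, Computable lim ∧ ∀ l : List C, (∀ c ∈ l, ρ c ∈ Q) → ∃ m,
      predIter le (stepFrom step Q) (upClosure le (statesOf ρ l)) m =
        predIter le (stepFrom step Q) (upClosure le (statesOf ρ l)) (m + 1) ∧
      upClosure le (statesOf ρ (lim l)) =
        predIter le (stepFrom step Q) (upClosure le (statesOf ρ l)) m := by
  simp only [predIn_eq] at hpb
  have key : ∀ l : List C, ∃ J ∈ searchLimit leB pb (l.filter inQ), (∀ c ∈ l, ρ c ∈ Q) → ∃ m,
      predIter le (stepFrom step Q) (upClosure le (statesOf ρ l)) m =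
        predIter le (stepFrom step Q) (upClosure le (statesOf ρ l)) (m + 1) ∧
      upClosure le (statesOf ρ J) =
        predIter le (stepFrom step Q) (upClosure le (statesOf ρ l)) m := by
    intro l
    have hl : statesOf ρ (l.filter inQ) ⊆ Q := by
      rintro s ⟨c, hc, rfl⟩
      exact (hQ c).1 (List.mem_filter.1 hc).2
    have h := upClosure_searchList hpb hl
    obtain ⟨m, hm⟩ := exists_stationary hrefl htrans hwqo
      (fun n => statesOf ρ (searchList pb (l.filter inQ) n)) (fun n => (h n).1) (by
        intro n n' hn
        dsimp only
        rw [(h n).2, (h n').2]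
        exact predIter_mono hn)
    rw [(h m).2, (h (m + 1)).2] at hm
    obtain ⟨J, hJ, hJ'⟩ := exists_mem_searchLimit hrefl htrans hle hpb hl hm
    refine ⟨J, hJ, fun hlQ => ?_⟩
    have hfilter : l.filter inQ = l := List.filter_eq_self.2 fun c hc => (hQ c).2 (hlQ c hc)
    rw [hfilter] at hm hJ'
    exact ⟨m, hm, hJ'⟩
  choose lim hlim hspec using key
  refine ⟨lim, ?_, hspec⟩
  have hfilter : Primrec fun l : List C => l.filter inQ := by fun_prop
  exact ((partrec_searchLimit hleP hpbP).comp hfilter.to_comp).of_eq_tot hlim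

/-- If `Q` is closed under transitions, then the limit of the restricted backward search decides
the restricted coverability problem. -/
theorem restrictedCoverabilityDecidable_of_closed (hrefl : ∀ s, le s s)
    (htrans : ∀ s t r, le s t → le t r → le s r)
    (hcompat : ∀ s₁ s₂ t₁, le s₁ t₁ → step s₁ s₂ →
      ∃ t₂, Relation.ReflTransGen step t₁ t₂ ∧ le s₂ t₂)
    (hle : ∀ c d, leB c d = true ↔ le (ρ c) (ρ d)) (hleP : Primrec fun p : C × C => leB p.1 p.2)
    {lim : List C → List C} (hlim : Computable lim)
    (hspec : ∀ l : List C, (∀ c ∈ l, ρ c ∈ Q) → ∃ m,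
      predIter le (stepFrom step Q) (upClosure le (statesOf ρ l)) m =
        predIter le (stepFrom step Q) (upClosure le (statesOf ρ l)) (m + 1) ∧
      upClosure le (statesOf ρ (lim l)) =
        predIter le (stepFrom step Q) (upClosure le (statesOf ρ l)) m)
    (hclosed : ∀ s t, s ∈ Q → step s t → t ∈ Q) :
    RestrictedCoverabilityDecidable ρ step le Q := by
  have h1 : Primrec fun p : C × List C => p.2.any fun c => leB c p.1 :=
    primrec_any Primrec.snd
      (hleP.comp (Primrec.pair Primrec.snd (Primrec.fst.comp Primrec.fst)))
  have h2 : Primrec fun p : C × C => [p.2] := by fun_prop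
  refine ⟨fun p => (lim [p.2]).any fun c => leB c p.1,
    h1.to_comp.comp (Computable.fst.pair (hlim.comp h2.to_comp)), fun s t hs ht => ?_⟩
  obtain ⟨m, hm, hJ⟩ := hspec [t] (by simpa using ht)
  have h3 : (lim [t]).any (fun c => leB c s) = true ↔
      ρ s ∈ predIter le (stepFrom step Q) (upClosure le (statesOf ρ [t])) m := by
    rw [← hJ, List.any_eq_true]
    constructor
    · rintro ⟨c, hc, h⟩
      exact ⟨_, ⟨c, hc, rfl⟩, (hle _ _).1 h⟩
    · rintro ⟨-, ⟨c, hc, rfl⟩, h⟩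
      exact ⟨c, hc, (hle _ _).2 h⟩
  rw [h3]
  have hup : ∀ x, x ∈ upClosure le (statesOf ρ [t]) ↔ le (ρ t) x := by
    intro x
    constructor
    · rintro ⟨-, ⟨c, hc, rfl⟩, h⟩
      rwa [List.mem_singleton.1 hc] at h
    · exact fun h => ⟨_, ⟨t, by simp, rfl⟩, h⟩
  constructor
  · intro h
    obtain ⟨x, hx, hsx⟩ := coversSet_of_mem_predIter htrans hcompat (fun _ _ h => h.2) h
    refine ⟨x, ?_, (hup x).1 hx⟩
    have key : ∀ y, Relation.ReflTransGen step y x → y ∈ Q →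
        Relation.ReflTransGen (stepIn step Q) y x := by
      intro y hyx
      induction hyx using Relation.ReflTransGen.head_induction_on with
      | refl => exact fun _ => .refl
      | head h _ ih => exact fun hQ => .head ⟨hQ, hclosed _ _ hQ h, h⟩ (ih (hclosed _ _ hQ h))
    exact key _ hsx hs
  · rintro ⟨x, hsx, htx⟩
    exact mem_predIter_of_coversSet hrefl (fun _ _ h => ⟨h.1, h.2.2⟩) hm ⟨x, (hup x).2 htx, hsx⟩

end Algorithm

/-! ### Bases of predecessors of graphs -/

section Graphs

theorem subgraphOf_refl (G : Hypergraph Λ ar) : SubgraphOf G G :=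
  subgraphOf_iff_embeds.2 (Embeds.refl G)

theorem subgraphOf_trans (G H K : Hypergraph Λ ar) (h : SubgraphOf G H) (h' : SubgraphOf H K) :
    SubgraphOf G K :=
  subgraphOf_iff_embeds.2 ((subgraphOf_iff_embeds.1 h).trans (subgraphOf_iff_embeds.1 h'))

/-- The list `rules` of codes represents the set of rules `𝓡`. -/
structure RepresentsRules (rules : List (RuleCode Λ ar)) (𝓡 : Set (Rule Λ ar)) : Prop where
  exists_code : ∀ ρ ∈ rules, ∃ r : PMor ρ.1.1.graph ρ.1.2.graph, r.code = ρ.2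
  step_iff : ∀ G H, Step 𝓡 G H ↔ ∃ ρ ∈ rules, ∃ r : PMor ρ.1.1.graph ρ.1.2.graph,
    r.code = ρ.2 ∧ Rule.Rewrites ⟨_, _, r⟩ G H

/-- Every finite set of rules is represented by a list of codes, up to isomorphism of the rules. -/
theorem exists_representsRules {𝓡 : Set (Rule Λ ar)} (h𝓡 : 𝓡.Finite) :
    ∃ rules : List (RuleCode Λ ar), RepresentsRules rules 𝓡 := by
  choose L R r hr using Rule.exists_code (Λ := Λ) (ar := ar)
  refine ⟨h𝓡.toFinset.toList.map fun ρ => ((L ρ, R ρ), (r ρ).code), fun x hx => ?_,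
    fun G H => ⟨?_, ?_⟩⟩
  · obtain ⟨ρ, -, rfl⟩ := List.mem_map.1 hx
    exact ⟨r ρ, rfl⟩
  · rintro ⟨ρ, hρ, h⟩
    exact ⟨_, List.mem_map.2 ⟨ρ, by simpa using hρ, rfl⟩, r ρ, rfl, (hr ρ G H).1 h⟩
  · rintro ⟨x, hx, r', hr', h⟩
    obtain ⟨ρ, hρ, rfl⟩ := List.mem_map.1 hx
    obtain rfl := PMor.code_injective hr'
    exact ⟨ρ, by simpa using hρ, (hr ρ G H).2 h⟩

variable [Finite Λ] [Primcodable Λ]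

theorem RepresentsRules.mem_pred {rules : List (RuleCode Λ ar)} {𝓡 : Set (Rule Λ ar)}
    (h : RepresentsRules rules 𝓡) {T G : GraphCode Λ ar} (hG : G ∈ predList rules T) :
    G.graph ∈ pred (Step 𝓡) (upClosure SubgraphOf {T.graph}) := by
  obtain ⟨ρ, hρ, hG⟩ := List.mem_flatMap.1 hG
  have hG := (List.mem_filter.1 hG).2
  obtain ⟨r, hr⟩ := h.exists_code ρ hρ
  rw [← hr, rewritesAboveB_iff] at hG
  obtain ⟨H, hGH, hTH⟩ := hG
  exact ⟨H, ⟨_, rfl, hTH⟩, (h.step_iff _ _).2 ⟨ρ, hρ, r, hr, hGH⟩⟩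

/-- Every predecessor of a graph above `T` contains one from the list. -/
theorem RepresentsRules.exists_mem_predList {rules : List (RuleCode Λ ar)} {𝓡 : Set (Rule Λ ar)}
    (h : RepresentsRules rules 𝓡) {T : GraphCode Λ ar} {G : Hypergraph Λ ar}
    (hG : G ∈ pred (Step 𝓡) (upClosure SubgraphOf {T.graph})) :
    ∃ c ∈ predList rules T, SubgraphOf c.graph G := by
  obtain ⟨H, ⟨-, rfl, hTH⟩, hGH⟩ := hG
  obtain ⟨ρ, hρ, r, hr, hGH⟩ := (h.step_iff _ _).1 hGH
  obtain ⟨G₀, H₀, h1, h2, h3, h4, h5⟩ := hGH.exists_bounded (subgraphOf_iff_embeds.1 hTH)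
  have hV : ∀ e : GraphCode Λ ar, Nat.card e.graph.V = e.nV := fun e => Nat.card_fin _
  have hE : ∀ e : GraphCode Λ ar, Nat.card e.graph.E = e.nE := fun e => Nat.card_fin _
  rw [hV, hV] at h4
  rw [hE, hE] at h5
  obtain ⟨c, hc, hcG⟩ := exists_mem_graphsUpTo h4 h5
  have hid : Isomorphic H₀ H₀ := ⟨PMor.id _, PMor.total_id, PMor.isSubgraphMor_id⟩
  refine ⟨c, List.mem_flatMap.2 ⟨ρ, hρ, List.mem_filter.2 ⟨hc, ?_⟩⟩,
    subgraphOf_iff_embeds.2 (hcG.embeds.trans h1)⟩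
  rw [← hr, rewritesAboveB_iff]
  exact ⟨H₀, h2.congr_graphs hcG.symm hid, subgraphOf_iff_embeds.2 h3⟩

theorem RepresentsRules.upClosure_predList {rules : List (RuleCode Λ ar)} {𝓡 : Set (Rule Λ ar)}
    (h : RepresentsRules rules 𝓡) (T : GraphCode Λ ar) :
    upClosure SubgraphOf (statesOf GraphCode.graph (predList rules T)) =
      upClosure SubgraphOf (pred (Step 𝓡) (upClosure SubgraphOf {T.graph})) := by
  apply Set.Subset.antisymm
  · refine upClosure_mono ?_
    rintro s ⟨c, hc, rfl⟩
    exact h.mem_pred hc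
  · rw [upClosure_subset_iff subgraphOf_refl subgraphOf_trans]
    intro G hG
    obtain ⟨c, hc, hcG⟩ := h.exists_mem_predList hG
    exact ⟨_, ⟨c, hc, rfl⟩, hcG⟩

/-- A finite basis of the predecessors with bounded paths.  As these form a downward closed set, it
suffices to filter the basis of all predecessors. -/
noncomputable def predListIn (k : ℕ) (rules : List (RuleCode Λ ar)) (T : GraphCode Λ ar) :
    List (GraphCode Λ ar) :=
  (predList rules T).filter fun G => boundedPathB k G

theorem primrec_predListIn (k : ℕ) (rules : List (RuleCode Λ ar)) :
    Primrec (predListIn k rules) := by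
  unfold predListIn
  fun_prop

theorem RepresentsRules.upClosure_predListIn {rules : List (RuleCode Λ ar)}
    {𝓡 : Set (Rule Λ ar)} (h : RepresentsRules rules 𝓡) (k : ℕ) (T : GraphCode Λ ar) :
    statesOf GraphCode.graph (predListIn k rules T) ⊆ boundedPath Λ ar k ∧
    upClosure SubgraphOf (statesOf GraphCode.graph (predListIn k rules T)) =
      upClosure SubgraphOf (predIn (Step 𝓡) (boundedPath Λ ar k)
        (upClosure SubgraphOf {T.graph})) := by
  have hmem : ∀ c ∈ predListIn k rules T, c.graph ∈ boundedPath Λ ar k := fun c hc =>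
    boundedPathB_iff.1 (List.mem_filter.1 hc).2
  refine ⟨?_, Set.Subset.antisymm (upClosure_mono ?_) ?_⟩
  · rintro s ⟨c, hc, rfl⟩
    exact hmem c hc
  · rintro s ⟨c, hc, rfl⟩
    exact ⟨h.mem_pred (List.mem_filter.1 hc).1, hmem c hc⟩
  · rw [upClosure_subset_iff subgraphOf_refl subgraphOf_trans]
    rintro G ⟨hG, hGk⟩
    obtain ⟨c, hc, hcG⟩ := h.exists_mem_predList hG
    have := boundedPath_downward_closed (subgraphOf_iff_embeds.1 hcG) hGk
    exact ⟨_, ⟨c, List.mem_filter.2 ⟨hc, boundedPathB_iff.2 this⟩, rfl⟩, hcG⟩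

/-- Minimal pushout complement objects are minimal among those of bounded size, as every pushout
complement object contains one of bounded size. -/
theorem minimalPOCsComputable_subgraphOf : MinimalPOCsComputable ar SubgraphOf := by
  have hP : Primrec fun x :
      (GraphCode Λ ar × GraphCode Λ ar × GraphCode Λ ar) × MorCode × MorCode =>
      minPocList x.1.1 x.1.2.1 x.1.2.2 x.2.1 x.2.2 := by
    fun_prop
  refine ⟨_, hP.to_comp, fun L R S r m' _ => ?_⟩
  have hV : ∀ e : GraphCode Λ ar, Nat.card e.graph.V = e.nV := fun e => Nat.card_fin _
  have hE : ∀ e : GraphCode Λ ar, Nat.card e.graph.E = e.nE := fun e => Nat.card_fin _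
  have hmem : ∀ c ∈ pocList L R S r.code m'.code, IsPOC r m' c.graph := fun c hc =>
    pocB_iff.1 (List.mem_filter.1 hc).2
  -- below every pushout complement object there is one in the list
  have hbelow : ∀ G, IsPOC r m' G → ∃ c ∈ pocList L R S r.code m'.code, Embeds c.graph G := by
    intro G hG
    obtain ⟨G₀, h1, h2, h3, h4⟩ := hG.exists_bounded
    rw [hV, hV] at h3
    rw [hE, hE] at h4
    obtain ⟨c, hc, hcG⟩ := exists_mem_graphsUpTo h3 h4
    exact ⟨c, List.mem_filter.2 ⟨hc, pocB_iff.2 (h2.congr hcG.symm)⟩, hcG.embeds.trans h1⟩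
  have hmin : ∀ c, c ∈ minPocList L R S r.code m'.code ↔ c ∈ pocList L R S r.code m'.code ∧
      ∀ d ∈ pocList L R S r.code m'.code, Embeds d.graph c.graph → Embeds c.graph d.graph := by
    intro c
    simp only [minPocList, List.mem_filter, List.all_eq_true, Bool.or_eq_true, Bool.not_eq_true',
      ← Bool.not_eq_true, leB_iff, subgraphOf_iff_embeds, ← imp_iff_not_or]
  refine ⟨fun c hc => ?_, fun G hG => ?_⟩
  · obtain ⟨h1, h2⟩ := (hmin c).1 hc
    refine ⟨hmem c h1, fun G hG hGc => ?_⟩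
    rw [subgraphOf_iff_embeds] at hGc ⊢
    obtain ⟨d, hd, hdG⟩ := hbelow G hG
    exact (h2 d hd (hdG.trans hGc)).trans hdG
  · obtain ⟨c, hc, hcG⟩ := hbelow G hG.1
    have hGc : ∀ d ∈ pocList L R S r.code m'.code, Embeds d.graph G → Embeds G d.graph :=
      fun d hd hdG =>
        subgraphOf_iff_embeds.1 (hG.2 _ (hmem d hd) (subgraphOf_iff_embeds.2 hdG))
    refine ⟨c, (hmin c).2 ⟨hc, fun d hd hdc => ?_⟩, hcG.antisymm (hGc c hc hcG)⟩
    exact hcG.trans (hGc d hd (hdc.trans hcG))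

end Graphs

end GTS

theorem mainTheorem4 {Λ : Type} [Finite Λ] [Primcodable Λ] (ar : Λ → ℕ) :
    -- subgraph morphisms satisfy the conditions of the framework
    GTS.RepresentableBy (Λ := Λ) (ar := ar) GTS.SubgraphOf GTS.PMor.IsSubgraphMor ∧
    GTS.PreservedByTotalPushouts (Λ := Λ) (ar := ar) GTS.PMor.IsSubgraphMor ∧
    GTS.PushoutClosed (Λ := Λ) (ar := ar) GTS.PMor.IsSubgraphMor ∧
    -- minimal pushout complements are finite and computable
    GTS.MinimalPOCsComputable ar GTS.SubgraphOf ∧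
    ∀ (k : ℕ) (𝓡 : Set (GTS.Rule Λ ar)), 𝓡.Finite →
      GTS.IsRestrictedWSTS (GTS.GraphCode.graph (ar := ar)) (GTS.Step 𝓡) GTS.SubgraphOf
        (GTS.boundedPath Λ ar k) ∧
      GTS.DecidableOrder (GTS.GraphCode.graph (ar := ar)) GTS.SubgraphOf ∧
      -- effective bases
      GTS.HasEffectivePredBasis (GTS.GraphCode.graph (ar := ar)) (GTS.Step 𝓡) GTS.SubgraphOf ∧
      GTS.HasEffectiveQPredBasis (GTS.GraphCode.graph (ar := ar)) (GTS.Step 𝓡) GTS.SubgraphOf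
        (GTS.boundedPath Λ ar k) ∧
      -- (i) the case in which all graphs are allowed
      (GTS.boundedPath Λ ar k = Set.univ →
        (∀ G H, GTS.Covers (GTS.Step 𝓡) GTS.SubgraphOf G H ↔
          GTS.Covers (GTS.stepIn (GTS.Step 𝓡) (GTS.boundedPath Λ ar k)) GTS.SubgraphOf G H) ∧
        GTS.GeneralCoverabilityDecidable (GTS.GraphCode.graph (ar := ar)) (GTS.Step 𝓡)
          GTS.SubgraphOf ∧
        GTS.RestrictedCoverabilityDecidable (GTS.GraphCode.graph (ar := ar)) (GTS.Step 𝓡)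
          GTS.SubgraphOf (GTS.boundedPath Λ ar k)) ∧
      -- (ii) the case in which the bounded graphs are closed under reachability
      ((∀ G H, G ∈ GTS.boundedPath Λ ar k → GTS.Step 𝓡 G H → H ∈ GTS.boundedPath Λ ar k) →
        GTS.RestrictedCoverabilityDecidable (GTS.GraphCode.graph (ar := ar)) (GTS.Step 𝓡)
          GTS.SubgraphOf (GTS.boundedPath Λ ar k)) ∧
      -- (iii) the restricted backward search terminates, with a correct result
      (∀ pb : GTS.Hypergraph Λ ar → Set (GTS.Hypergraph Λ ar),
        GTS.IsQPredBasis (GTS.Step 𝓡) GTS.SubgraphOf (GTS.boundedPath Λ ar k) pb →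
        ∀ B : Set (GTS.Hypergraph Λ ar), B.Finite → B ⊆ GTS.boundedPath Λ ar k →
          (∃ m, GTS.StationaryAt GTS.SubgraphOf pb B m) ∧
          ∀ m, GTS.StationaryAt GTS.SubgraphOf pb B m → ∀ G,
            (G ∈ GTS.upClosure GTS.SubgraphOf (GTS.backSeq pb B m) →
              GTS.CoversSet (GTS.Step 𝓡) G (GTS.upClosure GTS.SubgraphOf B)) ∧
            (G ∉ GTS.upClosure GTS.SubgraphOf (GTS.backSeq pb B m) →
              ¬ GTS.CoversSet (GTS.stepIn (GTS.Step 𝓡) (GTS.boundedPath Λ ar k)) G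
                (GTS.upClosure GTS.SubgraphOf B))) ∧
      -- the limit of the restricted backward search is computable
      (∃ lim : List (GTS.GraphCode Λ ar) → List (GTS.GraphCode Λ ar), Computable lim ∧
        ∀ pb : GTS.Hypergraph Λ ar → Set (GTS.Hypergraph Λ ar),
          GTS.IsQPredBasis (GTS.Step 𝓡) GTS.SubgraphOf (GTS.boundedPath Λ ar k) pb →
          ∀ B : List (GTS.GraphCode Λ ar), (∀ c ∈ B, c.graph ∈ GTS.boundedPath Λ ar k) →
            ∀ m, GTS.StationaryAt GTS.SubgraphOf pb (GTS.statesOf GTS.GraphCode.graph B) m →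
              GTS.upClosure GTS.SubgraphOf (GTS.statesOf GTS.GraphCode.graph (lim B)) =
                GTS.upClosure GTS.SubgraphOf
                  (GTS.backSeq pb (GTS.statesOf GTS.GraphCode.graph B) m)) ∧
      -- (iv) the general backward search is correct whenever it becomes stationary
      (∀ pb : GTS.Hypergraph Λ ar → Set (GTS.Hypergraph Λ ar),
        GTS.IsPredBasis (GTS.Step 𝓡) GTS.SubgraphOf pb →
        ∀ B : Set (GTS.Hypergraph Λ ar), B.Finite →
          ∀ m, GTS.StationaryAt GTS.SubgraphOf pb B m → ∀ G,
            (GTS.CoversSet (GTS.Step 𝓡) G (GTS.upClosure GTS.SubgraphOf B) ↔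
              G ∈ GTS.upClosure GTS.SubgraphOf (GTS.backSeq pb B m))) ∧
      -- the limit of the general backward search is computable whenever it exists
      (∃ lim : List (GTS.GraphCode Λ ar) →. List (GTS.GraphCode Λ ar), Partrec lim ∧
        ∀ pb : GTS.Hypergraph Λ ar → Set (GTS.Hypergraph Λ ar),
          GTS.IsPredBasis (GTS.Step 𝓡) GTS.SubgraphOf pb →
          ∀ (B : List (GTS.GraphCode Λ ar)) (m : ℕ),
            GTS.StationaryAt GTS.SubgraphOf pb (GTS.statesOf GTS.GraphCode.graph B) m →
              ∃ J ∈ lim B,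
                GTS.upClosure GTS.SubgraphOf (GTS.statesOf GTS.GraphCode.graph J) =
                  GTS.upClosure GTS.SubgraphOf
                    (GTS.backSeq pb (GTS.statesOf GTS.GraphCode.graph B) m)) := by
  refine ⟨GTS.representableBy_isSubgraphMor, GTS.preservedByTotalPushouts_isSubgraphMor,
    GTS.pushoutClosed_isSubgraphMor, GTS.minimalPOCsComputable_subgraphOf, fun k 𝓡 h𝓡 => ?_⟩
  obtain ⟨rules, hrules⟩ := GTS.exists_representsRules h𝓡
  have hrefl := GTS.subgraphOf_refl (Λ := Λ) (ar := ar)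
  have htrans := GTS.subgraphOf_trans (Λ := Λ) (ar := ar)
  have hcompat : ∀ s₁ s₂ t₁, GTS.SubgraphOf s₁ t₁ → GTS.Step 𝓡 s₁ s₂ →
      ∃ t₂, Relation.ReflTransGen (GTS.Step 𝓡) t₁ t₂ ∧ GTS.SubgraphOf s₂ t₂ := by
    intro s₁ s₂ t₁ hle hstep
    obtain ⟨t₂, h1, h2⟩ := hstep.exists_of_embeds (GTS.subgraphOf_iff_embeds.1 hle)
    exact ⟨t₂, .single h1, GTS.subgraphOf_iff_embeds.2 h2⟩
  have hwqo := GTS.exists_subgraphOf_of_boundedPath (Λ := Λ) (ar := ar) k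
  have hle : ∀ c d : GTS.GraphCode Λ ar, GTS.leB c d = true ↔ GTS.SubgraphOf c.graph d.graph :=
    fun _ _ => GTS.leB_iff
  have hleP : Primrec fun p : GTS.GraphCode Λ ar × GTS.GraphCode Λ ar => GTS.leB p.1 p.2 := by
    fun_prop
  have hQP : Primrec fun c : GTS.GraphCode Λ ar => GTS.boundedPathB k c := by fun_prop
  have hpbP : Primrec (GTS.predList rules) := by fun_prop
  have hpb : ∀ c : GTS.GraphCode Λ ar, c.graph ∈ Set.univ →
      GTS.statesOf GTS.GraphCode.graph (GTS.predList rules c) ⊆ Set.univ ∧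
      GTS.upClosure GTS.SubgraphOf (GTS.statesOf GTS.GraphCode.graph (GTS.predList rules c)) =
        GTS.upClosure GTS.SubgraphOf
          (GTS.pred (GTS.Step 𝓡) (GTS.upClosure GTS.SubgraphOf {c.graph})) :=
    fun c _ => ⟨Set.subset_univ _, hrules.upClosure_predList c⟩
  obtain ⟨lim, hlim, hspec⟩ := GTS.exists_computable_limit hrefl htrans hwqo hle hleP
    (fun _ => GTS.boundedPathB_iff) hQP (fun c _ => hrules.upClosure_predListIn k c)
    (GTS.primrec_predListIn k rules)
  -- both backward searches compute `predIter`
  have hback := fun (pb : GTS.Hypergraph Λ ar → Set (GTS.Hypergraph Λ ar))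
      (h : GTS.IsQPredBasis (GTS.Step 𝓡) GTS.SubgraphOf (GTS.boundedPath Λ ar k) pb)
      (B : Set (GTS.Hypergraph Λ ar)) (hB : B ⊆ GTS.boundedPath Λ ar k) =>
    GTS.upClosure_backSeq (R := GTS.stepFrom (GTS.Step 𝓡) (GTS.boundedPath Λ ar k))
      (fun s hs => ⟨(h s hs).2.1, by rw [← GTS.predIn_eq]; exact (h s hs).2.2⟩) hB
  have hback' := fun (pb : GTS.Hypergraph Λ ar → Set (GTS.Hypergraph Λ ar))
      (h : GTS.IsPredBasis (GTS.Step 𝓡) GTS.SubgraphOf pb) (B : Set (GTS.Hypergraph Λ ar)) n =>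
    (GTS.upClosure_backSeq (D := Set.univ)
      (fun s _ => ⟨Set.subset_univ _, (h s).2⟩) (Set.subset_univ B) n).2
  have hrestricted : (∀ G H, G ∈ GTS.boundedPath Λ ar k → GTS.Step 𝓡 G H →
      H ∈ GTS.boundedPath Λ ar k) → GTS.RestrictedCoverabilityDecidable
        (GTS.GraphCode.graph (ar := ar)) (GTS.Step 𝓡) GTS.SubgraphOf (GTS.boundedPath Λ ar k) :=
    GTS.restrictedCoverabilityDecidable_of_closed hrefl htrans hcompat hle hleP hlim hspec
  refine ⟨⟨fun s t h => GTS.boundedPath_downward_closed (GTS.subgraphOf_iff_embeds.1 h), ?_, hrefl,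
    htrans, hwqo, hcompat⟩, ?_, ⟨_, hpbP.to_comp, fun c => (hpb c trivial).2⟩,
    ⟨_, (GTS.primrec_predListIn k rules).to_comp, fun c _ => hrules.upClosure_predListIn k c⟩,
    fun huniv => ?_, hrestricted, fun pb hpbQ B hBfin hB => ⟨?_, fun m hm G => ⟨fun hG => ?_,
      fun hG hcov => hG ?_⟩⟩, ⟨lim, hlim, fun pb hpbQ B hB m hm => ?_⟩,
    fun pb hpb' B hBfin m hm G => ⟨fun hG => ?_, fun hG => ?_⟩,
    ⟨_, GTS.partrec_searchLimit hleP hpbP, fun pb hpb' B m hm => ?_⟩⟩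
  · exact ComputablePred.computable_iff.2 ⟨_, hQP.to_comp, funext fun c =>
      propext GTS.boundedPathB_iff.symm⟩
  · exact ComputablePred.computable_iff.2 ⟨_, hleP.to_comp, funext fun p =>
      propext GTS.leB_iff.symm⟩
  · have hstep : GTS.stepIn (GTS.Step 𝓡) (GTS.boundedPath Λ ar k) = GTS.Step 𝓡 := by
      rw [huniv]
      funext G H
      exact propext ⟨fun h => h.2.2, fun h => ⟨trivial, trivial, h⟩⟩
    have hmem : ∀ G, G ∈ GTS.boundedPath Λ ar k := fun G => huniv ▸ Set.mem_univ G
    have hres := hrestricted fun _ H _ _ => hmem H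
    refine ⟨fun G H => by rw [hstep], ?_, hres⟩
    obtain ⟨d, hd, hd'⟩ := hres
    refine ComputablePred.computable_iff.2 ⟨d, hd, funext fun p => propext ?_⟩
    rw [← hstep]
    exact (hd' p.1 p.2 (hmem _) (hmem _)).symm
  · refine GTS.exists_stationary hrefl htrans hwqo _ (fun n => (hback pb hpbQ B hB n).1) ?_
    intro n n' hn
    dsimp only
    rw [(hback pb hpbQ B hB n).2, (hback pb hpbQ B hB n').2]
    exact GTS.predIter_mono hn
  · rw [(hback pb hpbQ B hB m).2] at hG
    exact GTS.coversSet_of_mem_predIter htrans hcompat (fun _ _ h => h.2) hG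
  · rw [GTS.StationaryAt, (hback pb hpbQ B hB m).2, (hback pb hpbQ B hB (m + 1)).2] at hm
    rw [(hback pb hpbQ B hB m).2]
    exact GTS.mem_predIter_of_coversSet hrefl (fun _ _ h => ⟨h.1, h.2.2⟩) hm hcov
  · have hB' : GTS.statesOf GTS.GraphCode.graph B ⊆ GTS.boundedPath Λ ar k := by
      rintro s ⟨c, hc, rfl⟩
      exact hB c hc
    have h := hback pb hpbQ _ hB'
    rw [GTS.StationaryAt, (h m).2, (h (m + 1)).2] at hm
    obtain ⟨n, hn, hJ⟩ := hspec B hB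
    rw [hJ, (h m).2]
    exact GTS.predIter_eq_of_stationary_of_stationary hm hn
  · rw [GTS.StationaryAt, hback' pb hpb', hback' pb hpb'] at hm
    rw [hback' pb hpb']
    exact GTS.mem_predIter_of_coversSet hrefl (fun _ _ h => h) hm hG
  · rw [hback' pb hpb'] at hG
    exact GTS.coversSet_of_mem_predIter htrans hcompat (fun _ _ h => h) hG
  · rw [GTS.StationaryAt, hback' pb hpb', hback' pb hpb'] at hm
    rw [hback' pb hpb']
    exact GTS.exists_mem_searchLimit hrefl htrans hle hpb (Set.subset_univ _) hm
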